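/- **Setting.** Let $n\ge 1$, let $p_0\ge p_1\ge\dots\ge p_n\ge 1$ be integers, $N=p_0+\dots+p_n$, and write $x=(x^{(p_0)},\dots,x^{(p_n)})\in\mathbb{R}^{p_0}\times\dots\times\mathbb{R}^{p_n}=\mathbb{R}^N$, $z=(x,t)\in\mathbb{R}^{N+1}$. Let $B\in\mathbb{R}^{N\times N}$ be the block matrix whose only nonzero blocks are those directly above the diagonal, $\mathbb{B}_1,\dots,\mathbb{B}_n$, where $\mathbb{B}_j$ is of size $p_{j-1}\times p_j$ and has rank $p_j$. Put $Q=\sum_{i=0}^n(2i+1)p_i$, $E(\sigma)=\exp(-\sigma B^T)$, $(x,t)\circ(\xi,\tau)=(\xi+E(\tau)x,\,t+\tau)$ and $|x|_B=\sum_{i=0}^n|x^{(p_i)}|^{1/(2i+1)}$. For $\rho>0$ and $t_1<t_2$ let $$\mathcal{Q}^{t_1,t_2}_\rho(z_0)=z_0\circ\big(\{x\in\mathbb{R}^N:|x|_B<\rho\}\times(t_1,t_2)\big).$$ Let $\sigma_0=\min_{|x|=1}|x|_B$, $\bar\sigma=\max_{|x|=1}|x|_B$, and fix a constant $b_B$ with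 $0<b_B\le(\sigma_0/\bar\sigma)^2$ and $\|E(\sigma)\|\le 2$ for all $|\sigma|\le b_B$. For $K,r>0$ put $$\mathcal{Q}^1_r(z_0)=\mathcal{Q}^{-b_Br^2,0}_{Kr}(z_0),\qquad \mathcal{Q}^2_r(z_0)=\mathcal{Q}^{-\frac14 b_Br^2,0}_{\sigma_0r}(z_0),\qquad \mathcal{Q}^3_r(z_0)=\mathcal{Q}^{-b_Br^2,-\frac12 b_Br^2}_{\sigma_0r}(z_0).$$ For an open set $\Omega\subseteq\mathbb{R}^{N+1}$ consider $$\mathcal{L}_A=\mathrm{tr}\big(A(z)D_x^2\big)+\langle x,B\nabla_x\rangle-\partial_t,\qquad A(z)=\begin{bmatrix}\mathbb{A}(z)&0\\0&0\end{bmatrix},\quad z\in\Omega,$$ with $\mathbb{A}(z)\in\mathbb{R}^{p_0\times p_0}$ symmetric. The Cordes-Landis condition (H1) with constants $\lambda,\Lambda>0$ says that $\lambda\mathbb{I}_{p_0}\le\mathbb{A}(z)\le\Lambda\mathbb{I}_{p_0}$ for all $z\in\Omega$ and $\Lambda/\lambda<1+2/Q$. **Theorem (growth lemma under H1).** Given $n$,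 $p_0,\dots,p_n$, $B$, $b_B$, $\lambda,\Lambda$ as above, there is a constant $K_0>\sigma_0$, depending only on these data, such that for every $K>K_0$ there is a constant $\eta>0$, depending only on these data and on $K$, with the following property. Let $\Omega\subseteq\mathbb{R}^{N+1}$ be open, let $\mathcal{L}_A$ satisfy (H1) in $\Omega$ with the constants $\lambda,\Lambda$, let $z_0\in\Omega$ and $r>0$, and let $D$ be an open set with $D\subseteq\mathcal{Q}^1_r(z_0)\subseteq\Omega$ and $D\cap\mathcal{Q}^2_r(z_0)\ne\emptyset$. Suppose that $u\in C^2(D)\cap C(\overline D)$ is nonnegative in $D$, vanishes on $\partial D\cap\mathcal{Q}^1_r(z_0)$, and satisfies $\mathcal{L}_Au\ge 0$ in $D$. Then $$\sup_D u\ \ge\ \Big(1+\eta\,\frac{|\mathcal{Q}^3_r(z_0)\setminus D|}{|\mathcal{Q}^3_r(z_0)|}\Big)\sup_{D\cap\mathcal{Q}^2_r(z_0)}u .$$ -/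

import Mathlib

namespace Kolmogorov

noncomputable section

/-- The space `ℝ^N = ℝ^{p₀} × ⋯ × ℝ^{pₙ}` with its Euclidean norm. The coordinate `⟨i, a⟩` is the
`a`-th coordinate of the `i`-th block, so `N = p₀ + ⋯ + pₙ`. -/
abbrev Space {n : ℕ} (p : Fin (n + 1) → ℕ) : Type :=
  EuclideanSpace ℝ (Σ i : Fin (n + 1), Fin (p i))

/-- Space-time `ℝ^{N+1}`, with points `z = (x, t)`. -/
abbrev SpaceTime {n : ℕ} (p : Fin (n + 1) → ℕ) : Type := Space p × ℝ

/-- Square `N × N` matrices, with rows and columns split in blocks. -/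
abbrev BlockMatrix {n : ℕ} (p : Fin (n + 1) → ℕ) : Type :=
  Matrix (Σ i : Fin (n + 1), Fin (p i)) (Σ i : Fin (n + 1), Fin (p i)) ℝ

/-- The block of `M` in block-row `i` and block-column `k`, a `pᵢ × pₖ` matrix. -/
def block {n : ℕ} {p : Fin (n + 1) → ℕ} (M : BlockMatrix p) (i k : Fin (n + 1)) :
    Matrix (Fin (p i)) (Fin (p k)) ℝ :=
  M.submatrix (fun a => ⟨i, a⟩) (fun c => ⟨k, c⟩)

/-- The standing assumptions on the drift matrix `B`: there are `n + 1 ≥ 2` diagonal blocks, of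
sizes `p₀ ≥ p₁ ≥ ⋯ ≥ pₙ ≥ 1`; the only blocks of `B` that may be nonzero are those directly above
the diagonal, and the one in block-row `j - 1` and block-column `j` has rank `pⱼ`, `1 ≤ j ≤ n`. -/
structure IsDriftMatrix {n : ℕ} (p : Fin (n + 1) → ℕ) (B : BlockMatrix p) : Prop where
  one_le_n : 1 ≤ n
  antitone : Antitone p
  one_le_last : 1 ≤ p (Fin.last n)
  block_eq_zero : ∀ i k : Fin (n + 1), (k : ℕ) ≠ (i : ℕ) + 1 → block B i k = 0
  rank_block : ∀ j : Fin n, (block B j.castSucc j.succ).rank = p j.succ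

/-- `Q = p₀ + 3 p₁ + ⋯ + (2n + 1) pₙ`. -/
def homDim {n : ℕ} (p : Fin (n + 1) → ℕ) : ℕ := ∑ i : Fin (n + 1), (2 * (i : ℕ) + 1) * p i

/-- `E(σ) = exp(-σ Bᵀ)` as an operator on `ℝ^N`. -/
def expFlow {n : ℕ} {p : Fin (n + 1) → ℕ} (B : BlockMatrix p) (σ : ℝ) :
    Space p →L[ℝ] Space p :=
  Matrix.toEuclideanCLM (𝕜 := ℝ) (NormedSpace.exp (-(σ • B.transpose)))

/-- The group law `(x, t) ∘ (ξ, τ) = (ξ + E(τ) x, t + τ)`. -/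
def groupMul {n : ℕ} {p : Fin (n + 1) → ℕ} (B : BlockMatrix p) (z ζ : SpaceTime p) :
    SpaceTime p :=
  (ζ.1 + expFlow B ζ.2 z.1, z.2 + ζ.2)

/-- The `i`-th block `x^{(pᵢ)}` of `x`. -/
def blockVec {n : ℕ} {p : Fin (n + 1) → ℕ} (x : Space p) (i : Fin (n + 1)) :
    EuclideanSpace ℝ (Fin (p i)) :=
  WithLp.toLp 2 (fun a => x ⟨i, a⟩)

/-- The homogeneous norm `|x|_B = ∑ᵢ |x^{(pᵢ)}|^{1/(2i+1)}` on `ℝ^N`. -/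
def homNorm {n : ℕ} {p : Fin (n + 1) → ℕ} (x : Space p) : ℝ :=
  ∑ i : Fin (n + 1), ‖blockVec x i‖ ^ ((1 : ℝ) / (2 * (i : ℕ) + 1))

/-- `σ₀`, the minimum of `|x|_B` over the Euclidean unit sphere. -/
def sigmaMin {n : ℕ} (p : Fin (n + 1) → ℕ) : ℝ :=
  sInf (homNorm '' Metric.sphere (0 : Space p) 1)

/-- `σ̄`, the maximum of `|x|_B` over the Euclidean unit sphere. -/
def sigmaMax {n : ℕ} (p : Fin (n + 1) → ℕ) : ℝ :=
  sSup (homNorm '' Metric.sphere (0 : Space p) 1)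

/-- The cylinder-like set `𝒬_r^{t₁,t₂}(z₀) = z₀ ∘ ({x : |x|_B < r} × (t₁, t₂))`. -/
def cylinder {n : ℕ} {p : Fin (n + 1) → ℕ} (B : BlockMatrix p) (r t₁ t₂ : ℝ)
    (z₀ : SpaceTime p) : Set (SpaceTime p) :=
  groupMul B z₀ '' ({x : Space p | homNorm x < r} ×ˢ Set.Ioo t₁ t₂)

/-- Admissible choices of the constant `b_B`: `0 < b ≤ (σ₀/σ̄)²` and `‖E(σ)‖ ≤ 2` (Euclidean
operator norm) for `|σ| ≤ b`. -/
def IsTimeConstant {n : ℕ} {p : Fin (n + 1) → ℕ} (B : BlockMatrix p) (b : ℝ) : Prop :=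
  0 < b ∧ b ≤ (sigmaMin p / sigmaMax p) ^ 2 ∧ ∀ σ : ℝ, |σ| ≤ b → ‖expFlow B σ‖ ≤ 2

/-- `𝒬¹_r(z₀) = 𝒬_{K r}^{-b r², 0}(z₀)`. -/
def cyl1 {n : ℕ} {p : Fin (n + 1) → ℕ} (B : BlockMatrix p) (b K r : ℝ) (z₀ : SpaceTime p) :
    Set (SpaceTime p) :=
  cylinder B (K * r) (-(b * r ^ 2)) 0 z₀

/-- `𝒬²_r(z₀) = 𝒬_{σ₀ r}^{-b r²/4, 0}(z₀)`. -/
def cyl2 {n : ℕ} {p : Fin (n + 1) → ℕ} (B : BlockMatrix p) (b r : ℝ) (z₀ : SpaceTime p) :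
    Set (SpaceTime p) :=
  cylinder B (sigmaMin p * r) (-(1 / 4 * b * r ^ 2)) 0 z₀

/-- `𝒬³_r(z₀) = 𝒬_{σ₀ r}^{-b r², -b r²/2}(z₀)`. -/
def cyl3 {n : ℕ} {p : Fin (n + 1) → ℕ} (B : BlockMatrix p) (b r : ℝ) (z₀ : SpaceTime p) :
    Set (SpaceTime p) :=
  cylinder B (sigmaMin p * r) (-(b * r ^ 2)) (-(1 / 2 * b * r ^ 2)) z₀

/-- The partial derivative `∂_{x_j} u`. -/
def partialX {n : ℕ} {p : Fin (n + 1) → ℕ} (j : Σ i : Fin (n + 1), Fin (p i))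
    (u : SpaceTime p → ℝ) (z : SpaceTime p) : ℝ :=
  fderiv ℝ u z (EuclideanSpace.single j 1, 0)

/-- The partial derivative `∂_t u`. -/
def partialT {n : ℕ} {p : Fin (n + 1) → ℕ} (u : SpaceTime p → ℝ) (z : SpaceTime p) : ℝ :=
  fderiv ℝ u z (0, 1)

/-- The spatial Hessian `D² u`. -/
def hessianX {n : ℕ} {p : Fin (n + 1) → ℕ} (u : SpaceTime p → ℝ) (z : SpaceTime p) :
    BlockMatrix p :=
  Matrix.of fun i j => partialX i (partialX j u) z

/-- The operator `ℒ_A u = tr(A(z) D² u) + ⟨x, B ∇u⟩ - ∂_t u`. -/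
def opL {n : ℕ} {p : Fin (n + 1) → ℕ} (B : BlockMatrix p) (A : SpaceTime p → BlockMatrix p)
    (u : SpaceTime p → ℝ) (z : SpaceTime p) : ℝ :=
  (A z * hessianX u z).trace + (z.1 : _ → ℝ) ⬝ᵥ (B.mulVec fun j => partialX j u z)
    - partialT u z

/-- The coefficient matrix is, at every point of `Ω`, zero outside its upper left `p₀ × p₀` block
`𝔸(z)`, and `λ I ≤ 𝔸(z) ≤ Λ I` for symmetric matrices. -/
def IsCoefficient {n : ℕ} {p : Fin (n + 1) → ℕ} (Ω : Set (SpaceTime p)) (lam Lam : ℝ)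
    (A : SpaceTime p → BlockMatrix p) : Prop :=
  ∀ z ∈ Ω,
    (∀ i k : Fin (n + 1), (i ≠ 0 ∨ k ≠ 0) → block (A z) i k = 0) ∧
    (block (A z) 0 0).IsSymm ∧
    (block (A z) 0 0 - lam • (1 : Matrix (Fin (p 0)) (Fin (p 0)) ℝ)).PosSemidef ∧
    (Lam • (1 : Matrix (Fin (p 0)) (Fin (p 0)) ℝ) - block (A z) 0 0).PosSemidef

/-- The Cordes-Landis condition on the coefficients in `Ω`, with ellipticity constants `λ, Λ`. -/
def CordesLandis {n : ℕ} {p : Fin (n + 1) → ℕ} (Ω : Set (SpaceTime p)) (lam Lam : ℝ)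
    (A : SpaceTime p → BlockMatrix p) : Prop :=
  0 < lam ∧ 0 < Lam ∧ IsCoefficient Ω lam Lam A ∧ Lam / lam < 1 + 2 / (homDim p : ℝ)

end

end Kolmogorov

namespace Kolmogorov

noncomputable section

open Set Filter Topology MeasureTheory

/-! Left translations and dilations reduce the statement to z₀ = 0 and r = 1, since `ℒ` is
compatible with both. There `u` is compared with the potential of the set E = 𝒬³ \ D.

The kernel. Let C = ∫₀¹ E(σ) A₀ E(σ)ᵀ dσ be the controllability Gramian, A₀ the projection on the
first block, and P = C⁻¹. The rank condition makes C positive definite (`posDef_gramian`); it solves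
a Lyapunov equation (`gramian_lyapunov`), which also yields tr(A₀ P) = Q (`exists_lyapunov`). Let
q(x, t) be the quadratic form of P rescaled by powers of t. With s = ΛQ/(2λ) and κ = 1/(4λ), the
function f = -s log t - κ q satisfies ⟨A∇f, ∇f⟩ + ℒ_A f ≥ 0 for all admissible A at once. Hence Ψ(f)
is a subsolution for t > 0 as soon as Ψ'' ≥ Ψ' ≥ 0. The choice Ψ = exp would give a Gaussian;
`cutExp` is a truncation of it that vanishes where f ≤ f₀, so that the kernel is C² off the origin
and zero for large x.

The potential. The integral in x of t^{-s} e^{-κq} is a multiple of t^{Q/2-s}. The Cordes-Landis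
condition says exactly that s < Q/2 + 1, that is, that this power is integrable at t = 0. Hence the
potential U of E is at most C (t + b)^θ with θ = Q/2 + 1 - s > 0 (`exists_potential_le`). Moreover U
is a subsolution in D, vanishes for |x|_B > K₀ (`exists_logKernel_le`), and is at least c|E| on 𝒬²,
which lies at a time lag of at least b/4 after 𝒬³.

The comparison (`growth_of_potential`). Put m = sup u and C₁ = C b^θ. The subsolution u + (m/C₁) U
is at most m on the parabolic boundary of D: at the bottom U tends to 0, on the lateral side U = 0,
and elsewhere u = 0 and U ≤ C₁. The maximum principle `le_of_subsolution` gives u ≤ m (1 - c|E|/C₁)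
on D ∩ 𝒬², and (1 + x)(1 - x) ≤ 1 concludes. -/

/-- The generator `-Bᵀ` of the flow `expFlow`, as a continuous linear map. -/
def flowGen {n : ℕ} {p : Fin (n + 1) → ℕ} (B : BlockMatrix p) : Space p →L[ℝ] Space p :=
  Matrix.toEuclideanCLM (𝕜 := ℝ) (-B.transpose)

theorem flowGen_apply {n : ℕ} {p : Fin (n + 1) → ℕ} (B : BlockMatrix p) (x : Space p) :
    flowGen B x = WithLp.toLp 2 (-(B.transpose.mulVec x.ofLp)) := by
  ext i
  simp [flowGen]

theorem expFlow_eq_exp {n : ℕ} {p : Fin (n + 1) → ℕ} (B : BlockMatrix p) (σ : ℝ) :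
    expFlow B σ = NormedSpace.exp (σ • flowGen B) := by
  -- A norm on matrices is chosen locally, to place both exponentials in normed algebras.
  let _ : NormedRing (BlockMatrix p) := Matrix.linftyOpNormedRing
  let _ : NormedAlgebra ℝ (BlockMatrix p) := Matrix.linftyOpNormedAlgebra
  let _ : NormedAlgebra ℚ (BlockMatrix p) := NormedAlgebra.restrictScalars ℚ ℝ _
  have hc : Continuous (Matrix.toEuclideanCLM (𝕜 := ℝ) (n := Σ i : Fin (n + 1), Fin (p i))) :=
    LinearMap.continuous_of_finiteDimensional
      (Matrix.toEuclideanCLM (𝕜 := ℝ) (n := Σ i : Fin (n + 1), Fin (p i))).toAlgEquiv.toLinearMap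
  unfold expFlow flowGen
  refine (NormedSpace.map_exp (Matrix.toEuclideanCLM (𝕜 := ℝ)
    (n := Σ i : Fin (n + 1), Fin (p i))) hc (-(σ • B.transpose))).trans ?_
  congr 1
  rw [← smul_neg]
  exact map_smul (Matrix.toEuclideanCLM (𝕜 := ℝ) (n := Σ i : Fin (n + 1), Fin (p i))) σ _

theorem expFlow_zero {n : ℕ} {p : Fin (n + 1) → ℕ} (B : BlockMatrix p) :
    expFlow B 0 = ContinuousLinearMap.id ℝ (Space p) := by
  have h : (0 : ℝ) • flowGen B = 0 :=
    ContinuousLinearMap.ext fun x => zero_smul ℝ (flowGen B x)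
  rw [expFlow_eq_exp, h]
  exact NormedSpace.exp_zero

theorem expFlow_add {n : ℕ} {p : Fin (n + 1) → ℕ} (B : BlockMatrix p) (s t : ℝ) :
    expFlow B (s + t) = (expFlow B s).comp (expFlow B t) := by
  let _ : NormedAlgebra ℚ (Space p →L[ℝ] Space p) := NormedAlgebra.restrictScalars ℚ ℝ _
  have h : (s + t) • flowGen B = s • flowGen B + t • flowGen B :=
    ContinuousLinearMap.ext fun x => add_smul s t (flowGen B x)
  rw [expFlow_eq_exp, expFlow_eq_exp, expFlow_eq_exp, h]
  exact NormedSpace.exp_add_of_commute (ContinuousLinearMap.ext fun x => by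
    simp [smul_comm s t])

theorem expFlow_add_apply {n : ℕ} {p : Fin (n + 1) → ℕ} (B : BlockMatrix p) (s t : ℝ)
    (x : Space p) : expFlow B (s + t) x = expFlow B s (expFlow B t x) := by
  rw [expFlow_add]; rfl

theorem hasDerivAt_expFlow {n : ℕ} {p : Fin (n + 1) → ℕ} (B : BlockMatrix p) (t : ℝ) :
    HasDerivAt (expFlow B) ((flowGen B).comp (expFlow B t)) t := by
  have h := hasDerivAt_exp_smul_const' (𝕂 := ℝ) (flowGen B) t
  have he : expFlow B = fun σ : ℝ => NormedSpace.exp (σ • flowGen B) := by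
    funext σ; exact expFlow_eq_exp B σ
  rw [he]
  exact h

theorem contDiff_expFlow {n : ℕ} {p : Fin (n + 1) → ℕ} (B : BlockMatrix p) (m : WithTop ℕ∞) :
    ContDiff ℝ m (expFlow B) := by
  have he : expFlow B = fun σ : ℝ => NormedSpace.exp (σ • flowGen B) := by
    funext σ; exact expFlow_eq_exp B σ
  rw [he]
  have h : ContDiff ℝ m (NormedSpace.exp : (Space p →L[ℝ] Space p) → (Space p →L[ℝ] Space p)) :=
    contDiff_iff_contDiffAt.2 fun x => (NormedSpace.exp_analytic (𝕂 := ℝ) x).contDiffAt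
  exact h.comp (contDiff_id.smul contDiff_const)

/-! ### Anisotropic dilations and their commutation with the flow. -/

/-- The spatial dilation `x^{(pᵢ)} ↦ r^{2i+1} x^{(pᵢ)}`. -/
def dilation {n : ℕ} (p : Fin (n + 1) → ℕ) (r : ℝ) : Space p →L[ℝ] Space p :=
  Matrix.toEuclideanCLM (𝕜 := ℝ)
    (Matrix.diagonal fun k : (Σ i : Fin (n + 1), Fin (p i)) => r ^ (2 * (k.1 : ℕ) + 1))

@[simp] theorem dilation_apply {n : ℕ} {p : Fin (n + 1) → ℕ} (r : ℝ) (x : Space p)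
    (k : Σ i : Fin (n + 1), Fin (p i)) : dilation p r x k = r ^ (2 * (k.1 : ℕ) + 1) * x k := by
  simp [dilation, Matrix.mulVec_diagonal]

theorem dilation_comp {n : ℕ} {p : Fin (n + 1) → ℕ} (r s : ℝ) (x : Space p) :
    dilation p r (dilation p s x) = dilation p (r * s) x := by
  ext k
  simp [mul_pow, mul_assoc]

@[simp] theorem dilation_one {n : ℕ} {p : Fin (n + 1) → ℕ} (x : Space p) :
    dilation p 1 x = x := by
  ext k
  simp

theorem dilation_single {n : ℕ} {p : Fin (n + 1) → ℕ} (r : ℝ)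
    (k : Σ i : Fin (n + 1), Fin (p i)) :
    dilation p r (EuclideanSpace.single k 1) =
      r ^ (2 * (k.1 : ℕ) + 1) • EuclideanSpace.single k (1 : ℝ) := by
  ext l
  by_cases h : l = k
  · subst h; simp
  · simp [h]

theorem det_dilation {n : ℕ} (p : Fin (n + 1) → ℕ) (r : ℝ) :
    LinearMap.det (dilation p r : Space p →ₗ[ℝ] Space p) = r ^ homDim p := by
  have h : (dilation p r : Space p →ₗ[ℝ] Space p) =
      Matrix.toLin (EuclideanSpace.basisFun _ ℝ).toBasis (EuclideanSpace.basisFun _ ℝ).toBasis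
        (Matrix.diagonal fun k : (Σ i : Fin (n + 1), Fin (p i)) =>
        r ^ (2 * (k.1 : ℕ) + 1)) := by
    rw [dilation, Matrix.coe_toEuclideanCLM_eq_toEuclideanLin,
      Matrix.toEuclideanLin_eq_toLin_orthonormal]
  rw [h, LinearMap.det_toLin, Matrix.det_diagonal, Finset.prod_pow_eq_pow_sum, homDim]
  congr 1
  rw [Fintype.sum_sigma]
  simp [mul_comm]

theorem entry_eq_zero {n : ℕ} {p : Fin (n + 1) → ℕ} {B : BlockMatrix p} (hB : IsDriftMatrix p B)
    (k l : Σ i : Fin (n + 1), Fin (p i)) (h : (l.1 : ℕ) ≠ (k.1 : ℕ) + 1) : B k l = 0 := by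
  have := congrFun (congrFun (hB.block_eq_zero k.1 l.1 h) k.2) l.2
  exact this

/-- `Bᵀ` sends block `i` to block `i + 1`, and the weights of these blocks differ by the factor
`r²`. So the dilation conjugates `τ Bᵀ` into `r² τ Bᵀ`, and conjugation passes to exponentials. -/
theorem expFlow_dilation {n : ℕ} {p : Fin (n + 1) → ℕ} {B : BlockMatrix p}
    (hB : IsDriftMatrix p B) {r : ℝ} (hr : r ≠ 0) (τ : ℝ) (x : Space p) :
    expFlow B (r ^ 2 * τ) (dilation p r x) = dilation p r (expFlow B τ x) := by
  set d : (Σ i : Fin (n + 1), Fin (p i)) → ℝ := fun k => r ^ (2 * (k.1 : ℕ) + 1) with hd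
  have hU : IsUnit (Matrix.diagonal d) := by
    rw [Matrix.isUnit_diagonal, Pi.isUnit_iff]
    intro k
    exact (isUnit_iff_ne_zero.2 (pow_ne_zero _ hr))
  have hcomm : Matrix.diagonal d * (-(τ • B.transpose)) =
      (-((r ^ 2 * τ) • B.transpose)) * Matrix.diagonal d := by
    ext k l
    rw [Matrix.diagonal_mul, Matrix.mul_diagonal]
    simp only [Matrix.neg_apply, Matrix.smul_apply, Matrix.transpose_apply, smul_eq_mul]
    by_cases h : (k.1 : ℕ) = (l.1 : ℕ) + 1
    · simp only [hd, h]; ring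
    · rw [entry_eq_zero hB l k h]; ring
  have hconj : -((r ^ 2 * τ) • B.transpose) =
      Matrix.diagonal d * (-(τ • B.transpose)) * (Matrix.diagonal d)⁻¹ := by
    rw [hcomm, Matrix.mul_assoc, Matrix.mul_nonsing_inv _ ((Matrix.isUnit_iff_isUnit_det _).1 hU),
      Matrix.mul_one]
  have hexp : NormedSpace.exp (-((r ^ 2 * τ) • B.transpose)) * Matrix.diagonal d =
      Matrix.diagonal d * NormedSpace.exp (-(τ • B.transpose)) := by
    rw [hconj, Matrix.exp_conj _ _ hU, Matrix.mul_assoc,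
      Matrix.nonsing_inv_mul _ ((Matrix.isUnit_iff_isUnit_det _).1 hU), Matrix.mul_one]
  have := congrArg (fun M => Matrix.toEuclideanCLM (𝕜 := ℝ) M x) hexp
  simp only [map_mul] at this
  exact this

/-! ### The change of variables `ζ ↦ z₀ ∘ δ_r ζ` -/

/-- The map `(ξ, τ) ↦ z₀ ∘ (δ_r ξ, r² τ)`. -/
def affineMap {n : ℕ} {p : Fin (n + 1) → ℕ} (B : BlockMatrix p) (z₀ : SpaceTime p) (r : ℝ)
    (ζ : SpaceTime p) : SpaceTime p :=
  groupMul B z₀ (dilation p r ζ.1, r ^ 2 * ζ.2)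

theorem contDiff_affineMap {n : ℕ} {p : Fin (n + 1) → ℕ} (B : BlockMatrix p) (z₀ : SpaceTime p)
    (r : ℝ) (m : WithTop ℕ∞) : ContDiff ℝ m (affineMap B z₀ r) := by
  have h := contDiff_expFlow B m
  unfold affineMap groupMul
  have h2 : ContDiff ℝ m fun ζ : SpaceTime p => r ^ 2 * ζ.2 := contDiff_const.mul contDiff_snd
  exact (((dilation p r).contDiff.comp contDiff_fst).add
    ((h.comp h2).clm_apply contDiff_const)).prodMk (contDiff_const.add h2)

/-- The inverse of `affineMap`. -/
def affineInv {n : ℕ} {p : Fin (n + 1) → ℕ} (B : BlockMatrix p) (z₀ : SpaceTime p) (r : ℝ)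
    (z : SpaceTime p) : SpaceTime p :=
  (dilation p r⁻¹ (z.1 - expFlow B (z.2 - z₀.2) z₀.1), (r⁻¹) ^ 2 * (z.2 - z₀.2))

/-- `affineMap` as a homeomorphism. -/
def affineHomeo {n : ℕ} {p : Fin (n + 1) → ℕ} (B : BlockMatrix p) (z₀ : SpaceTime p) {r : ℝ}
    (hr : r ≠ 0) : SpaceTime p ≃ₜ SpaceTime p where
  toFun := affineMap B z₀ r
  invFun := affineInv B z₀ r
  left_inv ζ := by
    ext1
    · simp only [affineMap, affineInv, groupMul, add_sub_cancel_left, add_sub_cancel_right,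
        dilation_comp, inv_mul_cancel₀ hr, dilation_one]
    · simp only [affineMap, affineInv, groupMul, add_sub_cancel_left]
      field_simp
  right_inv z := by
    have h2 : r ^ 2 * (r⁻¹ ^ 2 * (z.2 - z₀.2)) = z.2 - z₀.2 := by field_simp
    ext1
    · simp only [affineMap, affineInv, groupMul, dilation_comp, mul_inv_cancel₀ hr, dilation_one,
        h2, sub_add_cancel]
    · simp only [affineMap, affineInv, groupMul, h2]
      ring
  continuous_toFun := (contDiff_affineMap B z₀ r 0).continuous
  continuous_invFun := by
    have h := (contDiff_expFlow B 0).continuous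
    unfold affineInv
    have h3 : Continuous fun z : SpaceTime p => z.2 - z₀.2 := continuous_snd.sub continuous_const
    exact ((dilation p r⁻¹).continuous.comp (continuous_fst.sub ((h.comp h3).clm_apply
      continuous_const))).prodMk (continuous_const.mul h3)

theorem homNorm_dilation {n : ℕ} {p : Fin (n + 1) → ℕ} {r : ℝ} (hr : 0 < r) (x : Space p) :
    homNorm (dilation p r x) = r * homNorm x := by
  unfold homNorm
  rw [Finset.mul_sum]
  refine Finset.sum_congr rfl fun i _ => ?_
  have h : blockVec (dilation p r x) i = r ^ (2 * (i : ℕ) + 1) • blockVec x i := by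
    ext a
    simp [blockVec]
  rw [h, norm_smul, Real.norm_of_nonneg (by positivity),
    Real.mul_rpow (by positivity) (norm_nonneg _), ← Real.rpow_natCast, ← Real.rpow_mul hr.le]
  congr 1
  have : (((2 * (i : ℕ) + 1 : ℕ) : ℝ)) * (1 / (2 * (i : ℕ) + 1)) = 1 := by
    push_cast
    field_simp
  rw [this, Real.rpow_one]

theorem cylinder_eq_image {n : ℕ} {p : Fin (n + 1) → ℕ} (B : BlockMatrix p) (z₀ : SpaceTime p)
    {r : ℝ} (hr : 0 < r) (ρ a c : ℝ) :
    cylinder B (ρ * r) (a * r ^ 2) (c * r ^ 2) z₀ =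
      affineMap B z₀ r '' ({x : Space p | homNorm x < ρ} ×ˢ Ioo a c) := by
  have hr2 : 0 < r ^ 2 := by positivity
  unfold cylinder
  ext z
  constructor
  · rintro ⟨⟨x, t⟩, ⟨hx, ht1, ht2⟩, rfl⟩
    simp only [mem_ofPred_eq] at hx ht1 ht2
    have hxx : dilation p r (dilation p r⁻¹ x) = x := by
      rw [dilation_comp, mul_inv_cancel₀ hr.ne', dilation_one]
    refine ⟨(dilation p r⁻¹ x, t / r ^ 2), ⟨?_, ?_, ?_⟩, ?_⟩
    · rw [← hxx, homNorm_dilation hr] at hx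
      exact lt_of_mul_lt_mul_right (by rwa [mul_comm r] at hx) hr.le
    · exact (lt_div_iff₀ hr2).2 ht1
    · exact (div_lt_iff₀ hr2).2 ht2
    · simp only [affineMap, hxx, mul_div_cancel₀ t hr2.ne']
  · rintro ⟨⟨x, t⟩, ⟨hx, ht1, ht2⟩, rfl⟩
    simp only [mem_ofPred_eq] at hx ht1 ht2
    refine ⟨(dilation p r x, r ^ 2 * t), ⟨?_, ?_, ?_⟩, rfl⟩
    · simp only [mem_ofPred_eq, homNorm_dilation hr]
      rw [mul_comm]
      exact mul_lt_mul_of_pos_right hx hr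
    · show a * r ^ 2 < r ^ 2 * t
      rw [mul_comm]; exact mul_lt_mul_of_pos_left ht1 hr2
    · show r ^ 2 * t < c * r ^ 2
      rw [mul_comm]; exact mul_lt_mul_of_pos_right ht2 hr2

/-- A left translation shifts `t`, and shifts `x` by a vector depending on time alone, so it
preserves volume; the dilation multiplies volume by a determinant. The value of the constant is
irrelevant, as only a ratio of volumes is needed. -/
theorem exists_volume_image_affineMap {n : ℕ} {p : Fin (n + 1) → ℕ} (B : BlockMatrix p)
    (z₀ : SpaceTime p) {r : ℝ} (hr : r ≠ 0) :
    ∃ c : ℝ, 0 < c ∧ ∀ S : Set (SpaceTime p), MeasurableSet S →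
      volume.real (affineMap B z₀ r '' S) = c * volume.real S := by
  let l : SpaceTime p →ₗ[ℝ] SpaceTime p :=
    LinearMap.prodMap (dilation p r : Space p →ₗ[ℝ] Space p) (r ^ 2 • LinearMap.id)
  have hl : Function.Injective l := by
    intro x y h
    have h1 : dilation p r x.1 = dilation p r y.1 := congrArg Prod.fst h
    have h2 : r ^ 2 * x.2 = r ^ 2 * y.2 := congrArg Prod.snd h
    ext1
    · have := congrArg (dilation p r⁻¹) h1
      simpa [dilation_comp, inv_mul_cancel₀ hr] using this
    · exact mul_left_cancel₀ (pow_ne_zero 2 hr) h2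
  have hdet : LinearMap.det l ≠ 0 := by
    intro h
    have := LinearMap.bot_lt_ker_of_det_eq_zero h
    rw [LinearMap.ker_eq_bot.2 hl] at this
    exact lt_irrefl _ this
  have hg : MeasurePreserving (groupMul B z₀) volume volume := by
    -- Time comes first, as the base of the skew product; the swaps restore the order.
    have h1 : MeasurePreserving (fun q : ℝ × Space p => (z₀.2 + q.1, q.2 + expFlow B q.1 z₀.1))
        volume volume := by
      refine MeasurePreserving.skew_product (g := fun t x => x + expFlow B t z₀.1)
        (measurePreserving_add_left volume z₀.2) ?_ ?_
      · have h := (contDiff_expFlow B 0).continuous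
        exact (continuous_snd.add ((h.comp continuous_fst).clm_apply continuous_const)).measurable
      · exact Eventually.of_forall fun t => (measurePreserving_add_right volume _).map_eq
    exact (Measure.measurePreserving_swap.comp h1).comp Measure.measurePreserving_swap
  refine ⟨|LinearMap.det l|, abs_pos.2 hdet, fun S hS => ?_⟩
  have e : affineMap B z₀ r '' S = groupMul B z₀ '' (l '' S) := by
    rw [image_image]; rfl
  let Φ := affineHomeo B z₀ (one_ne_zero (α := ℝ))
  have hΦ : ⇑Φ = groupMul B z₀ := by
    funext ζ
    simp [Φ, affineHomeo, affineMap]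
  have hlS : MeasurableSet (l '' S) := by
    refine hS.image_of_continuousOn_injOn ?_ hl.injOn
    exact (LinearMap.continuous_of_finiteDimensional l).continuousOn
  have e2 : volume (groupMul B z₀ '' (l '' S)) = volume (l '' S) := by
    rw [← hΦ]
    have : MeasurableSet (Φ '' (l '' S)) := Φ.toMeasurableEquiv.measurableSet_image.2 hlS
    rw [← hg.measure_preimage this.nullMeasurableSet, ← hΦ, preimage_image_eq _ Φ.injective]
  have _ : (volume : Measure (SpaceTime p)).IsAddHaarMeasure :=
    inferInstanceAs (Measure.prod volume volume).IsAddHaarMeasure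
  rw [e, measureReal_def, e2, Measure.addHaar_image_linearMap, ENNReal.toReal_mul,
    ENNReal.toReal_ofReal (abs_nonneg _)]
  rfl

/-! ### The Lyapunov equation -/

/-- The projection on the first block, as a matrix. -/
def firstBlock {n : ℕ} (p : Fin (n + 1) → ℕ) : BlockMatrix p :=
  Matrix.diagonal fun k => if (k.1 : ℕ) = 0 then 1 else 0

/-- The block of size `p_m × p_{m+1}` has rank equal to its number of columns, so its kernel is
trivial. For `m ≥ n` there is no block `m + 1` and `y` is already zero. -/
theorem drift_injOn_block {n : ℕ} {p : Fin (n + 1) → ℕ} {B : BlockMatrix p}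
    (hB : IsDriftMatrix p B) (m : ℕ) (y : (Σ i : Fin (n + 1), Fin (p i)) → ℝ)
    (hy : ∀ l, (l.1 : ℕ) ≠ m + 1 → y l = 0) (h : B.mulVec y = 0) : y = 0 := by
  by_cases hm : m < n
  swap
  · funext l
    exact hy l (by have := l.1.2; omega)
  let j : Fin n := ⟨m, hm⟩
  have hinj : Function.Injective (block B j.castSucc j.succ).mulVec := by
    have hr := hB.rank_block j
    rw [Matrix.rank] at hr
    have h2 := LinearMap.finrank_range_add_finrank_ker (block B j.castSucc j.succ).mulVecLin
    rw [hr, Module.finrank_fin_fun] at h2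
    have h3 : Module.finrank ℝ (block B j.castSucc j.succ).mulVecLin.ker = 0 := by omega
    exact LinearMap.ker_eq_bot.1 (Submodule.finrank_eq_zero.1 h3)
  have h0 : (block B j.castSucc j.succ).mulVec (fun c => y ⟨j.succ, c⟩) = 0 := by
    funext a
    have := congrFun h ⟨j.castSucc, a⟩
    rw [Matrix.mulVec, dotProduct, Fintype.sum_sigma, Finset.sum_eq_single j.succ] at this
    · exact this
    · intro i _ hi
      refine Finset.sum_eq_zero fun c _ => ?_
      rw [hy ⟨i, c⟩ (fun hh => hi (Fin.ext (by simpa [j] using hh))), mul_zero]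
    · simp
  have h1 : (fun c => y ⟨j.succ, c⟩) = 0 := hinj (by rw [h0, Matrix.mulVec_zero])
  funext l
  by_cases hl : (l.1 : ℕ) = m + 1
  · obtain ⟨i, c⟩ := l
    have : i = j.succ := Fin.ext (by simpa [j] using hl)
    subst this
    exact congrFun h1 c
  · exact hy l hl

/-- Each factor `B` moves the support one block towards the first, injectively. -/
theorem drift_pow_injOn_block {n : ℕ} {p : Fin (n + 1) → ℕ} {B : BlockMatrix p}
    (hB : IsDriftMatrix p B) (m : ℕ) (y : (Σ i : Fin (n + 1), Fin (p i)) → ℝ)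
    (hy : ∀ l, (l.1 : ℕ) ≠ m → y l = 0) (h : (B ^ m).mulVec y = 0) : y = 0 := by
  induction m generalizing y with
  | zero => simpa using h
  | succ m ih =>
    rw [pow_succ, ← Matrix.mulVec_mulVec] at h
    refine drift_injOn_block hB m y hy (ih _ (fun l hl => ?_) h)
    rw [Matrix.mulVec, dotProduct]
    refine Finset.sum_eq_zero fun k _ => ?_
    by_cases hk : (k.1 : ℕ) = m + 1
    · rw [entry_eq_zero hB l k (by omega), zero_mul]
    · rw [hy k hk, mul_zero]

/-- `∫₀¹ ((-σ)^i / i!) ((-σ)^j / j!) dσ`. -/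
def hilbertCoeff (i j : ℕ) : ℝ :=
  (-1) ^ (i + j) / (i.factorial * j.factorial * (i + j + 1))

theorem hilbertCoeff_comm (i j : ℕ) : hilbertCoeff i j = hilbertCoeff j i := by
  unfold hilbertCoeff
  rw [add_comm i j, mul_comm (i.factorial : ℝ), add_comm (i : ℝ)]

theorem hilbertCoeff_succ_zero (i : ℕ) :
    hilbertCoeff i 0 + ((i + 1 : ℕ) + (0 : ℕ) + 1) * hilbertCoeff (i + 1) 0 = 0 := by
  unfold hilbertCoeff
  rw [Nat.factorial_succ]
  have : (i.factorial : ℝ) ≠ 0 := by positivity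
  push_cast
  field_simp
  ring

/-- With eᵢ(σ) = (-σ)ⁱ/i!, this equates two expressions of eᵢ₊₁(1) eⱼ₊₁(1): the integrals over [0,
1] of (eᵢ₊₁ eⱼ₊₁)' and of (σ eᵢ₊₁ eⱼ₊₁)'. It is the Lyapunov equation freed of the powers of `B`. -/
theorem hilbertCoeff_succ_succ (i j : ℕ) :
    hilbertCoeff i (j + 1) + hilbertCoeff (i + 1) j +
      ((i + 1 : ℕ) + (j + 1 : ℕ) + 1) * hilbertCoeff (i + 1) (j + 1) = 0 := by
  unfold hilbertCoeff
  rw [Nat.factorial_succ, Nat.factorial_succ]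
  have : (i.factorial : ℝ) ≠ 0 := by positivity
  have : (j.factorial : ℝ) ≠ 0 := by positivity
  have : (i : ℝ) + (j + 1) + 1 ≠ 0 := by positivity
  have : (i : ℝ) + 1 + j + 1 ≠ 0 := by positivity
  have : (i : ℝ) + 1 + (j + 1) + 1 ≠ 0 := by positivity
  push_cast
  field_simp
  ring

/-- The controllability Gramian `∫₀¹ E(σ) A₀ E(σ)ᵀ dσ`, where `A₀` is the projection on the first
block. -/
def gramian {n : ℕ} {p : Fin (n + 1) → ℕ} (B : BlockMatrix p) : BlockMatrix p :=
  Matrix.of fun k l => hilbertCoeff k.1 l.1 *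
    ∑ a, (B ^ (k.1 : ℕ)) a k * (B ^ (l.1 : ℕ)) a l

theorem gramian_comm {n : ℕ} {p : Fin (n + 1) → ℕ} (B : BlockMatrix p)
    (k l : Σ i : Fin (n + 1), Fin (p i)) : gramian B k l = gramian B l k := by
  simp only [gramian, Matrix.of_apply]
  rw [hilbertCoeff_comm]
  congr 1
  exact Finset.sum_congr rfl fun a _ => mul_comm _ _

theorem transpose_mul_gramian_zero {n : ℕ} {p : Fin (n + 1) → ℕ} {B : BlockMatrix p}
    (hB : IsDriftMatrix p B) (k l : Σ i : Fin (n + 1), Fin (p i)) (hk : (k.1 : ℕ) = 0) :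
    (B.transpose * gramian B) k l = 0 := by
  rw [Matrix.mul_apply]
  refine Finset.sum_eq_zero fun m _ => ?_
  rw [Matrix.transpose_apply, entry_eq_zero hB m k (by omega), zero_mul]

theorem transpose_mul_gramian_succ {n : ℕ} {p : Fin (n + 1) → ℕ} {B : BlockMatrix p}
    (hB : IsDriftMatrix p B) (k l : Σ i : Fin (n + 1), Fin (p i)) {i : ℕ}
    (hk : (k.1 : ℕ) = i + 1) :
    (B.transpose * gramian B) k l = hilbertCoeff i l.1 *
      ∑ a, (B ^ (k.1 : ℕ)) a k * (B ^ (l.1 : ℕ)) a l := by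
  have h1 : ∀ m, B.transpose k m * gramian B m l =
      ∑ a, hilbertCoeff i l.1 * ((B ^ i) a m * B m k * (B ^ (l.1 : ℕ)) a l) := by
    intro m
    simp only [Matrix.transpose_apply, gramian, Matrix.of_apply]
    by_cases hm : (m.1 : ℕ) = i
    · rw [hm, Finset.mul_sum, Finset.mul_sum]
      refine Finset.sum_congr rfl fun a _ => by ring
    · rw [entry_eq_zero hB m k (by omega)]
      simp
  rw [Matrix.mul_apply]
  simp_rw [h1]
  rw [Finset.sum_comm, Finset.mul_sum]
  refine Finset.sum_congr rfl fun a _ => ?_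
  rw [← Finset.mul_sum, ← Finset.sum_mul, hk, pow_succ, Matrix.mul_apply]

/-- Multiplying by `Bᵀ` on the left or `B` on the right lowers one index of `hilbertCoeff` and keeps
the powers of `B`. All terms thus share the same sum over `a`, and a recurrence for the coefficients
is left. In the block (0, 0) only the Gramian itself survives, and it is the identity there. -/
theorem gramian_lyapunov {n : ℕ} {p : Fin (n + 1) → ℕ} {B : BlockMatrix p}
    (hB : IsDriftMatrix p B) (k l : Σ i : Fin (n + 1), Fin (p i)) :
    (B.transpose * gramian B) k l + (gramian B * B) k l +
      ((k.1 : ℕ) + (l.1 : ℕ) + 1) * gramian B k l = firstBlock p k l := by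
  have hsymm : (gramian B * B) k l = (B.transpose * gramian B) l k := by
    rw [Matrix.mul_apply, Matrix.mul_apply]
    refine Finset.sum_congr rfl fun m _ => ?_
    rw [Matrix.transpose_apply, gramian_comm B k m, mul_comm]
  have hW : ∑ a, (B ^ (l.1 : ℕ)) a l * (B ^ (k.1 : ℕ)) a k =
      ∑ a, (B ^ (k.1 : ℕ)) a k * (B ^ (l.1 : ℕ)) a l :=
    Finset.sum_congr rfl fun a _ => mul_comm _ _
  have hC : gramian B k l = hilbertCoeff k.1 l.1 *
    ∑ a, (B ^ (k.1 : ℕ)) a k * (B ^ (l.1 : ℕ)) a l := rfl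
  have hne : ∀ m : ℕ, ((k.1 : ℕ) = m + 1 ∨ (l.1 : ℕ) = m + 1) → firstBlock p k l = 0 := by
    intro m h
    by_cases hkl : k = l
    · subst hkl
      have : (k.1 : ℕ) ≠ 0 := by omega
      simp [firstBlock, -Fin.val_eq_zero_iff, this]
    · simp [firstBlock, hkl]
  rw [hsymm, hC]
  rcases hk : (k.1 : ℕ) with _ | i <;> rcases hl : (l.1 : ℕ) with _ | j
  · rw [transpose_mul_gramian_zero hB k l hk, transpose_mul_gramian_zero hB l k hl]
    simp only [hilbertCoeff, firstBlock]
    by_cases hkl : k = l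
    · subst hkl
      simp [Matrix.one_apply, -Fin.val_eq_zero_iff, hk]
    · simp [Matrix.one_apply, hkl, Ne.symm hkl]
  · rw [transpose_mul_gramian_zero hB k l hk, transpose_mul_gramian_succ hB l k hl, hW,
      hne j (Or.inr hl), hk, hl, hilbertCoeff_comm 0 (j + 1)]
    linear_combination (∑ a, (B ^ 0) a k * (B ^ (j + 1)) a l) * hilbertCoeff_succ_zero j
  · rw [transpose_mul_gramian_succ hB k l hk, transpose_mul_gramian_zero hB l k hl,
      hne i (Or.inl hk), hk, hl]
    linear_combination (∑ a, (B ^ (i + 1)) a k * (B ^ 0) a l) * hilbertCoeff_succ_zero i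
  · rw [transpose_mul_gramian_succ hB k l hk, transpose_mul_gramian_succ hB l k hl, hW,
      hne i (Or.inl hk), hk, hl, hilbertCoeff_comm j (i + 1)]
    linear_combination (∑ a, (B ^ (i + 1)) a k * (B ^ (j + 1)) a l) * hilbertCoeff_succ_succ i j

theorem integral_hilbertCoeff (i j : ℕ) :
    ∫ σ in (0 : ℝ)..1, ((-σ) ^ i / i.factorial) * ((-σ) ^ j / j.factorial) = hilbertCoeff i j := by
  have : ∀ σ : ℝ, ((-σ) ^ i / i.factorial) * ((-σ) ^ j / j.factorial) =
      ((-1) ^ (i + j) / (i.factorial * j.factorial)) * σ ^ (i + j) := by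
    intro σ
    rw [neg_pow, neg_pow σ j, pow_add, pow_add]
    field_simp
  simp_rw [this]
  rw [intervalIntegral.integral_const_mul, integral_pow, hilbertCoeff]
  push_cast
  field_simp
  simp

/-- The quadratic form is the integral over [0, 1] of a sum of squares of polynomials in σ. If it
vanishes, so do all their coefficients; these are the coordinates of `B ^ m` applied to block `m` of
`v`, up to nonzero factors, and `drift_pow_injOn_block` gives `v = 0`. -/
theorem posDef_gramian {n : ℕ} {p : Fin (n + 1) → ℕ} {B : BlockMatrix p}
    (hB : IsDriftMatrix p B) : (gramian B).PosDef := by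
  refine Matrix.PosDef.of_dotProduct_mulVec_pos ?_ ?_
  · ext k l
    simp [Matrix.conjTranspose_apply, gramian_comm B l k]
  intro v hv
  let e : (Σ i : Fin (n + 1), Fin (p i)) → ℝ → ℝ := fun k σ =>
    (-σ) ^ (k.1 : ℕ) / (k.1 : ℕ).factorial
  let F : (Σ i : Fin (n + 1), Fin (p i)) → ℝ → ℝ := fun a σ =>
    ∑ k, v k * (B ^ (k.1 : ℕ)) a k * e k σ
  have hec : ∀ k, Continuous (e k) := fun k => by fun_prop
  have hFc : ∀ a, Continuous (F a) := fun a => by fun_prop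
  have hkey : star v ⬝ᵥ (gramian B).mulVec v = ∫ σ in (0 : ℝ)..1, ∑ a, F a σ ^ 2 := by
    have h1 : ∀ σ, ∑ a, F a σ ^ 2 = ∑ k, ∑ l, (∑ a, v k * v l * ((B ^ (k.1 : ℕ)) a k *
        (B ^ (l.1 : ℕ)) a l)) * (e k σ * e l σ) := by
      intro σ
      simp only [F, sq, Finset.sum_mul_sum]
      simp only [Finset.sum_mul]
      rw [Finset.sum_comm]
      refine Finset.sum_congr rfl fun k _ => ?_
      rw [Finset.sum_comm]
      refine Finset.sum_congr rfl fun l _ => Finset.sum_congr rfl fun a _ => by ring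
    simp_rw [h1]
    rw [intervalIntegral.integral_finsetSum]
    swap
    · intro k _
      exact Continuous.intervalIntegrable (by fun_prop) _ _
    rw [dotProduct]
    refine Finset.sum_congr rfl fun k _ => ?_
    rw [intervalIntegral.integral_finsetSum]
    swap
    · intro k _
      exact Continuous.intervalIntegrable (by fun_prop) _ _
    rw [Matrix.mulVec, dotProduct, Finset.mul_sum]
    refine Finset.sum_congr rfl fun l _ => ?_
    rw [intervalIntegral.integral_const_mul, integral_hilbertCoeff]
    simp only [gramian, Matrix.of_apply, ← Finset.mul_sum, star_trivial]
    ring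
  rw [hkey]
  refine intervalIntegral.integral_pos one_pos (by fun_prop)
    (fun σ _ => Finset.sum_nonneg fun a _ => sq_nonneg _) ?_
  by_contra hcon
  push Not at hcon
  have hF0 : ∀ a, ∀ σ ∈ Icc (0 : ℝ) 1, F a σ = 0 := by
    intro a σ hσ
    have h2 := (Finset.sum_eq_zero_iff_of_nonneg (fun a _ => sq_nonneg (F a σ))).1
      (le_antisymm (hcon σ hσ) (Finset.sum_nonneg fun a _ => sq_nonneg _)) a (Finset.mem_univ a)
    exact pow_eq_zero_iff (two_ne_zero) |>.1 h2
  apply hv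
  have hblock : ∀ m : ℕ, (fun k => if (k.1 : ℕ) = m then v k else 0) =
      (0 : (Σ i : Fin (n + 1), Fin (p i)) → ℝ) := by
    intro m
    refine drift_pow_injOn_block hB m _ (fun l hl => if_neg hl) ?_
    funext a
    -- `F a` as a polynomial; it has infinitely many roots, so its coefficient of degree `m` is
    -- zero.
    let q : Polynomial ℝ := ∑ k, Polynomial.monomial (k.1 : ℕ)
      (v k * (B ^ (k.1 : ℕ)) a k * ((-1) ^ (k.1 : ℕ) / (k.1 : ℕ).factorial))
    have hq : q = 0 := by
      refine Polynomial.eq_zero_of_infinite_isRoot q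
        ((Icc_infinite (zero_lt_one (α := ℝ))).mono fun σ hσ => ?_)
      show Polynomial.eval σ q = 0
      rw [← hF0 a σ hσ]
      simp only [q, Polynomial.eval_finsetSum, Polynomial.eval_monomial, F, e]
      refine Finset.sum_congr rfl fun k _ => ?_
      rw [neg_pow σ]
      ring
    have hc := congrArg (fun q => Polynomial.coeff q m) hq
    simp only [q, Polynomial.finsetSum_coeff, Polynomial.coeff_monomial,
      Polynomial.coeff_zero] at hc
    have hfac : ((-1 : ℝ) ^ m / m.factorial) ≠ 0 := by positivity
    refine (mul_eq_zero_iff_right hfac).1 ?_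
    refine Eq.trans ?_ hc
    rw [Matrix.mulVec, dotProduct, Finset.sum_mul]
    refine Finset.sum_congr rfl fun k _ => ?_
    by_cases hk : (k.1 : ℕ) = m
    · simp only [hk, if_true]; ring
    · simp [hk]
  funext k
  simpa using congrFun (hblock k.1) k

theorem sum_weights {n : ℕ} (p : Fin (n + 1) → ℕ) :
    ∑ k : (Σ i : Fin (n + 1), Fin (p i)), (2 * ((k.1 : ℕ) : ℝ) + 1) = homDim p := by
  rw [Fintype.sum_sigma, homDim]
  push_cast
  refine Finset.sum_congr rfl fun i _ => ?_
  rw [Finset.sum_const, Finset.card_univ, Fintype.card_fin, nsmul_eq_mul, mul_comm]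

/-- `P` is the inverse of the Gramian `C`, and its equation is that of `C` multiplied by `C⁻¹` on
both sides. The weight `i + j + 1` splits as `(i + 1/2) + (j + 1/2)`, that is `S C + C S`; hence the
trace is `2 tr B + 2 tr S`, where `tr B = 0` and `2 tr S = Q`. -/
theorem exists_lyapunov {n : ℕ} {p : Fin (n + 1) → ℕ} {B : BlockMatrix p}
    (hB : IsDriftMatrix p B) : ∃ P : BlockMatrix p, P.PosDef ∧
      (∀ k l, (P * firstBlock p * P) k l =
        (P * B.transpose) k l + (B * P) k l + ((k.1 : ℕ) + (l.1 : ℕ) + 1) * P k l) ∧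
      (firstBlock p * P).trace = homDim p := by
  set C := gramian B with hC
  have hpd : C.PosDef := posDef_gramian hB
  have hu : IsUnit C.det := (Matrix.isUnit_iff_isUnit_det C).1 hpd.isUnit
  let S : BlockMatrix p := Matrix.diagonal fun k => ((k.1 : ℕ) : ℝ) + 1 / 2
  have hA : firstBlock p = B.transpose * C + C * B + (S * C + C * S) := by
    ext k l
    rw [← gramian_lyapunov hB k l]
    simp only [Matrix.add_apply, S, Matrix.diagonal_mul, Matrix.mul_diagonal]
    ring
  have h1 : C * C⁻¹ = 1 := Matrix.mul_nonsing_inv _ hu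
  have h2 : C⁻¹ * C = 1 := Matrix.nonsing_inv_mul _ hu
  refine ⟨C⁻¹, hpd.inv, fun k l => ?_, ?_⟩
  · have h3 : C⁻¹ * firstBlock p * C⁻¹ = C⁻¹ * B.transpose + B * C⁻¹ + (C⁻¹ * S + S * C⁻¹) := by
      calc C⁻¹ * firstBlock p * C⁻¹ = C⁻¹ * B.transpose * (C * C⁻¹) + C⁻¹ * C * B * C⁻¹ +
            (C⁻¹ * S * (C * C⁻¹) + C⁻¹ * C * S * C⁻¹) := by
            rw [hA]; simp only [Matrix.mul_add, Matrix.add_mul, Matrix.mul_assoc]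
        _ = _ := by rw [h1, h2]; simp only [Matrix.mul_one, Matrix.one_mul]
    rw [h3]
    simp only [Matrix.add_apply, S, Matrix.diagonal_mul, Matrix.mul_diagonal]
    ring
  · have h3 : (firstBlock p * C⁻¹).trace = B.trace + B.trace + (S.trace + S.trace) := by
      rw [hA, Matrix.add_mul, Matrix.add_mul, Matrix.add_mul, Matrix.trace_add, Matrix.trace_add,
        Matrix.trace_add, Matrix.mul_assoc, h1, Matrix.mul_one, Matrix.mul_assoc S, h1,
        Matrix.mul_one, Matrix.trace_mul_comm (C * B), ← Matrix.mul_assoc, h2, Matrix.one_mul,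
        Matrix.trace_mul_comm (C * S), ← Matrix.mul_assoc, h2, Matrix.one_mul,
        Matrix.trace_transpose]
    have h4 : B.trace = 0 := Finset.sum_eq_zero fun k _ => entry_eq_zero hB k k (by omega)
    rw [h3, h4, ← sum_weights]
    simp only [S, Matrix.trace, Matrix.diag_apply, Matrix.diagonal_apply_eq]
    rw [← Finset.sum_add_distrib, zero_add, zero_add]
    exact Finset.sum_congr rfl fun k _ => by ring

/-! ### The operator in terms of the first and second derivatives -/

/-- `u` is differentiable near `z` and its derivative is differentiable at `z`. -/
def TwiceDiffAt {E : Type*} [NormedAddCommGroup E] [NormedSpace ℝ E] (u : E → ℝ) (z : E) : Prop :=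
  (∀ᶠ w in 𝓝 z, DifferentiableAt ℝ u w) ∧ DifferentiableAt ℝ (fderiv ℝ u) z

theorem TwiceDiffAt.differentiableAt {E : Type*} [NormedAddCommGroup E] [NormedSpace ℝ E]
    {u : E → ℝ} {z : E} (h : TwiceDiffAt u z) : DifferentiableAt ℝ u z := h.1.self_of_nhds

theorem _root_.ContDiffAt.twiceDiffAt {E : Type*} [NormedAddCommGroup E] [NormedSpace ℝ E]
    {u : E → ℝ} {z : E} (h : ContDiffAt ℝ 2 u z) : TwiceDiffAt u z := by
  refine ⟨?_, ?_⟩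
  · filter_upwards [h.eventually (by simp)] with w hw
    exact hw.differentiableAt (by simp)
  · exact (h.fderiv_right (m := 1) (by norm_num)).differentiableAt (by simp)

theorem TwiceDiffAt.add {E : Type*} [NormedAddCommGroup E] [NormedSpace ℝ E]
    {u v : E → ℝ} {z : E} (hu : TwiceDiffAt u z) (hv : TwiceDiffAt v z) :
    TwiceDiffAt (fun w => u w + v w) z ∧ fderiv ℝ (fun w => u w + v w) z =
      fderiv ℝ u z + fderiv ℝ v z ∧
    fderiv ℝ (fderiv ℝ fun w => u w + v w) z =
      fderiv ℝ (fderiv ℝ u) z + fderiv ℝ (fderiv ℝ v) z := by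
  have he : fderiv ℝ (fun w => u w + v w) =ᶠ[𝓝 z] fun w => fderiv ℝ u w + fderiv ℝ v w := by
    filter_upwards [hu.1, hv.1] with w h1 h2
    exact fderiv_fun_add h1 h2
  refine ⟨⟨?_, ?_⟩, he.self_of_nhds, ?_⟩
  · filter_upwards [hu.1, hv.1] with w h1 h2
    exact h1.fun_add h2
  · exact (hu.2.fun_add hv.2).congr_of_eventuallyEq he
  · rw [he.fderiv_eq]
    exact fderiv_fun_add hu.2 hv.2

/-- The spatial unit vector `e_j` in space-time. -/
def unitX {n : ℕ} {p : Fin (n + 1) → ℕ} (j : Σ i : Fin (n + 1), Fin (p i)) : SpaceTime p :=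
  (EuclideanSpace.single j 1, 0)

/-- The linear form `H ↦ tr (M H)` on Hessians. -/
def secondOrder {n : ℕ} {p : Fin (n + 1) → ℕ} (M : BlockMatrix p) :
    (SpaceTime p →L[ℝ] SpaceTime p →L[ℝ] ℝ) →L[ℝ] ℝ :=
  ∑ i, ∑ j, M i j • (ContinuousLinearMap.apply ℝ ℝ (unitX i)).comp
    (ContinuousLinearMap.apply ℝ (SpaceTime p →L[ℝ] ℝ) (unitX j))

theorem secondOrder_apply {n : ℕ} {p : Fin (n + 1) → ℕ} (M : BlockMatrix p)
    (H : SpaceTime p →L[ℝ] SpaceTime p →L[ℝ] ℝ) :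
    secondOrder M H = ∑ i, ∑ j, M i j * H (unitX j) (unitX i) := by
  simp [secondOrder]

/-- The direction `(Bᵀ x, -1)` of the drift at `(x, t)`. -/
def driftVec {n : ℕ} {p : Fin (n + 1) → ℕ} (B : BlockMatrix p) (z : SpaceTime p) : SpaceTime p :=
  (-flowGen B z.1, -1)

theorem clm_apply_eq_sum {n : ℕ} {p : Fin (n + 1) → ℕ} (l : SpaceTime p →L[ℝ] ℝ) (x : Space p) :
    l (x, 0) = ∑ j, x j * l (unitX j) := by
  have h := (EuclideanSpace.basisFun (Σ i : Fin (n + 1), Fin (p i)) ℝ).sum_repr x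
  have h2 : (x, (0 : ℝ)) = ContinuousLinearMap.inl ℝ (Space p) ℝ x := rfl
  rw [h2]
  conv_lhs => rw [← h]
  rw [map_sum, map_sum]
  refine Finset.sum_congr rfl fun j _ => ?_
  rw [map_smul, map_smul]
  simp [unitX]

theorem drift_eq {n : ℕ} {p : Fin (n + 1) → ℕ} (B : BlockMatrix p) (u : SpaceTime p → ℝ)
    (z : SpaceTime p) :
    (z.1 : _ → ℝ) ⬝ᵥ (B.mulVec fun j => partialX j u z) - partialT u z =
      fderiv ℝ u z (driftVec B z) := by
  have h : driftVec B z = (-flowGen B z.1, (0 : ℝ)) - (0, 1) := by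
    simp [driftVec]
  rw [h, map_sub, clm_apply_eq_sum, Matrix.dotProduct_mulVec, ← Matrix.mulVec_transpose]
  congr 1
  rw [dotProduct]
  refine Finset.sum_congr rfl fun j _ => ?_
  rw [flowGen_apply]
  simp [partialX, unitX]

theorem opL_eq_hessian {n : ℕ} {p : Fin (n + 1) → ℕ} (B : BlockMatrix p)
    (A : SpaceTime p → BlockMatrix p) (u : SpaceTime p → ℝ) (z : SpaceTime p) :
    opL B A u z = ∑ i, ∑ j, A z i j * partialX j (partialX i u) z +
      fderiv ℝ u z (driftVec B z) := by
  rw [opL, add_sub_assoc, drift_eq]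
  simp [Matrix.trace, Matrix.mul_apply, hessianX]

theorem TwiceDiffAt.partialX_partialX {n : ℕ} {p : Fin (n + 1) → ℕ} {u : SpaceTime p → ℝ}
    {z : SpaceTime p} (h : TwiceDiffAt u z) (i j : Σ i : Fin (n + 1), Fin (p i)) :
    partialX j (partialX i u) z = fderiv ℝ (fderiv ℝ u) z (unitX j) (unitX i) := by
  have := (h.2.hasFDerivAt.clm_apply (hasFDerivAt_const (unitX i) z)).fderiv
  unfold partialX
  change fderiv ℝ (fun y => fderiv ℝ u y (unitX i)) z (unitX j) = _
  rw [this]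
  simp

theorem TwiceDiffAt.opL_eq {n : ℕ} {p : Fin (n + 1) → ℕ} {u : SpaceTime p → ℝ}
    {z : SpaceTime p} (h : TwiceDiffAt u z) (B : BlockMatrix p)
    (A : SpaceTime p → BlockMatrix p) :
    opL B A u z = secondOrder (A z) (fderiv ℝ (fderiv ℝ u) z) +
      fderiv ℝ u z (driftVec B z) := by
  rw [opL_eq_hessian, secondOrder_apply]
  simp_rw [h.partialX_partialX]

/-- Behaviour of the operator under the change of variables `ζ ↦ z₀ ∘ δ_r ζ`. -/
theorem opL_comp_affineMap {n : ℕ} {p : Fin (n + 1) → ℕ} {B : BlockMatrix p}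
    (hB : IsDriftMatrix p B) (z₀ : SpaceTime p) (r : ℝ) (M : BlockMatrix p)
    (hM : ∀ k l : (Σ i : Fin (n + 1), Fin (p i)), ((k.1 : ℕ) ≠ 0 ∨ (l.1 : ℕ) ≠ 0) → M k l = 0)
    (u : SpaceTime p → ℝ) (ζ : SpaceTime p) (hu : TwiceDiffAt u (affineMap B z₀ r ζ)) :
    opL B (fun _ => M) (fun ξ => u (affineMap B z₀ r ξ)) ζ =
      r ^ 2 * opL B (fun _ => M) u (affineMap B z₀ r ζ) := by
  have hΦ : ∀ ξ, HasFDerivAt (affineMap B z₀ r) (fderiv ℝ (affineMap B z₀ r) ξ) ξ := fun ξ =>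
    ((contDiff_affineMap B z₀ r 1).differentiable (by simp) ξ).hasFDerivAt
  have hd : ∀ ξ v, fderiv ℝ (affineMap B z₀ r) ξ v = (dilation p r v.1 +
      (r ^ 2 * v.2) • flowGen B (expFlow B (r ^ 2 * ξ.2) z₀.1), r ^ 2 * v.2) := by
    intro ξ v
    have h1 : HasFDerivAt (fun ζ : SpaceTime p => r ^ 2 * ζ.2)
        (r ^ 2 • ContinuousLinearMap.snd ℝ (Space p) ℝ) ξ :=
      (ContinuousLinearMap.snd ℝ (Space p) ℝ).hasFDerivAt.const_mul (r ^ 2)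
    have h2a := (hasDerivAt_expFlow B (r ^ 2 * ξ.2)).hasFDerivAt.comp ξ h1
    have h2 := h2a.clm_apply (hasFDerivAt_const z₀.1 ξ)
    have h3 := (((dilation p r).comp (ContinuousLinearMap.fst ℝ (Space p) ℝ)).hasFDerivAt
      (x := ξ)).add h2
    have h4 := h3.prodMk (h1.const_add z₀.2)
    have h5 : HasFDerivAt (affineMap B z₀ r) _ ξ := h4
    rw [h5.fderiv]
    simp [mul_smul]
  have hunit : ∀ ξ j, fderiv ℝ (affineMap B z₀ r) ξ (unitX j) =
      r ^ (2 * (j.1 : ℕ) + 1) • unitX j := by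
    intro ξ j
    rw [hd]
    simp [unitX, dilation_single]
  have hcomp : ∀ {w : SpaceTime p → ℝ} {ξ : SpaceTime p},
      DifferentiableAt ℝ w (affineMap B z₀ r ξ) → ∀ v,
      fderiv ℝ (fun ξ => w (affineMap B z₀ r ξ)) ξ v =
        fderiv ℝ w (affineMap B z₀ r ξ) (fderiv ℝ (affineMap B z₀ r) ξ v) := by
    intro w ξ hw v
    have := (hw.hasFDerivAt.comp ξ (hΦ ξ)).fderiv
    change fderiv ℝ (w ∘ affineMap B z₀ r) ξ v = _
    rw [this]; rfl
  have hpart : ∀ {w : SpaceTime p → ℝ} {ξ : SpaceTime p},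
      DifferentiableAt ℝ w (affineMap B z₀ r ξ) → ∀ j,
      partialX j (fun ξ => w (affineMap B z₀ r ξ)) ξ =
        r ^ (2 * (j.1 : ℕ) + 1) * partialX j w (affineMap B z₀ r ξ) := by
    intro w ξ hw j
    have := hcomp hw (unitX j)
    rw [hunit, map_smul] at this
    exact this
  have hev : ∀ᶠ ξ in 𝓝 ζ, DifferentiableAt ℝ u (affineMap B z₀ r ξ) :=
    (contDiff_affineMap B z₀ r 0).continuous.continuousAt.eventually hu.1
  have hdp : ∀ i, DifferentiableAt ℝ (partialX i u) (affineMap B z₀ r ζ) := fun i =>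
    hu.2.clm_apply (differentiableAt_const _)
  have hpp : ∀ i j, partialX j (partialX i fun ξ => u (affineMap B z₀ r ξ)) ζ =
      r ^ (2 * (i.1 : ℕ) + 1) * (r ^ (2 * (j.1 : ℕ) + 1) *
        partialX j (partialX i u) (affineMap B z₀ r ζ)) := by
    intro i j
    have he : partialX i (fun ξ => u (affineMap B z₀ r ξ)) =ᶠ[𝓝 ζ] fun ξ =>
        r ^ (2 * (i.1 : ℕ) + 1) * partialX i u (affineMap B z₀ r ξ) := by
      filter_upwards [hev] with ξ hξ using hpart hξ i
    have hdc : DifferentiableAt ℝ (fun ξ => partialX i u (affineMap B z₀ r ξ)) ζ :=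
      (hdp i).comp ζ (hΦ ζ).differentiableAt
    rw [← hpart (hdp i) j]
    unfold partialX at he ⊢
    rw [he.fderiv_eq]
    exact congrArg (fun l => l (EuclideanSpace.single j 1, (0 : ℝ))) (fderiv_const_mul hdc _)
  -- The count of weights of `expFlow_dilation`, for the generator.
  have hgen : ∀ x : Space p, dilation p r (flowGen B x) = r ^ 2 • flowGen B (dilation p r x) := by
    intro x
    ext k
    simp only [dilation_apply, flowGen_apply, PiLp.smul_apply, Pi.neg_apply, smul_eq_mul,
      Matrix.mulVec, dotProduct, mul_neg, Matrix.transpose_apply, Finset.mul_sum]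
    congr 1
    refine Finset.sum_congr rfl fun l _ => ?_
    by_cases h : (k.1 : ℕ) = (l.1 : ℕ) + 1
    · rw [h]; ring
    · rw [entry_eq_zero hB l k h]; ring
  rw [opL_eq_hessian, opL_eq_hessian, mul_add, Finset.mul_sum]
  congr 1
  · refine Finset.sum_congr rfl fun i _ => ?_
    rw [Finset.mul_sum]
    refine Finset.sum_congr rfl fun j _ => ?_
    -- Only indices in the first block count, and there each derivative brings one factor `r`.
    by_cases h : (i.1 : ℕ) ≠ 0 ∨ (j.1 : ℕ) ≠ 0
    · simp [hM i j h]
    · push Not at h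
      rw [hpp, h.1, h.2]
      ring
  · rw [hcomp hu.differentiableAt, hd]
    -- The differential of the change of variables sends the drift at ζ to `r²` times the drift at
    -- the image point; the term from the time derivative of the flow accounts for `z₀`.
    have hv : (dilation p r (driftVec B ζ).1 + (r ^ 2 * (driftVec B ζ).2) •
        flowGen B (expFlow B (r ^ 2 * ζ.2) z₀.1), r ^ 2 * (driftVec B ζ).2) =
        r ^ 2 • driftVec B (affineMap B z₀ r ζ) := by
      ext1
      · simp only [driftVec, affineMap, groupMul, map_neg, map_add, hgen, Prod.smul_fst]
        module
      · simp [driftVec]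
    rw [hv, map_smul, smul_eq_mul]

/-! ### The maximum principle -/

/-- A positive second derivative would make 0 a local minimum as well, so `g` would be locally
constant and its second derivative zero. -/
theorem secondDeriv_nonpos_of_isLocalMax {g : ℝ → ℝ} (h : IsLocalMax g 0)
    (hc : ContinuousAt g 0) : deriv (deriv g) 0 ≤ 0 := by
  by_contra hcon
  push Not at hcon
  have hmin := isLocalMin_of_deriv_deriv_pos hcon h.deriv_eq_zero hc
  have he : g =ᶠ[𝓝 0] fun _ => g 0 := by
    filter_upwards [h, hmin] with s h1 h2 using le_antisymm h1 h2
  have h3 : deriv g =ᶠ[𝓝 0] fun _ => 0 := by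
    filter_upwards [he.eventuallyEq_nhds] with s hs
    rw [hs.deriv_eq]
    simp
  rw [h3.deriv_eq] at hcon
  simp at hcon

theorem TwiceDiffAt.hessian_nonpos {E : Type*} [NormedAddCommGroup E] [NormedSpace ℝ E]
    {v : E → ℝ} {z : E} (h : TwiceDiffAt v z) (w : E)
    (hmax : IsLocalMax (fun s : ℝ => v (z + s • w)) 0) :
    fderiv ℝ (fderiv ℝ v) z w w ≤ 0 := by
  have hline : ∀ s : ℝ, HasDerivAt (fun s : ℝ => z + s • w) w s := fun s => by
    simpa using ((hasDerivAt_id s).smul_const w).const_add z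
  have hz : z + (0 : ℝ) • w = z := by simp
  have hct : Tendsto (fun s : ℝ => z + s • w) (𝓝 0) (𝓝 z) := by
    have := (hline 0).continuousAt.tendsto
    rwa [hz] at this
  have hd1 : deriv (fun s : ℝ => v (z + s • w)) =ᶠ[𝓝 0] fun s => fderiv ℝ v (z + s • w) w := by
    filter_upwards [hct.eventually h.1] with s hs
    exact (hs.hasFDerivAt.comp_hasDerivAt s (hline s)).deriv
  have hd2 : HasDerivAt (fun s : ℝ => fderiv ℝ v (z + s • w) w)
      (fderiv ℝ (fderiv ℝ v) z w w) 0 := by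
    have h2 : HasFDerivAt (fderiv ℝ v) (fderiv ℝ (fderiv ℝ v) z) (z + (0 : ℝ) • w) := by
      rw [hz]; exact h.2.hasFDerivAt
    have h3 := h2.comp_hasDerivAt (0 : ℝ) (hline 0)
    have h4 := h3.clm_apply (hasDerivAt_const (0 : ℝ) w)
    rw [map_zero, add_zero] at h4
    exact h4
  have hcont : ContinuousAt (fun s : ℝ => v (z + s • w)) 0 := by
    have hv : ContinuousAt v (z + (0 : ℝ) • w) := by
      rw [hz]; exact h.differentiableAt.continuousAt
    exact ContinuousAt.comp (f := fun s : ℝ => z + s • w) (g := v) hv (hline 0).continuousAt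
  have := secondDeriv_nonpos_of_isLocalMax hmax hcont
  rwa [hd1.deriv_eq, hd2.deriv] at this

theorem exists_transpose_mul_self {ι : Type*} [Fintype ι] [DecidableEq ι] {M : Matrix ι ι ℝ}
    (hM : M.PosSemidef) : ∃ R : Matrix ι ι ℝ, M = R.transpose * R := by
  open scoped MatrixOrder in
  obtain ⟨R, hR⟩ := CStarAlgebra.nonneg_iff_eq_star_mul_self.mp hM.nonneg
  exact ⟨R, by rw [hR, Matrix.star_eq_conjTranspose, Matrix.conjTranspose_eq_transpose_of_trivial]⟩

/-- Writing `M = Rᵀ R` turns the trace into a sum of second derivatives along the rows of `R`. -/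
theorem secondOrder_nonpos {n : ℕ} {p : Fin (n + 1) → ℕ} {M : BlockMatrix p} (hM : M.PosSemidef)
    (H : SpaceTime p →L[ℝ] SpaceTime p →L[ℝ] ℝ) (hH : ∀ x : Space p, H (x, 0) (x, 0) ≤ 0) :
    secondOrder M H ≤ 0 := by
  obtain ⟨R, rfl⟩ := exists_transpose_mul_self hM
  have h : secondOrder (R.transpose * R) H =
      ∑ k, H (WithLp.toLp 2 (R k), 0) (WithLp.toLp 2 (R k), 0) := by
    rw [secondOrder_apply]
    have h1 : ∀ k, H (WithLp.toLp 2 (R k), 0) (WithLp.toLp 2 (R k), 0) =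
        ∑ i, ∑ j, R k i * R k j * H (unitX j) (unitX i) := by
      intro k
      rw [clm_apply_eq_sum (H (WithLp.toLp 2 (R k), 0))]
      refine Finset.sum_congr rfl fun i _ => ?_
      have h2 := clm_apply_eq_sum (H.flip (unitX i)) (WithLp.toLp 2 (R k))
      simp only [ContinuousLinearMap.flip_apply] at h2
      rw [h2, Finset.mul_sum]
      exact Finset.sum_congr rfl fun j _ => by ring
    simp_rw [h1, Matrix.mul_apply, Matrix.transpose_apply, Finset.sum_mul]
    conv_rhs => rw [Finset.sum_comm]
    refine Finset.sum_congr rfl fun i _ => ?_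
    rw [Finset.sum_comm]
  rw [h]
  exact Finset.sum_nonpos fun k _ => hH _

/-- A subsolution in `D` whose upper limits at the points of `∂D` with negative time are at most
`m` is at most `m` in `D`. -/
theorem le_of_subsolution {n : ℕ} {p : Fin (n + 1) → ℕ} {B : BlockMatrix p}
    {A : SpaceTime p → BlockMatrix p} {D : Set (SpaceTime p)} (hDo : IsOpen D)
    (hDb : Bornology.IsBounded D) {t₀ : ℝ} (hDt : ∀ z ∈ D, t₀ ≤ z.2 ∧ z.2 < 0)
    (hA : ∀ z ∈ D, (A z).PosSemidef) {v : SpaceTime p → ℝ} (hv : ∀ z ∈ D, TwiceDiffAt v z)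
    (hL : ∀ z ∈ D, 0 ≤ secondOrder (A z) (fderiv ℝ (fderiv ℝ v) z) +
      fderiv ℝ v z (driftVec B z)) {m : ℝ}
    (hbd : ∀ z ∈ frontier D, z.2 < 0 → ∀ ε > 0, ∀ᶠ w in 𝓝[D] z, v w ≤ m + ε) :
    ∀ z ∈ D, v z ≤ m := by
  classical
  intro z hz
  by_contra hcon
  push Not at hcon
  -- Subtracting ε(t - t₀) makes the subsolution strict; ε is small enough for the value at `z` to
  -- stay above `m`.
  obtain ⟨ε, hε, hε2⟩ : ∃ ε > 0, m < v z - ε * (z.2 - t₀) := by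
    have h0 : 0 ≤ z.2 - t₀ := by linarith [(hDt z hz).1]
    refine ⟨(v z - m) / (2 * (z.2 - t₀ + 1)), by apply div_pos <;> linarith, ?_⟩
    have h1 : (v z - m) / (2 * (z.2 - t₀ + 1)) * (z.2 - t₀) ≤ (v z - m) / 2 := by
      rw [div_mul_eq_mul_div, div_le_div_iff₀ (by linarith) (by norm_num)]
      nlinarith
    linarith
  let l : SpaceTime p → ℝ := fun w => -ε * (w.2 - t₀)
  let vt : SpaceTime p → ℝ := fun w => v w + l w
  have hlc : ContDiff ℝ 2 l := contDiff_const.mul (contDiff_snd.sub contDiff_const)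
  have hl1 : ∀ w, fderiv ℝ l w = -ε • ContinuousLinearMap.snd ℝ (Space p) ℝ := fun w =>
    (((ContinuousLinearMap.snd ℝ (Space p) ℝ).hasFDerivAt.sub_const t₀).const_mul (-ε)).fderiv
  have hl2 : ∀ w, fderiv ℝ (fderiv ℝ l) w = 0 := by
    intro w
    have : fderiv ℝ l = fun _ => -ε • ContinuousLinearMap.snd ℝ (Space p) ℝ := funext hl1
    rw [this]
    simp
  -- The value `m` off `D` makes `g` upper semicontinuous on `K`, so a maximum exists, and a maximum
  -- above `m` lies in `D`.
  let g : SpaceTime p → ℝ := fun w => if w ∈ D then vt w else m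
  -- Times after that of `z` are cut off, because nothing is known on the boundary at time 0.
  let K : Set (SpaceTime p) := closure D ∩ {w | w.2 ≤ z.2}
  have hK : IsCompact K :=
    hDb.isCompact_closure.inter_right (isClosed_le continuous_snd continuous_const)
  have hvt : ∀ w ∈ D, vt w ≤ v w := by
    intro w hw
    have := (hDt w hw).1
    simp only [vt, l]
    nlinarith
  have hus : UpperSemicontinuousOn g K := by
    rw [upperSemicontinuousOn_iff]
    intro w hw y hy
    by_cases hwD : w ∈ D
    · have hc : ContinuousAt vt w :=
        ((hv w hwD).differentiableAt.continuousAt).add hlc.continuous.continuousAt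
      have hy' : vt w < y := by simpa [g, hwD] using hy
      refine mem_nhdsWithin_of_mem_nhds ?_
      filter_upwards [hDo.mem_nhds hwD, hc.eventually (gt_mem_nhds hy')] with a ha1 ha2
      simpa [g, ha1] using ha2
    · have hy' : m < y := by simpa [g, hwD] using hy
      have hwf : w ∈ frontier D := ⟨hw.1, by rwa [hDo.interior_eq]⟩
      have hev := hbd w hwf (lt_of_le_of_lt hw.2 (hDt z hz).2) ((y - m) / 2) (by linarith)
      rw [eventually_nhdsWithin_iff] at hev
      refine mem_nhdsWithin_of_mem_nhds ?_
      filter_upwards [hev] with a ha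
      by_cases haD : a ∈ D
      · have h1 := ha haD
        have h2 := hvt a haD
        simp only [g, haD, if_true]
        show vt a < y
        linarith
      · simpa [g, haD] using hy'
  obtain ⟨a, haK, hamax⟩ := hus.exists_isMaxOn (⟨z, subset_closure hz, le_refl z.2⟩ : K.Nonempty) hK
  have hga : m < g a := by
    refine lt_of_lt_of_le ?_ (hamax (show z ∈ K from ⟨subset_closure hz, le_refl z.2⟩))
    simp only [g, hz, if_true, vt, l]
    linarith
  have haD : a ∈ D := by
    by_contra h
    simp [g, h] at hga
  have hmax : ∀ w ∈ D, w.2 ≤ a.2 → vt w ≤ vt a := by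
    intro w hw hwt
    have := hamax (show w ∈ K from ⟨subset_closure hw, le_trans hwt haK.2⟩)
    simpa [g, hw, haD] using this
  obtain ⟨htd, hf1, hf2⟩ := (hv a haD).add (hlc.contDiffAt.twiceDiffAt (z := a))
  have hfd : fderiv ℝ (fderiv ℝ vt) a = fderiv ℝ (fderiv ℝ v) a := by
    rw [← add_zero (fderiv ℝ (fderiv ℝ v) a), ← hl2 a]
    exact hf2
  have hhess : ∀ x : Space p, fderiv ℝ (fderiv ℝ v) a (x, 0) (x, 0) ≤ 0 := by
    intro x
    rw [← hfd]
    refine htd.hessian_nonpos _ ?_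
    have hc : ContinuousAt (fun s : ℝ => a + s • ((x, 0) : SpaceTime p)) 0 := by fun_prop
    have hn : D ∈ 𝓝 (a + (0 : ℝ) • ((x, 0) : SpaceTime p)) := by
      simpa using hDo.mem_nhds haD
    filter_upwards [hc.preimage_mem_nhds hn] with s hs
    have := hmax _ hs (by simp)
    simpa [vt] using this
  have hsec := secondOrder_nonpos (hA a haD) _ hhess
  -- The drift direction goes back in time, so a short move along it stays where `a` is maximal,
  -- even if `a` is on the top of `K`. Only the one-sided derivative is used.
  have hdrift : fderiv ℝ vt a (driftVec B a) ≤ 0 := by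
    have hline : HasDerivAt (fun s : ℝ => a + s • driftVec B a) (driftVec B a) 0 := by
      simpa using ((hasDerivAt_id (0 : ℝ)).smul_const (driftVec B a)).const_add a
    have h1 : HasFDerivAt vt (fderiv ℝ vt a) (a + (0 : ℝ) • driftVec B a) := by
      have := htd.differentiableAt.hasFDerivAt
      simpa using this
    have h2 : HasDerivAt (fun s : ℝ => vt (a + s • driftVec B a))
        (fderiv ℝ vt a (driftVec B a)) 0 := by
      have := h1.comp_hasDerivAt (0 : ℝ) hline
      exact this
    have h3 := h2.hasDerivWithinAt (s := Ici 0)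
    by_contra hpos
    push Not at hpos
    have h4 := (hasDerivWithinAt_iff_tendsto_slope.1 h3).eventually (lt_mem_nhds hpos)
    have hn : D ∈ 𝓝 (a + (0 : ℝ) • driftVec B a) := by simpa using hDo.mem_nhds haD
    have h5 : ∀ᶠ s in 𝓝[Ici 0 \ {0}] (0 : ℝ), a + s • driftVec B a ∈ D :=
      nhdsWithin_le_nhds (hline.continuousAt.preimage_mem_nhds hn)
    have hne : (𝓝[Ici 0 \ {0}] (0 : ℝ)).NeBot := by
      rw [Ici_sdiff_left]; infer_instance
    obtain ⟨s, ⟨hs1, hs2⟩, hs3⟩ := ((h4.and h5).and self_mem_nhdsWithin).exists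
    have hs : 0 < s := lt_of_le_of_ne hs3.1 (fun h => hs3.2 h.symm)
    have h6 := hmax _ hs2 (by simp [driftVec, hs.le])
    rw [slope_def_field] at hs1
    simp only [zero_smul, add_zero, sub_zero] at hs1
    have : (vt (a + s • driftVec B a) - vt a) / s ≤ 0 :=
      div_nonpos_of_nonpos_of_nonneg (by linarith) hs.le
    linarith
  have hf1' : fderiv ℝ vt a (driftVec B a) = fderiv ℝ v a (driftVec B a) + ε := by
    have : fderiv ℝ vt a = fderiv ℝ v a + fderiv ℝ l a := hf1
    rw [this, hl1]
    simp [driftVec]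
  have := hL a haD
  linarith

/-! ### A convex cut-off of the exponential -/

theorem hasDerivAt_posPart_pow (m : ℕ) (hm : 1 ≤ m) (x : ℝ) :
    HasDerivAt (fun x : ℝ => max x 0 ^ (m + 1)) ((m + 1) * max x 0 ^ m) x := by
  rcases lt_trichotomy x 0 with hx | rfl | hx
  · have h : (fun x : ℝ => max x 0 ^ (m + 1)) =ᶠ[𝓝 x] fun _ => 0 := by
      filter_upwards [gt_mem_nhds hx] with y hy
      rw [max_eq_right hy.le, zero_pow (by omega)]
    rw [max_eq_right hx.le, zero_pow (by omega), mul_zero]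
    exact (hasDerivAt_const x (0 : ℝ)).congr_of_eventuallyEq h
  · rw [max_self, zero_pow (by omega), mul_zero]
    have h : HasFDerivAt (fun x : ℝ => max x 0 ^ (m + 1)) (0 : ℝ →L[ℝ] ℝ) 0 := by
      refine Asymptotics.IsBigO.hasFDerivAt (n := m + 1) ?_ (by omega)
      refine Asymptotics.IsBigO.of_bound 1 (Eventually.of_forall fun y => ?_)
      rw [one_mul, sub_zero, norm_pow, norm_pow, norm_norm]
      refine pow_le_pow_left₀ (norm_nonneg _) ?_ _
      rw [Real.norm_of_nonneg (le_max_right _ _)]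
      exact max_le (le_abs_self y) (norm_nonneg y)
    simpa using h.hasDerivAt
  · have h : (fun x : ℝ => max x 0 ^ (m + 1)) =ᶠ[𝓝 x] fun x => x ^ (m + 1) := by
      filter_upwards [lt_mem_nhds hx] with y hy
      rw [max_eq_left hy.le]
    rw [max_eq_left hx.le]
    have := hasDerivAt_pow (m + 1) x
    simp only [Nat.cast_add, Nat.cast_one, add_tsub_cancel_right] at this
    exact this.congr_of_eventuallyEq h

/-- `e^a (1 - e^{f₀ - a})₊³`. -/
def cutExp (f₀ a : ℝ) : ℝ := Real.exp a * max (1 - Real.exp (f₀ - a)) 0 ^ 3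

/-- The derivative of `cutExp f₀`. -/
def cutExp' (f₀ a : ℝ) : ℝ :=
  cutExp f₀ a + 3 * Real.exp f₀ * max (1 - Real.exp (f₀ - a)) 0 ^ 2

/-- The second derivative of `cutExp f₀`. -/
def cutExp'' (f₀ a : ℝ) : ℝ :=
  cutExp' f₀ a + 6 * Real.exp f₀ * Real.exp (f₀ - a) * max (1 - Real.exp (f₀ - a)) 0

theorem hasDerivAt_one_sub_exp (f₀ a : ℝ) :
    HasDerivAt (fun a => 1 - Real.exp (f₀ - a)) (Real.exp (f₀ - a)) a := by
  have h := ((Real.hasDerivAt_exp (f₀ - a)).comp a ((hasDerivAt_id a).const_sub f₀)).const_sub 1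
  simpa using h

theorem hasDerivAt_cutExp (f₀ a : ℝ) : HasDerivAt (cutExp f₀) (cutExp' f₀ a) a := by
  have h1 := (hasDerivAt_posPart_pow 2 (by norm_num) (1 - Real.exp (f₀ - a))).comp a
    (hasDerivAt_one_sub_exp f₀ a)
  have h2 := (Real.hasDerivAt_exp a).mul h1
  have h3 : Real.exp a * Real.exp (f₀ - a) = Real.exp f₀ := by
    rw [← Real.exp_add]; congr 1; ring
  refine HasDerivAt.congr_deriv (f := cutExp f₀) h2 ?_
  simp only [cutExp', cutExp, Function.comp]
  push_cast
  linear_combination (3 * max (1 - Real.exp (f₀ - a)) 0 ^ 2) * h3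

theorem hasDerivAt_cutExp' (f₀ a : ℝ) : HasDerivAt (cutExp' f₀) (cutExp'' f₀ a) a := by
  have h1 := (hasDerivAt_posPart_pow 1 le_rfl (1 - Real.exp (f₀ - a))).comp a
    (hasDerivAt_one_sub_exp f₀ a)
  have h2 := (hasDerivAt_cutExp f₀ a).add (h1.const_mul (3 * Real.exp f₀))
  refine HasDerivAt.congr_deriv (f := cutExp' f₀) h2 ?_
  simp only [cutExp'']
  push_cast
  ring

theorem continuous_cutExp'' (f₀ : ℝ) : Continuous (cutExp'' f₀) := by
  unfold cutExp'' cutExp' cutExp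
  fun_prop

/-- The cube of the positive part is what leaves two continuous derivatives. -/
theorem contDiff_cutExp (f₀ : ℝ) : ContDiff ℝ 2 (cutExp f₀) := by
  have h1 : deriv (cutExp f₀) = cutExp' f₀ := funext fun a => (hasDerivAt_cutExp f₀ a).deriv
  have h2 : deriv (cutExp' f₀) = cutExp'' f₀ := funext fun a => (hasDerivAt_cutExp' f₀ a).deriv
  have h3 : ContDiff ℝ 1 (cutExp' f₀) :=
    contDiff_one_iff_deriv.2 ⟨fun a => (hasDerivAt_cutExp' f₀ a).differentiableAt,
      h2 ▸ continuous_cutExp'' f₀⟩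
  have h4 := contDiff_succ_iff_deriv (𝕜 := ℝ) (n := 1) (f := cutExp f₀)
  rw [show ((1 : WithTop ℕ∞) + 1) = 2 by norm_num] at h4
  exact h4.2 ⟨fun a => (hasDerivAt_cutExp f₀ a).differentiableAt, by simp, h1 ▸ h3⟩

theorem cutExp_nonneg (f₀ a : ℝ) : 0 ≤ cutExp f₀ a := by unfold cutExp; positivity

theorem cutExp'_nonneg (f₀ a : ℝ) : 0 ≤ cutExp' f₀ a := by
  have := cutExp_nonneg f₀ a
  unfold cutExp'; positivity

/-- Together with `cutExp'_nonneg`, this is the form of convexity that makes Ψ(f) a subsolution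
whenever ⟨A∇f, ∇f⟩ + ℒf ≥ 0. -/
theorem cutExp'_le_cutExp'' (f₀ a : ℝ) : cutExp' f₀ a ≤ cutExp'' f₀ a := by
  unfold cutExp''
  have : 0 ≤ max (1 - Real.exp (f₀ - a)) 0 := le_max_right _ _
  have := Real.exp_pos f₀
  have := Real.exp_pos (f₀ - a)
  linarith [show 0 ≤ 6 * Real.exp f₀ * Real.exp (f₀ - a) * max (1 - Real.exp (f₀ - a)) 0 by
    positivity]

theorem cutExp_le_exp (f₀ a : ℝ) : cutExp f₀ a ≤ Real.exp a := by
  unfold cutExp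
  refine mul_le_of_le_one_right (Real.exp_pos a).le (pow_le_one₀ (le_max_right _ _) ?_)
  exact max_le (by linarith [Real.exp_pos (f₀ - a)]) zero_le_one

theorem cutExp_eq_zero {f₀ a : ℝ} (h : a ≤ f₀) : cutExp f₀ a = 0 := by
  have : 1 ≤ Real.exp (f₀ - a) := Real.one_le_exp (by linarith)
  rw [cutExp, max_eq_right (by linarith)]
  simp

theorem cutExp_pos {f₀ a : ℝ} (h : f₀ < a) : 0 < cutExp f₀ a := by
  have : Real.exp (f₀ - a) < 1 := by
    rw [← Real.exp_zero]; exact Real.exp_lt_exp.2 (by linarith)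
  unfold cutExp
  have h2 : 0 < max (1 - Real.exp (f₀ - a)) 0 := lt_max_of_lt_left (by linarith)
  positivity

theorem monotone_cutExp (f₀ : ℝ) : Monotone (cutExp f₀) :=
  monotone_of_deriv_nonneg (fun a => (hasDerivAt_cutExp f₀ a).differentiableAt) fun a => by
    rw [(hasDerivAt_cutExp f₀ a).deriv]; exact cutExp'_nonneg f₀ a

/-! ### The logarithm of the kernel -/

/-- The matrix with entries `t^{-(i + j + 1)} P` in the block of index `(i, j)`. -/
def scaledMatrix {n : ℕ} {p : Fin (n + 1) → ℕ} (P : BlockMatrix p) (t : ℝ) : BlockMatrix p :=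
  Matrix.of fun k l => (t⁻¹) ^ ((k.1 : ℕ) + (l.1 : ℕ) + 1) * P k l

/-- The quadratic form of `scaledMatrix P t`. -/
def quadForm {n : ℕ} {p : Fin (n + 1) → ℕ} (P : BlockMatrix p) (z : SpaceTime p) : ℝ :=
  ∑ k, ∑ l, scaledMatrix P z.2 k l * (z.1 k * z.1 l)

/-- `-s log t - κ q(x, t)`, where `q = quadForm P`. -/
def logKernel {n : ℕ} {p : Fin (n + 1) → ℕ} (P : BlockMatrix p) (s κ : ℝ) (z : SpaceTime p) : ℝ :=
  -s * Real.log z.2 - κ * quadForm P z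

theorem hasDerivAt_inv_pow_line (m : ℕ) {t : ℝ} (ht : t ≠ 0) (τ : ℝ) :
    HasDerivAt (fun s : ℝ => ((t + s * τ)⁻¹) ^ (m + 1))
      (-(m + 1) * t⁻¹ * (t⁻¹) ^ (m + 1) * τ) 0 := by
  have h1 : HasDerivAt (fun s : ℝ => t + s * τ) τ 0 := by
    simpa using ((hasDerivAt_id (0 : ℝ)).mul_const τ).const_add t
  have h2 := (h1.inv (by simpa using ht)).pow (m + 1)
  refine h2.congr_deriv ?_
  simp
  field_simp
  ring

theorem contDiffAt_scaledMatrix {n : ℕ} {p : Fin (n + 1) → ℕ} (P : BlockMatrix p)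
    {z : SpaceTime p} (hz : z.2 ≠ 0) (k l : Σ i : Fin (n + 1), Fin (p i)) (m : WithTop ℕ∞) :
    ContDiffAt ℝ m (fun z : SpaceTime p => scaledMatrix P z.2 k l) z := by
  simp only [scaledMatrix, Matrix.of_apply]
  exact ((contDiffAt_snd.inv hz).pow _).mul contDiffAt_const

theorem contDiff_coord {n : ℕ} {p : Fin (n + 1) → ℕ} (k : Σ i : Fin (n + 1), Fin (p i))
    (m : WithTop ℕ∞) : ContDiff ℝ m (fun z : SpaceTime p => z.1 k) :=
  (EuclideanSpace.proj (𝕜 := ℝ) k).contDiff.comp contDiff_fst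

theorem contDiffAt_quadForm {n : ℕ} {p : Fin (n + 1) → ℕ} (P : BlockMatrix p)
    {z : SpaceTime p} (hz : z.2 ≠ 0) (m : WithTop ℕ∞) : ContDiffAt ℝ m (quadForm P) z := by
  unfold quadForm
  refine ContDiffAt.sum fun k _ => ContDiffAt.sum fun l _ => ?_
  exact (contDiffAt_scaledMatrix P hz k l m).mul
    ((contDiff_coord k m).contDiffAt.mul (contDiff_coord l m).contDiffAt)

theorem contDiffAt_logKernel {n : ℕ} {p : Fin (n + 1) → ℕ} (P : BlockMatrix p) (s κ : ℝ)
    {z : SpaceTime p} (hz : z.2 ≠ 0) (m : WithTop ℕ∞) : ContDiffAt ℝ m (logKernel P s κ) z := by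
  unfold logKernel
  exact (contDiffAt_const.mul (contDiffAt_snd.log hz)).sub
    (contDiffAt_const.mul (contDiffAt_quadForm P hz m))

theorem fderiv_eq_of_line {n : ℕ} {p : Fin (n + 1) → ℕ} {f : SpaceTime p → ℝ} {z v : SpaceTime p}
    (hf : DifferentiableAt ℝ f z) {c : ℝ}
    (h : HasDerivAt (fun s : ℝ => f (z.1 + s • v.1, z.2 + s * v.2)) c 0) :
    fderiv ℝ f z v = c := by
  have h1 : HasLineDerivAt ℝ f c z v := h
  exact (hf.hasFDerivAt.hasLineDerivAt v).unique h1

theorem fderiv_quadForm {n : ℕ} {p : Fin (n + 1) → ℕ} {P : BlockMatrix p}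
    (hP : ∀ k l, P k l = P l k) {z : SpaceTime p} (hz : z.2 ≠ 0) (v : SpaceTime p) :
    fderiv ℝ (quadForm P) z v = 2 * ∑ k, v.1 k * ∑ l, scaledMatrix P z.2 k l * z.1 l -
      v.2 * ∑ k, ∑ l, ((k.1 : ℕ) + (l.1 : ℕ) + 1) * (z.2)⁻¹ *
        scaledMatrix P z.2 k l * (z.1 k * z.1 l) := by
  have hd : ∀ k : (Σ i : Fin (n + 1), Fin (p i)),
      HasDerivAt (fun s : ℝ => (z.1 + s • v.1) k) (v.1 k) 0 := by
    intro k
    simpa using ((hasDerivAt_id (0 : ℝ)).mul_const (v.1 k)).const_add (z.1 k)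
  have h1 : HasDerivAt (fun s : ℝ => quadForm P (z.1 + s • v.1, z.2 + s * v.2))
      (∑ k, ∑ l, (-(((k.1 : ℕ) + (l.1 : ℕ) + 1)) * (z.2)⁻¹ *
        scaledMatrix P z.2 k l * v.2 * (z.1 k * z.1 l) +
        scaledMatrix P z.2 k l * (v.1 k * z.1 l + z.1 k * v.1 l))) 0 := by
    unfold quadForm
    refine HasDerivAt.fun_sum fun k _ => HasDerivAt.fun_sum fun l _ => ?_
    have h2 := ((hasDerivAt_inv_pow_line ((k.1 : ℕ) + (l.1 : ℕ)) hz v.2).mul_const (P k l)).mul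
      ((hd k).mul (hd l))
    refine HasDerivAt.congr_deriv (f := fun s : ℝ => scaledMatrix P (z.2 + s * v.2) k l *
      ((z.1 + s • v.1) k * (z.1 + s • v.1) l)) h2 ?_
    simp only [scaledMatrix, Matrix.of_apply, Pi.mul_apply, zero_mul, add_zero, zero_smul]
    push_cast
    ring
  rw [fderiv_eq_of_line ((contDiffAt_quadForm P hz 1).differentiableAt (by simp)) h1]
  have hsym : ∑ k, ∑ l, scaledMatrix P z.2 k l * (z.1 k * v.1 l) =
      ∑ k, ∑ l, scaledMatrix P z.2 k l * (v.1 k * z.1 l) := by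
    rw [Finset.sum_comm]
    refine Finset.sum_congr rfl fun k _ => Finset.sum_congr rfl fun l _ => ?_
    simp only [scaledMatrix, Matrix.of_apply, hP l k]
    rw [add_comm (l.1 : ℕ)]
    ring
  simp only [mul_add, Finset.sum_add_distrib]
  rw [hsym]
  have e1 : ∑ k, v.1 k * ∑ l, scaledMatrix P z.2 k l * z.1 l =
      ∑ k, ∑ l, scaledMatrix P z.2 k l * (v.1 k * z.1 l) := by
    refine Finset.sum_congr rfl fun k _ => ?_
    rw [Finset.mul_sum]
    exact Finset.sum_congr rfl fun l _ => by ring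
  have e2 : ∑ k, ∑ l, (-(((k.1 : ℕ) + (l.1 : ℕ) + 1) : ℝ)) * (z.2)⁻¹ *
        scaledMatrix P z.2 k l * v.2 * (z.1 k * z.1 l) =
      -(v.2 * ∑ k, ∑ l, ((k.1 : ℕ) + (l.1 : ℕ) + 1) * (z.2)⁻¹ *
        scaledMatrix P z.2 k l * (z.1 k * z.1 l)) := by
    rw [Finset.mul_sum, ← Finset.sum_neg_distrib]
    refine Finset.sum_congr rfl fun k _ => ?_
    rw [Finset.mul_sum, ← Finset.sum_neg_distrib]
    exact Finset.sum_congr rfl fun l _ => by ring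
  rw [e1, e2]
  ring

theorem fderiv_logKernel {n : ℕ} {p : Fin (n + 1) → ℕ} {P : BlockMatrix p}
    (hP : ∀ k l, P k l = P l k) (s κ : ℝ) {z : SpaceTime p} (hz : z.2 ≠ 0) (v : SpaceTime p) :
    fderiv ℝ (logKernel P s κ) z v = -s * (v.2 / z.2) - κ * (
      2 * ∑ k, v.1 k * ∑ l, scaledMatrix P z.2 k l * z.1 l -
      v.2 * ∑ k, ∑ l, ((k.1 : ℕ) + (l.1 : ℕ) + 1) * (z.2)⁻¹ *
        scaledMatrix P z.2 k l * (z.1 k * z.1 l)) := by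
  have h1 : HasFDerivAt (fun z : SpaceTime p => Real.log z.2) (z.2⁻¹ •
      ContinuousLinearMap.snd ℝ (Space p) ℝ) z :=
    (ContinuousLinearMap.snd ℝ (Space p) ℝ).hasFDerivAt.log hz
  have h2 := ((contDiffAt_quadForm P hz 1).differentiableAt (by simp)).hasFDerivAt
  have h3 : HasFDerivAt (logKernel P s κ) _ z := (h1.const_mul (-s)).sub (h2.const_mul κ)
  rw [h3.fderiv, ← fderiv_quadForm hP hz v]
  simp [div_eq_inv_mul]

theorem partialX_logKernel {n : ℕ} {p : Fin (n + 1) → ℕ} {P : BlockMatrix p}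
    (hP : ∀ k l, P k l = P l k) (s κ : ℝ) {z : SpaceTime p} (hz : z.2 ≠ 0)
    (j : Σ i : Fin (n + 1), Fin (p i)) :
    partialX j (logKernel P s κ) z = -(2 * κ) * ∑ l, scaledMatrix P z.2 j l * z.1 l := by
  rw [partialX, fderiv_logKernel hP s κ hz]
  simp
  ring

theorem partialX_partialX_logKernel {n : ℕ} {p : Fin (n + 1) → ℕ} {P : BlockMatrix p}
    (hP : ∀ k l, P k l = P l k) (s κ : ℝ) {z : SpaceTime p} (hz : z.2 ≠ 0)
    (i j : Σ i : Fin (n + 1), Fin (p i)) :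
    partialX i (partialX j (logKernel P s κ)) z = -(2 * κ) * scaledMatrix P z.2 j i := by
  have he : partialX j (logKernel P s κ) =ᶠ[𝓝 z] fun z =>
      -(2 * κ) * ∑ l, scaledMatrix P z.2 j l * z.1 l := by
    filter_upwards [continuous_snd.continuousAt.eventually_ne hz] with w hw
    exact partialX_logKernel hP s κ hw j
  unfold partialX at he ⊢
  rw [he.fderiv_eq]
  refine fderiv_eq_of_line ?_ ?_
  · refine DifferentiableAt.const_mul (DifferentiableAt.fun_sum fun l _ => ?_) _
    exact ((contDiffAt_scaledMatrix P hz j l 1).differentiableAt (by simp)).mul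
      ((contDiff_coord l 1).differentiable (by simp) z)
  · have hd : ∀ k : (Σ i : Fin (n + 1), Fin (p i)), HasDerivAt (fun s : ℝ =>
        (z.1 + s • (EuclideanSpace.single i 1 : Space p)) k) (if k = i then 1 else 0) 0 := by
      intro k
      have := ((hasDerivAt_id (0 : ℝ)).mul_const
        ((EuclideanSpace.single i 1 : Space p) k)).const_add (z.1 k)
      simpa using this
    have h2 := (HasDerivAt.fun_sum (u := Finset.univ) fun l _ =>
      (hd l).const_mul (scaledMatrix P z.2 j l)).const_mul (-(2 * κ))
    simpa using h2

theorem partialX_comp {n : ℕ} {p : Fin (n + 1) → ℕ} {f : SpaceTime p → ℝ} {Ψ : ℝ → ℝ} {c : ℝ}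
    {z : SpaceTime p} (hf : DifferentiableAt ℝ f z) (hΨ : HasDerivAt Ψ c (f z)) :
    fderiv ℝ (fun w => Ψ (f w)) z = c • fderiv ℝ f z :=
  (hΨ.comp_hasFDerivAt z hf.hasFDerivAt).fderiv

/-- Chain rule for the operator. -/
theorem opL_comp {n : ℕ} {p : Fin (n + 1) → ℕ} (B : BlockMatrix p)
    (A : SpaceTime p → BlockMatrix p) {f : SpaceTime p → ℝ} {z : SpaceTime p}
    (hf : TwiceDiffAt f z) {Ψ Ψ' : ℝ → ℝ} {c : ℝ} (hΨ : ∀ a, HasDerivAt Ψ (Ψ' a) a)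
    (hΨ' : HasDerivAt Ψ' c (f z)) :
    opL B A (fun w => Ψ (f w)) z = c * (∑ i, ∑ j, A z i j * (partialX i f z * partialX j f z)) +
      Ψ' (f z) * opL B A f z := by
  have hpp : ∀ i j, partialX j (partialX i fun w => Ψ (f w)) z =
      c * (partialX i f z * partialX j f z) + Ψ' (f z) * partialX j (partialX i f) z := by
    intro i j
    have he : partialX i (fun w => Ψ (f w)) =ᶠ[𝓝 z] fun w => Ψ' (f w) * partialX i f w := by
      filter_upwards [hf.1] with w hw
      unfold partialX
      rw [partialX_comp hw (hΨ (f w))]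
      rfl
    have h1 := (hΨ'.comp_hasFDerivAt z hf.differentiableAt.hasFDerivAt)
    have h2 : DifferentiableAt ℝ (partialX i f) z := hf.2.clm_apply (differentiableAt_const _)
    have h3 := h1.mul h2.hasFDerivAt
    unfold partialX at he h3 ⊢
    rw [he.fderiv_eq]
    refine (congrArg (fun l => l (EuclideanSpace.single j 1, (0 : ℝ))) h3.fderiv).trans ?_
    simp
    ring
  rw [opL_eq_hessian, opL_eq_hessian, partialX_comp hf.differentiableAt (hΨ _)]
  simp_rw [hpp, mul_add, Finset.sum_add_distrib]
  rw [Finset.mul_sum, Finset.mul_sum]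
  simp_rw [Finset.mul_sum]
  rw [add_assoc]
  congr 1
  · exact Finset.sum_congr rfl fun i _ => Finset.sum_congr rfl fun j _ => by ring
  · congr 1
    exact Finset.sum_congr rfl fun i _ => Finset.sum_congr rfl fun j _ => by ring

/-! ### Admissible coefficient matrices -/

/-- `M` vanishes outside its first diagonal block, where it lies between `λ I` and `Λ I`. -/
structure IsAdmissible {n : ℕ} {p : Fin (n + 1) → ℕ} (lam Lam : ℝ) (M : BlockMatrix p) : Prop where
  supp : ∀ k l : (Σ i : Fin (n + 1), Fin (p i)), ((k.1 : ℕ) ≠ 0 ∨ (l.1 : ℕ) ≠ 0) → M k l = 0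
  lower : (M - lam • firstBlock p).PosSemidef
  upper : (Lam • firstBlock p - M).PosSemidef

theorem posSemidef_of_block {n : ℕ} {p : Fin (n + 1) → ℕ} {M : BlockMatrix p}
    (hM : ∀ k l : (Σ i : Fin (n + 1), Fin (p i)), ((k.1 : ℕ) ≠ 0 ∨ (l.1 : ℕ) ≠ 0) → M k l = 0)
    (h : (block M 0 0).PosSemidef) : M.PosSemidef := by
  have hne : ∀ i : Fin (n + 1), i ≠ 0 → (i : ℕ) ≠ 0 := fun i hi h0 => hi (Fin.ext h0)
  refine Matrix.PosSemidef.of_dotProduct_mulVec_nonneg ?_ fun x => ?_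
  · ext ⟨i, a⟩ ⟨j, c⟩
    by_cases hi : i = 0
    · by_cases hj : j = 0
      · subst hi hj
        exact congrFun (congrFun h.isHermitian a) c
      · simp [hM ⟨i, a⟩ ⟨j, c⟩ (Or.inr (hne j hj)), hM ⟨j, c⟩ ⟨i, a⟩ (Or.inl (hne j hj))]
    · simp [hM ⟨i, a⟩ ⟨j, c⟩ (Or.inl (hne i hi)), hM ⟨j, c⟩ ⟨i, a⟩ (Or.inr (hne i hi))]
  · have h1 := h.dotProduct_mulVec_nonneg fun a => x ⟨0, a⟩
    have h2 : star x ⬝ᵥ M.mulVec x =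
        star (fun a => x ⟨0, a⟩) ⬝ᵥ (block M 0 0).mulVec fun a => x ⟨0, a⟩ := by
      simp only [dotProduct, Matrix.mulVec, Fintype.sum_sigma, Pi.star_apply]
      rw [Finset.sum_eq_single 0]
      · refine Finset.sum_congr rfl fun a _ => ?_
        congr 1
        rw [Finset.sum_eq_single 0]
        · rfl
        · intro j _ hj
          exact Finset.sum_eq_zero fun c _ => by
            rw [hM ⟨0, a⟩ ⟨j, c⟩ (Or.inr (hne j hj)), zero_mul]
        · simp
      · intro i _ hi
        refine Finset.sum_eq_zero fun a _ => ?_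
        rw [Finset.sum_eq_zero, mul_zero]
        intro j _
        exact Finset.sum_eq_zero fun c _ => by
          rw [hM ⟨i, a⟩ ⟨j, c⟩ (Or.inl (hne i hi)), zero_mul]
      · simp
    rw [h2]
    exact h1

theorem IsCoefficient.isAdmissible {n : ℕ} {p : Fin (n + 1) → ℕ} {Ω : Set (SpaceTime p)}
    {lam Lam : ℝ} {A : SpaceTime p → BlockMatrix p} (h : IsCoefficient Ω lam Lam A)
    {z : SpaceTime p} (hz : z ∈ Ω) : IsAdmissible lam Lam (A z) := by
  obtain ⟨h1, -, h3, h4⟩ := h z hz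
  have hs : ∀ k l : (Σ i : Fin (n + 1), Fin (p i)),
      ((k.1 : ℕ) ≠ 0 ∨ (l.1 : ℕ) ≠ 0) → A z k l = 0 := by
    intro k l hkl
    have := h1 k.1 l.1 (hkl.imp (fun h h0 => h (by rw [h0]; rfl)) (fun h h0 => h (by rw [h0]; rfl)))
    exact congrFun (congrFun this k.2) l.2
  have hf : ∀ k l : (Σ i : Fin (n + 1), Fin (p i)),
      ((k.1 : ℕ) ≠ 0 ∨ (l.1 : ℕ) ≠ 0) → firstBlock p k l = 0 := by
    intro k l hkl
    by_cases h : k = l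
    · subst h
      simp only [or_self] at hkl
      simp [firstBlock, -Fin.val_eq_zero_iff, hkl]
    · simp [firstBlock, h]
  have hb : block (firstBlock p) 0 0 = (1 : Matrix (Fin (p 0)) (Fin (p 0)) ℝ) := by
    ext a c
    by_cases h : a = c
    · subst h; simp [block, firstBlock]
    · rw [Matrix.one_apply_ne h]
      have : (⟨0, a⟩ : Σ i : Fin (n + 1), Fin (p i)) ≠ ⟨0, c⟩ := fun hh => h (by simpa using hh)
      simp [block, firstBlock, Matrix.diagonal_apply_ne _ this]
  refine ⟨hs, posSemidef_of_block (fun k l hkl => ?_) ?_,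
    posSemidef_of_block (fun k l hkl => ?_) ?_⟩
  · simp [hs k l hkl, hf k l hkl]
  · have : block (A z - lam • firstBlock p) 0 0 =
        block (A z) 0 0 - lam • block (firstBlock p) 0 0 := rfl
    rwa [this, hb]
  · simp [hs k l hkl, hf k l hkl]
  · have : block (Lam • firstBlock p - A z) 0 0 =
        Lam • block (firstBlock p) 0 0 - block (A z) 0 0 := rfl
    rwa [this, hb]

theorem posSemidef_firstBlock {n : ℕ} (p : Fin (n + 1) → ℕ) : (firstBlock p).PosSemidef := by
  refine Matrix.PosSemidef.diagonal fun k => ?_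
  dsimp only
  split_ifs <;> simp

theorem IsAdmissible.posSemidef {n : ℕ} {p : Fin (n + 1) → ℕ} {lam Lam : ℝ} {M : BlockMatrix p}
    (h : IsAdmissible lam Lam M) (hl : 0 ≤ lam) : M.PosSemidef := by
  have := h.lower.add ((posSemidef_firstBlock p).smul hl)
  simpa using this

theorem trace_mul_nonneg {ι : Type*} [Fintype ι] [DecidableEq ι] {M P : Matrix ι ι ℝ}
    (hM : M.PosSemidef) (hP : P.PosSemidef) : 0 ≤ (M * P).trace := by
  obtain ⟨R, rfl⟩ := exists_transpose_mul_self hM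
  have h := (hP.mul_mul_conjTranspose_same R).trace_nonneg
  rw [Matrix.conjTranspose_eq_transpose_of_trivial, Matrix.trace_mul_comm,
    ← Matrix.mul_assoc] at h
  exact h

/-! ### The kernel is a subsolution -/

/-- The solution of the Lyapunov equation provided by `exists_lyapunov`. -/
structure IsLyapunov {n : ℕ} {p : Fin (n + 1) → ℕ} (B P : BlockMatrix p) : Prop where
  posDef : P.PosDef
  eqn : ∀ k l, (P * firstBlock p * P) k l =
    (P * B.transpose) k l + (B * P) k l + ((k.1 : ℕ) + (l.1 : ℕ) + 1) * P k l
  trace : (firstBlock p * P).trace = homDim p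

theorem IsLyapunov.comm {n : ℕ} {p : Fin (n + 1) → ℕ} {B P : BlockMatrix p}
    (h : IsLyapunov B P) (k l : Σ i : Fin (n + 1), Fin (p i)) : P k l = P l k := by
  have := congrFun (congrFun h.posDef.isHermitian l) k
  simpa using this

/-- Every term is homogeneous of degree `-(k + l + 2)` in `t`: the projection forces the middle
index into block 0, and `B` shifts a block index by one. -/
theorem IsLyapunov.scaled {n : ℕ} {p : Fin (n + 1) → ℕ} {B P : BlockMatrix p}
    (hB : IsDriftMatrix p B) (h : IsLyapunov B P) (t : ℝ)
    (k l : Σ i : Fin (n + 1), Fin (p i)) :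
    (scaledMatrix P t * firstBlock p * scaledMatrix P t) k l =
      (scaledMatrix P t * B.transpose) k l + (B * scaledMatrix P t) k l +
        ((k.1 : ℕ) + (l.1 : ℕ) + 1) * t⁻¹ * scaledMatrix P t k l := by
  have e1 : (scaledMatrix P t * firstBlock p * scaledMatrix P t) k l =
      (t⁻¹) ^ ((k.1 : ℕ) + (l.1 : ℕ) + 2) * (P * firstBlock p * P) k l := by
    simp only [firstBlock, Matrix.mul_apply (M := _ * _), Matrix.mul_diagonal, Finset.mul_sum]
    refine Finset.sum_congr rfl fun m _ => ?_
    simp only [scaledMatrix, Matrix.of_apply]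
    split_ifs with hm
    · rw [hm]; ring
    · simp
  have e2 : (scaledMatrix P t * B.transpose) k l =
      (t⁻¹) ^ ((k.1 : ℕ) + (l.1 : ℕ) + 2) * (P * B.transpose) k l := by
    simp only [Matrix.mul_apply, Finset.mul_sum, Matrix.transpose_apply]
    refine Finset.sum_congr rfl fun m _ => ?_
    simp only [scaledMatrix, Matrix.of_apply]
    by_cases hm : (m.1 : ℕ) = (l.1 : ℕ) + 1
    · rw [hm]; ring
    · rw [entry_eq_zero hB l m hm]; simp
  have e3 : (B * scaledMatrix P t) k l =
      (t⁻¹) ^ ((k.1 : ℕ) + (l.1 : ℕ) + 2) * (B * P) k l := by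
    simp only [Matrix.mul_apply, Finset.mul_sum]
    refine Finset.sum_congr rfl fun m _ => ?_
    simp only [scaledMatrix, Matrix.of_apply]
    by_cases hm : (m.1 : ℕ) = (k.1 : ℕ) + 1
    · rw [hm]; ring
    · rw [entry_eq_zero hB k m hm]; simp
  rw [e1, e2, e3, h.eqn k l]
  simp only [scaledMatrix, Matrix.of_apply]
  ring

/-- With g = P_t x, the gradient of `logKernel` is -2κg. By the scaled Lyapunov equation, the drift
and time derivatives of the quadratic form add up to |g₀|², where g₀ is the first block of g. The
second-order part sees P_t only in the block (0, 0), where it equals P/t. -/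
theorem opL_logKernel {n : ℕ} {p : Fin (n + 1) → ℕ} {B P : BlockMatrix p}
    (hB : IsDriftMatrix p B) (h : IsLyapunov B P) (s κ : ℝ) {M : BlockMatrix p}
    (hM : ∀ k l : (Σ i : Fin (n + 1), Fin (p i)), ((k.1 : ℕ) ≠ 0 ∨ (l.1 : ℕ) ≠ 0) → M k l = 0)
    {z : SpaceTime p} (hz : z.2 ≠ 0) :
    opL B (fun _ => M) (logKernel P s κ) z = s / z.2 - 2 * κ * ((M * P).trace / z.2) -
      κ * ((scaledMatrix P z.2).mulVec z.1 ⬝ᵥ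
        (firstBlock p).mulVec ((scaledMatrix P z.2).mulVec z.1)) := by
  have hPt : ∀ k l, scaledMatrix P z.2 k l = scaledMatrix P z.2 l k := by
    intro k l
    simp only [scaledMatrix, Matrix.of_apply, h.comm k l]
    rw [add_comm (k.1 : ℕ)]
  have hsym : (scaledMatrix P z.2).transpose = scaledMatrix P z.2 := by
    ext k l
    exact hPt l k
  set Pt := scaledMatrix P z.2 with hPtdef
  set g := Pt.mulVec z.1.ofLp with hg
  have hvm : Matrix.vecMul z.1.ofLp Pt = g := by
    rw [hg, ← Matrix.vecMul_transpose, hsym]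
  have hly : g ⬝ᵥ (firstBlock p).mulVec g = 2 * (B.transpose.mulVec z.1.ofLp ⬝ᵥ g) +
      ∑ k, ∑ l, ((k.1 : ℕ) + (l.1 : ℕ) + 1) * (z.2)⁻¹ * Pt k l * (z.1 k * z.1 l) := by
    have e0 : Pt * firstBlock p * Pt = Pt * B.transpose + B * Pt +
        Matrix.of fun k l => ((k.1 : ℕ) + (l.1 : ℕ) + 1) * z.2⁻¹ * Pt k l := by
      ext k l
      simpa using h.scaled hB z.2 k l
    have e1 : g ⬝ᵥ (firstBlock p).mulVec g =
        z.1.ofLp ⬝ᵥ (Pt * firstBlock p * Pt).mulVec z.1.ofLp := by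
      rw [Matrix.mul_assoc, ← Matrix.mulVec_mulVec, Matrix.dotProduct_mulVec z.1.ofLp, hvm,
        ← Matrix.mulVec_mulVec]
    rw [e1, e0, Matrix.add_mulVec, Matrix.add_mulVec, dotProduct_add, dotProduct_add,
      ← Matrix.mulVec_mulVec, Matrix.dotProduct_mulVec z.1.ofLp, hvm, ← Matrix.mulVec_mulVec,
      Matrix.dotProduct_mulVec z.1.ofLp B, ← Matrix.mulVec_transpose, dotProduct_comm g]
    have e2 : z.1.ofLp ⬝ᵥ (Matrix.of fun k l : (Σ i : Fin (n + 1), Fin (p i)) =>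
        (((k.1 : ℕ) : ℝ) + ((l.1 : ℕ) : ℝ) + 1) * z.2⁻¹ * Pt k l).mulVec z.1.ofLp =
        ∑ k, ∑ l, ((k.1 : ℕ) + (l.1 : ℕ) + 1) * (z.2)⁻¹ * Pt k l * (z.1 k * z.1 l) := by
      simp only [dotProduct, Matrix.mulVec, Finset.mul_sum, Matrix.of_apply]
      exact Finset.sum_congr rfl fun k _ => Finset.sum_congr rfl fun l _ => by ring
    rw [e2]
    ring
  have hdr : ∑ k, (driftVec B z).1 k * ∑ l, Pt k l * z.1 l = B.transpose.mulVec z.1.ofLp ⬝ᵥ g := by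
    rw [dotProduct]
    refine Finset.sum_congr rfl fun k _ => ?_
    rw [driftVec, flowGen_apply]
    simp [hg, Matrix.mulVec, dotProduct]
  have htr : ∑ i, ∑ j, M i j * Pt i j = (M * P).trace / z.2 := by
    simp only [Matrix.trace, Matrix.diag_apply, Matrix.mul_apply, Finset.sum_div]
    refine Finset.sum_congr rfl fun i _ => Finset.sum_congr rfl fun j _ => ?_
    by_cases hij : (i.1 : ℕ) ≠ 0 ∨ (j.1 : ℕ) ≠ 0
    · simp [hM i j hij]
    · push Not at hij
      rw [hPtdef, scaledMatrix, Matrix.of_apply, hij.1, hij.2, h.comm i j]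
      rw [zero_add, zero_add, pow_one]
      ring
  rw [opL_eq_hessian, fderiv_logKernel h.comm s κ hz, ← hPtdef, hdr, hly]
  simp_rw [partialX_partialX_logKernel h.comm s κ hz, ← hPtdef]
  have : ∑ i, ∑ j, M i j * (-(2 * κ) * Pt i j) = -(2 * κ) * ∑ i, ∑ j, M i j * Pt i j := by
    simp only [Finset.mul_sum]
    exact Finset.sum_congr rfl fun k _ => Finset.sum_congr rfl fun l _ => by ring
  rw [this, htr]
  simp only [driftVec]
  ring

/-- By Ψ'' ≥ Ψ' ≥ 0 it suffices that ⟨M∇f, ∇f⟩ + ℒf ≥ 0. The constants are tuned for this: 4κ²λ = κ,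
so the lower ellipticity bound absorbs the term in |g₀|², and s = 2κΛQ dominates the trace term
since tr(MP) ≤ Λ tr(A₀P) = ΛQ. -/
theorem opL_cutExp_logKernel_nonneg {n : ℕ} {p : Fin (n + 1) → ℕ} {B P : BlockMatrix p}
    (hB : IsDriftMatrix p B) (h : IsLyapunov B P) {lam Lam : ℝ} (hlam : 0 < lam)
    {M : BlockMatrix p} (hM : IsAdmissible lam Lam M) (f₀ : ℝ) {z : SpaceTime p} (hz : 0 < z.2) :
    0 ≤ opL B (fun _ => M) (fun w => cutExp f₀
      (logKernel P (Lam * homDim p / (2 * lam)) (1 / (4 * lam)) w)) z := by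
  set s := Lam * homDim p / (2 * lam) with hs
  set κ := 1 / (4 * lam) with hκ
  have hκ0 : 0 < κ := by positivity
  rw [opL_comp B (fun _ => M) (contDiffAt_logKernel P s κ hz.ne' 2).twiceDiffAt
    (hasDerivAt_cutExp f₀) (hasDerivAt_cutExp' f₀ _), opL_logKernel hB h s κ hM.supp hz.ne']
  simp_rw [partialX_logKernel h.comm s κ hz.ne']
  set g := (scaledMatrix P z.2).mulVec z.1.ofLp with hg
  have hMg : ∑ i, ∑ j, M i j * (-(2 * κ) * (∑ l, scaledMatrix P z.2 i l * z.1 l) *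
      (-(2 * κ) * ∑ l, scaledMatrix P z.2 j l * z.1 l)) = 4 * κ ^ 2 * (g ⬝ᵥ M.mulVec g) := by
    change ∑ i, ∑ j, M i j * (-(2 * κ) * g i * (-(2 * κ) * g j)) = _
    simp only [dotProduct, Matrix.mulVec, Finset.mul_sum]
    exact Finset.sum_congr rfl fun i _ => Finset.sum_congr rfl fun j _ => by ring
  rw [hMg]
  have h1 : 0 ≤ g ⬝ᵥ M.mulVec g := by
    simpa using (hM.posSemidef hlam.le).dotProduct_mulVec_nonneg g
  have h2 : lam * (g ⬝ᵥ (firstBlock p).mulVec g) ≤ g ⬝ᵥ M.mulVec g := by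
    have := hM.lower.dotProduct_mulVec_nonneg g
    rw [Matrix.sub_mulVec, dotProduct_sub, Matrix.smul_mulVec, dotProduct_smul] at this
    simpa using this
  have h3 : (M * P).trace ≤ Lam * homDim p := by
    have := trace_mul_nonneg hM.upper h.posDef.posSemidef
    rw [Matrix.sub_mul, Matrix.trace_sub, Matrix.smul_mul, Matrix.trace_smul, h.trace] at this
    simpa using this
  have h4 : κ * (g ⬝ᵥ (firstBlock p).mulVec g) ≤ 4 * κ ^ 2 * (g ⬝ᵥ M.mulVec g) := by
    have e : κ = 4 * κ ^ 2 * lam := by rw [hκ]; field_simp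
    calc κ * (g ⬝ᵥ (firstBlock p).mulVec g)
        = 4 * κ ^ 2 * (lam * (g ⬝ᵥ (firstBlock p).mulVec g)) := by
          rw [← mul_assoc, ← e]
      _ ≤ _ := by gcongr
  have h5 : 2 * κ * ((M * P).trace / z.2) ≤ s / z.2 := by
    rw [← mul_div_assoc]
    refine div_le_div_of_nonneg_right ?_ hz.le
    calc 2 * κ * (M * P).trace ≤ 2 * κ * (Lam * homDim p) := by gcongr
      _ = s := by rw [hs, hκ]; field_simp; ring
  have h6 := cutExp'_nonneg f₀ (logKernel P s κ z)
  have h7 := cutExp'_le_cutExp'' f₀ (logKernel P s κ z)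
  have h8 : 0 ≤ 4 * κ ^ 2 * (g ⬝ᵥ M.mulVec g) := by positivity
  calc (0 : ℝ) ≤ cutExp' f₀ (logKernel P s κ z) * (4 * κ ^ 2 * (g ⬝ᵥ M.mulVec g) +
        (s / z.2 - 2 * κ * ((M * P).trace / z.2) - κ * (g ⬝ᵥ (firstBlock p).mulVec g))) :=
        mul_nonneg h6 (by linarith)
    _ ≤ _ := by
        rw [mul_add]
        gcongr

/-! ### Bounds for the quadratic form -/

theorem exists_posDef_lower {n : ℕ} {p : Fin (n + 1) → ℕ} {P : BlockMatrix p} (hP : P.PosDef) :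
    ∃ c : ℝ, 0 < c ∧ ∀ x : Space p, c * ‖x‖ ^ 2 ≤ ∑ k, ∑ l, P k l * (x k * x l) := by
  let q : Space p → ℝ := fun x => ∑ k, ∑ l, P k l * (x k * x l)
  have hq : Continuous q := by fun_prop
  have hpos : ∀ x : Space p, x ≠ 0 → 0 < q x := by
    intro x hx
    have h0 : x.ofLp ≠ 0 := fun h => hx (by ext k; exact congrFun h k)
    have := hP.dotProduct_mulVec_pos h0
    have e : star x.ofLp ⬝ᵥ P.mulVec x.ofLp = q x := by
      simp only [dotProduct, Matrix.mulVec, q, Finset.mul_sum, star_trivial]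
      exact Finset.sum_congr rfl fun k _ => Finset.sum_congr rfl fun l _ => by ring
    rwa [e] at this
  have hhom : ∀ (a : ℝ) (x : Space p), q (a • x) = a ^ 2 * q x := by
    intro a x
    simp only [q, Finset.mul_sum, PiLp.smul_apply, smul_eq_mul]
    exact Finset.sum_congr rfl fun k _ => Finset.sum_congr rfl fun l _ => by ring
  by_cases hne : (Metric.sphere (0 : Space p) 1).Nonempty
  · obtain ⟨x₀, hx₀, hmin⟩ := (isCompact_sphere (0 : Space p) 1).exists_isMinOn hne hq.continuousOn
    have hx₀' : x₀ ≠ 0 := by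
      rintro rfl
      simp at hx₀
    refine ⟨q x₀, hpos x₀ hx₀', fun x => ?_⟩
    by_cases hx : x = 0
    · subst hx; simp
    · have hn : ‖x‖ ≠ 0 := norm_ne_zero_iff.2 hx
      have h1 : q x₀ ≤ q (‖x‖⁻¹ • x) := hmin (by simp [norm_smul, hn])
      rw [hhom] at h1
      have h2 : 0 < ‖x‖ ^ 2 := by positivity
      calc q x₀ * ‖x‖ ^ 2 ≤ (‖x‖⁻¹ ^ 2 * q x) * ‖x‖ ^ 2 := by gcongr
        _ = q x := by field_simp
  -- No unit vector exists: the space is trivial and any constant works.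
  · refine ⟨1, one_pos, fun x => ?_⟩
    by_cases hx : x = 0
    · subst hx; simp
    · exact absurd ⟨‖x‖⁻¹ • x, by simp [norm_smul, norm_ne_zero_iff.2 hx]⟩ hne

theorem quadForm_eq {n : ℕ} {p : Fin (n + 1) → ℕ} (P : BlockMatrix p) (z : SpaceTime p) :
    quadForm P z = z.2⁻¹ * ∑ k, ∑ l, P k l *
      (((z.2⁻¹) ^ (k.1 : ℕ) * z.1 k) * ((z.2⁻¹) ^ (l.1 : ℕ) * z.1 l)) := by
  simp only [quadForm, scaledMatrix, Matrix.of_apply, Finset.mul_sum]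
  exact Finset.sum_congr rfl fun k _ => Finset.sum_congr rfl fun l _ => by ring

theorem exists_quadForm_lower {n : ℕ} {p : Fin (n + 1) → ℕ} {P : BlockMatrix p} (hP : P.PosDef)
    {T : ℝ} (hT : 1 ≤ T) : ∃ c : ℝ, 0 < c ∧ ∀ z : SpaceTime p, 0 < z.2 → z.2 ≤ T →
      c * ‖z.1‖ ^ 2 / z.2 ≤ quadForm P z := by
  obtain ⟨c, hc, h⟩ := exists_posDef_lower hP
  have hT0 : 0 < T := by linarith
  -- For times at most `T`, with `T ≥ 1`, the squared weight of block `i ≤ n` is at least `T⁻¹ ^ (2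
  -- * i)`, hence at least `T⁻¹ ^ (2 * n)`.
  refine ⟨c * (T⁻¹) ^ (2 * n), by positivity, fun z hz hzT => ?_⟩
  have h1 := h (WithLp.toLp 2 fun k => (z.2⁻¹) ^ (k.1 : ℕ) * z.1 k)
  rw [quadForm_eq, div_eq_inv_mul]
  refine mul_le_mul_of_nonneg_left (le_trans ?_ h1) (by positivity)
  rw [mul_assoc]
  refine mul_le_mul_of_nonneg_left ?_ hc.le
  rw [EuclideanSpace.norm_sq_eq, EuclideanSpace.norm_sq_eq, Finset.mul_sum]
  refine Finset.sum_le_sum fun k _ => ?_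
  rw [norm_mul, mul_pow]
  refine mul_le_mul_of_nonneg_right ?_ (by positivity)
  rw [norm_pow, Real.norm_of_nonneg (by positivity), ← pow_mul]
  calc T⁻¹ ^ (2 * n) ≤ T⁻¹ ^ ((k.1 : ℕ) * 2) := by
        refine pow_le_pow_of_le_one (by positivity) (inv_le_one_of_one_le₀ hT) ?_
        have := k.1.2
        omega
    _ ≤ _ := by gcongr

/-! ### The kernel -/

/-- The truncated kernel: `cutExp f₀ ∘ logKernel` for positive times, `0` otherwise. -/
def kernel {n : ℕ} {p : Fin (n + 1) → ℕ} (P : BlockMatrix p) (s κ f₀ : ℝ) (z : SpaceTime p) : ℝ :=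
  if 0 < z.2 then cutExp f₀ (logKernel P s κ z) else 0

theorem kernel_nonneg {n : ℕ} {p : Fin (n + 1) → ℕ} (P : BlockMatrix p) (s κ f₀ : ℝ)
    (z : SpaceTime p) : 0 ≤ kernel P s κ f₀ z := by
  unfold kernel
  split_ifs
  · exact cutExp_nonneg _ _
  · exact le_rfl

/-- Near (y, 0) with y ≠ 0, the quadratic form is at least a multiple of 1/t and beats the
logarithm, so `logKernel` tends to -∞ as t decreases to 0. -/
theorem eventually_logKernel_le {n : ℕ} {p : Fin (n + 1) → ℕ} {P : BlockMatrix p} (hP : P.PosDef)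
    (s : ℝ) {κ : ℝ} (hκ : 0 < κ) (f₀ : ℝ) {y : Space p} (hy : y ≠ 0) :
    ∀ᶠ w : SpaceTime p in 𝓝 (y, 0), 0 < w.2 → logKernel P s κ w ≤ f₀ := by
  obtain ⟨c, hc, hq⟩ := exists_quadForm_lower hP le_rfl
  have hn : 0 < ‖y‖ ^ 2 := by have := norm_pos_iff.2 hy; positivity
  set a := κ * (c * (‖y‖ ^ 2 / 2)) with ha
  have ha0 : 0 < a := by positivity
  have ht : Tendsto (fun σ : ℝ => (-s * (Real.log σ * σ) - a) * σ⁻¹) (𝓝[>] 0) atBot := by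
    refine Tendsto.neg_mul_atTop (C := -s * 0 - a) (by linarith) ?_ tendsto_inv_nhdsGT_zero
    have h0 : Tendsto (fun σ : ℝ => Real.log σ * σ) (𝓝[>] 0) (𝓝 0) := by
      have := (Real.continuous_mul_log.tendsto 0).mono_left (nhdsWithin_le_nhds (s := Ioi 0))
      simpa [mul_comm] using this
    exact (tendsto_const_nhds.mul h0).sub tendsto_const_nhds
  have h1 : ∀ᶠ w : SpaceTime p in 𝓝 (y, 0),
      0 < w.2 → (-s * (Real.log w.2 * w.2) - a) * w.2⁻¹ ≤ f₀ := by
    have := eventually_nhdsWithin_iff.1 (ht.eventually (eventually_le_atBot f₀))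
    have hc : Tendsto (fun w : SpaceTime p => w.2) (𝓝 (y, 0)) (𝓝 0) :=
      continuous_snd.tendsto (y, (0 : ℝ))
    exact hc.eventually this
  have h2 : ∀ᶠ w : SpaceTime p in 𝓝 (y, 0), w.2 < 1 :=
    continuous_snd.continuousAt.eventually (gt_mem_nhds (show ((y, 0) : SpaceTime p).2 < 1 by simp))
  have h3 : ∀ᶠ w : SpaceTime p in 𝓝 (y, 0), ‖y‖ ^ 2 / 2 < ‖w.1‖ ^ 2 := by
    have hcn : Continuous fun w : SpaceTime p => ‖w.1‖ ^ 2 := by fun_prop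
    exact hcn.continuousAt.eventually (lt_mem_nhds (show ‖y‖ ^ 2 / 2 < ‖y‖ ^ 2 by linarith))
  filter_upwards [h1, h2, h3] with w h1 h2 h3 hw
  refine le_trans ?_ (h1 hw)
  have h4 := hq w hw h2.le
  have h5 : c * (‖y‖ ^ 2 / 2) / w.2 ≤ quadForm P w := le_trans (by gcongr) h4
  have h6 : κ * (c * (‖y‖ ^ 2 / 2) / w.2) ≤ κ * quadForm P w := by gcongr
  have h7 : (-s * (Real.log w.2 * w.2) - a) * w.2⁻¹ =
      -s * Real.log w.2 - κ * (c * (‖y‖ ^ 2 / 2) / w.2) := by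
    rw [ha]; field_simp
  rw [h7, logKernel]
  linarith

theorem kernel_eventuallyEq_zero {n : ℕ} {p : Fin (n + 1) → ℕ} {P : BlockMatrix p} (hP : P.PosDef)
    (s : ℝ) {κ : ℝ} (hκ : 0 < κ) (f₀ : ℝ) {z : SpaceTime p} (hz : z ≠ 0) (ht : z.2 ≤ 0) :
    kernel P s κ f₀ =ᶠ[𝓝 z] fun _ => 0 := by
  rcases ht.lt_or_eq with ht | ht
  · filter_upwards [continuous_snd.continuousAt.eventually (gt_mem_nhds ht)] with w hw
    exact if_neg (not_lt.2 hw.le)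
  · obtain ⟨y, t⟩ := z
    have ht' : t = 0 := ht
    subst ht'
    have hy : y ≠ 0 := by
      rintro rfl
      exact hz rfl
    filter_upwards [eventually_logKernel_le hP s hκ f₀ hy] with w hw
    unfold kernel
    split_ifs with h
    · exact cutExp_eq_zero (hw h)
    · rfl

theorem kernel_eventuallyEq {n : ℕ} {p : Fin (n + 1) → ℕ} (P : BlockMatrix p)
    (s κ f₀ : ℝ) {z : SpaceTime p} (ht : 0 < z.2) :
    kernel P s κ f₀ =ᶠ[𝓝 z] fun w => cutExp f₀ (logKernel P s κ w) := by
  filter_upwards [continuous_snd.continuousAt.eventually (lt_mem_nhds ht)] with w hw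
  exact if_pos hw

/-- The truncated kernel is identically zero near the points of t = 0 other than the origin, which
is therefore its only singularity. -/
theorem contDiffAt_kernel {n : ℕ} {p : Fin (n + 1) → ℕ} {P : BlockMatrix p} (hP : P.PosDef)
    (s : ℝ) {κ : ℝ} (hκ : 0 < κ) (f₀ : ℝ) {z : SpaceTime p} (hz : z ≠ 0) :
    ContDiffAt ℝ 2 (kernel P s κ f₀) z := by
  rcases le_or_gt z.2 0 with ht | ht
  · exact contDiffAt_const.congr_of_eventuallyEq (kernel_eventuallyEq_zero hP s hκ f₀ hz ht)
  · exact ((contDiff_cutExp f₀).contDiffAt.comp z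
      (contDiffAt_logKernel P s κ ht.ne' 2)).congr_of_eventuallyEq
        (kernel_eventuallyEq P s κ f₀ ht)

theorem opL_congr {n : ℕ} {p : Fin (n + 1) → ℕ} (B : BlockMatrix p)
    (A : SpaceTime p → BlockMatrix p) {u v : SpaceTime p → ℝ} {z : SpaceTime p}
    (h : u =ᶠ[𝓝 z] v) : opL B A u z = opL B A v z := by
  have h1 : ∀ i, partialX i u =ᶠ[𝓝 z] partialX i v := by
    intro i
    filter_upwards [h.eventuallyEq_nhds] with w hw
    unfold partialX
    rw [hw.fderiv_eq]
  have h2 : ∀ i j, partialX j (partialX i u) z = partialX j (partialX i v) z := by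
    intro i j
    have := (h1 i).fderiv_eq (𝕜 := ℝ)
    exact congrArg (fun l => l (EuclideanSpace.single j 1, (0 : ℝ))) this
  rw [opL_eq_hessian, opL_eq_hessian, h.fderiv_eq]
  simp_rw [h2]

theorem opL_kernel_nonneg {n : ℕ} {p : Fin (n + 1) → ℕ} {B P : BlockMatrix p}
    (hB : IsDriftMatrix p B) (h : IsLyapunov B P) {lam Lam : ℝ} (hlam : 0 < lam)
    {M : BlockMatrix p} (hM : IsAdmissible lam Lam M) (f₀ : ℝ) {z : SpaceTime p} (hz : z ≠ 0) :
    0 ≤ opL B (fun _ => M)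
      (kernel P (Lam * homDim p / (2 * lam)) (1 / (4 * lam)) f₀) z := by
  rcases le_or_gt z.2 0 with ht | ht
  · rw [opL_congr B _ (kernel_eventuallyEq_zero h.posDef _ (by positivity) f₀ hz ht),
      TwiceDiffAt.opL_eq (contDiffAt_const.twiceDiffAt)]
    simp
  · rw [opL_congr B _ (kernel_eventuallyEq P _ _ f₀ ht)]
    exact opL_cutExp_logKernel_nonneg hB h hlam hM f₀ ht

/-! ### Left translates of the kernel. -/

/-- `(z, ζ) ↦ ζ⁻¹ ∘ z`. -/
def shiftMap {n : ℕ} {p : Fin (n + 1) → ℕ} (B : BlockMatrix p)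
    (q : SpaceTime p × SpaceTime p) : SpaceTime p :=
  (q.1.1 - expFlow B (q.1.2 - q.2.2) q.2.1, q.1.2 - q.2.2)

theorem contDiff_shiftMap {n : ℕ} {p : Fin (n + 1) → ℕ} (B : BlockMatrix p) (m : WithTop ℕ∞) :
    ContDiff ℝ m (shiftMap B) := by
  have h1 : ContDiff ℝ m fun q : SpaceTime p × SpaceTime p => q.1.2 - q.2.2 :=
    (contDiff_snd.comp contDiff_fst).sub (contDiff_snd.comp contDiff_snd)
  exact ((contDiff_fst.comp contDiff_fst).sub (((contDiff_expFlow B m).comp h1).clm_apply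
    (contDiff_fst.comp contDiff_snd))).prodMk h1

theorem shiftMap_ne_zero {n : ℕ} {p : Fin (n + 1) → ℕ} (B : BlockMatrix p)
    {z ζ : SpaceTime p} (h : z ≠ ζ) : shiftMap B (z, ζ) ≠ 0 := by
  intro h0
  have h2 : z.2 - ζ.2 = 0 := congrArg Prod.snd h0
  have h1 : z.1 - expFlow B (z.2 - ζ.2) ζ.1 = 0 := congrArg Prod.fst h0
  rw [h2, expFlow_zero] at h1
  exact h (Prod.ext (sub_eq_zero.1 h1) (sub_eq_zero.1 h2))

/-- The inverse of ζ = (ξ, τ) is (-E(-τ)ξ, -τ); in this form `opL_comp_affineMap` applies with `r =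
1`. -/
theorem shiftMap_eq_affineMap {n : ℕ} {p : Fin (n + 1) → ℕ} (B : BlockMatrix p)
    (z ζ : SpaceTime p) :
    shiftMap B (z, ζ) = affineMap B (-expFlow B (-ζ.2) ζ.1, -ζ.2) 1 z := by
  simp only [shiftMap, affineMap, groupMul, dilation_one, one_pow, one_mul, map_neg,
    ← expFlow_add_apply]
  ext1
  · simp [sub_eq_add_neg]
  · simp only; ring

theorem opL_kernel_shiftMap_nonneg {n : ℕ} {p : Fin (n + 1) → ℕ} {B P : BlockMatrix p}
    (hB : IsDriftMatrix p B) (h : IsLyapunov B P) {lam Lam : ℝ} (hlam : 0 < lam)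
    {M : BlockMatrix p} (hM : IsAdmissible lam Lam M) (f₀ : ℝ) {z ζ : SpaceTime p} (hz : z ≠ ζ) :
    0 ≤ opL B (fun _ => M) (fun w =>
      kernel P (Lam * homDim p / (2 * lam)) (1 / (4 * lam)) f₀ (shiftMap B (w, ζ))) z := by
  have hne := shiftMap_ne_zero B hz
  simp_rw [shiftMap_eq_affineMap] at hne ⊢
  rw [opL_comp_affineMap hB _ 1 M hM.supp _ z
    (contDiffAt_kernel h.posDef _ (by positivity) f₀ hne).twiceDiffAt, one_pow, one_mul]
  exact opL_kernel_nonneg hB h hlam hM f₀ hne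

/-! ### Differentiation under the integral sign -/

/-- A tube around `{z₀} × S` inside `W` gives a uniform bound on the derivative, hence the
domination. Values in `G` allow a second application, to the derivative itself; the functionals φ
bring operator-valued integrals back to scalar ones. -/
theorem hasFDerivAt_setIntegral_of_contDiffOn {H F G : Type*} [NormedAddCommGroup H]
    [NormedSpace ℝ H] [ProperSpace H] [NormedAddCommGroup F] [NormedSpace ℝ F]
    [MeasurableSpace F] [BorelSpace F] [SecondCountableTopology F] [NormedAddCommGroup G]
    [NormedSpace ℝ G] [CompleteSpace G] {μ : Measure F} [IsFiniteMeasureOnCompacts μ]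
    {k : H × F → G} {W : Set (H × F)} (hW : IsOpen W) (hk : ContDiffOn ℝ 1 k W) {S E : Set F}
    (hS : IsCompact S) (hE : MeasurableSet E) (hES : E ⊆ S) {z₀ : H} (hz₀ : ∀ ζ ∈ S, (z₀, ζ) ∈ W) :
    HasFDerivAt (fun z => ∫ ζ in E, k (z, ζ) ∂μ)
        (∫ ζ in E, (fderiv ℝ k (z₀, ζ)).comp (ContinuousLinearMap.inl ℝ H F) ∂μ) z₀ ∧
      ∀ φ : (H →L[ℝ] G) →L[ℝ] ℝ,
        IntegrableOn (fun ζ => φ ((fderiv ℝ k (z₀, ζ)).comp (ContinuousLinearMap.inl ℝ H F))) E μ ∧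
        φ (∫ ζ in E, (fderiv ℝ k (z₀, ζ)).comp (ContinuousLinearMap.inl ℝ H F) ∂μ) =
          ∫ ζ in E, φ ((fderiv ℝ k (z₀, ζ)).comp (ContinuousLinearMap.inl ℝ H F)) ∂μ := by
  let k' : H × F → H →L[ℝ] G := fun q => (fderiv ℝ k q).comp (ContinuousLinearMap.inl ℝ H F)
  have hk' : ContinuousOn k' W :=
    (hk.continuousOn_fderiv_of_isOpen hW le_rfl).clm_comp continuousOn_const
  obtain ⟨V, T, hV, -, hzV, hST, hVT⟩ :=
    generalized_tube_lemma (isCompact_singleton (x := z₀)) hS hW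
    (by rintro ⟨z, ζ⟩ ⟨rfl, hζ⟩; exact hz₀ ζ hζ)
  obtain ⟨ε, hε, hball⟩ := Metric.nhds_basis_closedBall.mem_iff.1
    (hV.mem_nhds (hzV rfl))
  have hsub : ∀ z ∈ Metric.closedBall z₀ ε, ∀ ζ ∈ S, (z, ζ) ∈ W := fun z hz ζ hζ =>
    hVT ⟨hball hz, hST hζ⟩
  have hcs : ∀ z ∈ Metric.closedBall z₀ ε, ContinuousOn (fun ζ => k (z, ζ)) S := fun z hz =>
    hk.continuousOn.comp (by fun_prop) fun ζ hζ => hsub z hz ζ hζ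
  have hcs' : ∀ z ∈ Metric.closedBall z₀ ε, ContinuousOn (fun ζ => k' (z, ζ)) S := fun z hz =>
    hk'.comp (by fun_prop) fun ζ hζ => hsub z hz ζ hζ
  have hz₀b : z₀ ∈ Metric.closedBall z₀ ε := Metric.mem_closedBall_self hε.le
  obtain ⟨C, hC⟩ := ((isCompact_closedBall z₀ ε).prod hS).exists_bound_of_continuousOn
    (hk'.mono fun q hq => hsub q.1 hq.1 q.2 hq.2)
  have hEfin : μ E ≠ ⊤ := ((measure_mono hES).trans_lt hS.measure_lt_top).ne
  have hkint : IntegrableOn (fun ζ => k' (z₀, ζ)) E μ :=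
    ((hcs' z₀ hz₀b).integrableOn_compact hS).mono_set hES
  refine ⟨?_, fun φ => ⟨φ.integrable_comp hkint, (φ.integral_comp_comm hkint).symm⟩⟩
  refine hasFDerivAt_integral_of_dominated_of_fderiv_le (𝕜 := ℝ) (F' := fun z ζ => k' (z, ζ))
    (bound := fun _ => C) (Metric.closedBall_mem_nhds z₀ hε) ?_ ?_ ?_ ?_ ?_ ?_
  · filter_upwards [Metric.closedBall_mem_nhds z₀ hε] with z hz
    exact (((hcs z hz).integrableOn_compact hS).mono_set hES).aestronglyMeasurable
  · exact ((hcs z₀ hz₀b).integrableOn_compact hS).mono_set hES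
  · exact (((hcs' z₀ hz₀b).integrableOn_compact hS).mono_set hES).aestronglyMeasurable
  · filter_upwards [ae_restrict_mem hE] with ζ hζ z hz
    exact hC (z, ζ) ⟨hz, hES hζ⟩
  · exact integrableOn_const hEfin
  · filter_upwards [ae_restrict_mem hE] with ζ hζ z hz
    have h1 : DifferentiableAt ℝ k (z, ζ) :=
      ((hk.contDiffAt (hW.mem_nhds (hsub z hz ζ (hES hζ)))).differentiableAt (by simp))
    have h2 : HasFDerivAt (fun z : H => (z, ζ)) (ContinuousLinearMap.inl ℝ H F) z :=
      hasFDerivAt_prodMk_left z ζ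
    exact h1.hasFDerivAt.comp z h2

theorem fderiv_partial_left {H F G : Type*} [NormedAddCommGroup H] [NormedSpace ℝ H]
    [NormedAddCommGroup F] [NormedSpace ℝ F] [NormedAddCommGroup G] [NormedSpace ℝ G]
    {W : Set (H × F)} (hW : IsOpen W) {g : H × F → G} (hg : ContDiffOn ℝ 1 g W) (w : H) (ζ : F)
    (hw : (w, ζ) ∈ W) : fderiv ℝ (fun w => g (w, ζ)) w =
      (fderiv ℝ g (w, ζ)).comp (ContinuousLinearMap.inl ℝ H F) := by
  have h1 : DifferentiableAt ℝ g (w, ζ) :=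
    (hg.contDiffAt (hW.mem_nhds hw)).differentiableAt (by simp)
  have h2 : HasFDerivAt (fun z : H => (z, ζ)) (ContinuousLinearMap.inl ℝ H F) w :=
    hasFDerivAt_prodMk_left w ζ
  exact (h1.hasFDerivAt.comp w h2).fderiv

theorem twiceDiffAt_setIntegral {H F : Type*} [NormedAddCommGroup H]
    [NormedSpace ℝ H] [ProperSpace H] [NormedAddCommGroup F] [NormedSpace ℝ F]
    [MeasurableSpace F] [BorelSpace F] [SecondCountableTopology F]
    {μ : Measure F} [IsFiniteMeasureOnCompacts μ]
    {k : H × F → ℝ} {W : Set (H × F)} (hW : IsOpen W) (hk : ContDiffOn ℝ 2 k W) {S E : Set F}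
    (hS : IsCompact S) (hE : MeasurableSet E) (hES : E ⊆ S) {D : Set H} (hD : IsOpen D)
    (hDS : ∀ z ∈ D, ∀ ζ ∈ S, (z, ζ) ∈ W) {z : H} (hz : z ∈ D) :
    TwiceDiffAt (fun z => ∫ ζ in E, k (z, ζ) ∂μ) z ∧
    (∀ φ : (H →L[ℝ] ℝ) →L[ℝ] ℝ, IntegrableOn (fun ζ => φ (fderiv ℝ (fun w => k (w, ζ)) z)) E μ ∧
      φ (fderiv ℝ (fun z => ∫ ζ in E, k (z, ζ) ∂μ) z) =
        ∫ ζ in E, φ (fderiv ℝ (fun w => k (w, ζ)) z) ∂μ) ∧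
    ∀ φ : (H →L[ℝ] H →L[ℝ] ℝ) →L[ℝ] ℝ,
      IntegrableOn (fun ζ => φ (fderiv ℝ (fderiv ℝ fun w => k (w, ζ)) z)) E μ ∧
      φ (fderiv ℝ (fderiv ℝ fun z => ∫ ζ in E, k (z, ζ) ∂μ) z) =
        ∫ ζ in E, φ (fderiv ℝ (fderiv ℝ fun w => k (w, ζ)) z) ∂μ := by
  let k' : H × F → H →L[ℝ] ℝ := fun q => (fderiv ℝ k q).comp (ContinuousLinearMap.inl ℝ H F)
  have hk' : ContDiffOn ℝ 1 k' W :=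
    (hk.fderiv_of_isOpen hW (by norm_num)).clm_comp contDiffOn_const
  have hk1 : ContDiffOn ℝ 1 k W := hk.of_le (by norm_num)
  have hA := fun w (hw : w ∈ D) =>
    hasFDerivAt_setIntegral_of_contDiffOn (μ := μ) hW hk1 hS hE hES (hDS w hw)
  have hB := hasFDerivAt_setIntegral_of_contDiffOn (μ := μ) hW hk' hS hE hES (hDS z hz)
  have he : fderiv ℝ (fun z => ∫ ζ in E, k (z, ζ) ∂μ) =ᶠ[𝓝 z] fun w => ∫ ζ in E, k' (w, ζ) ∂μ := by
    filter_upwards [hD.mem_nhds hz] with w hw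
    exact (hA w hw).1.fderiv
  have e1 : ∀ ζ ∈ E, fderiv ℝ (fun w => k (w, ζ)) z = k' (z, ζ) := fun ζ hζ =>
    fderiv_partial_left hW hk1 z ζ (hDS z hz ζ (hES hζ))
  have e2 : ∀ ζ ∈ E, fderiv ℝ (fderiv ℝ fun w => k (w, ζ)) z =
      (fderiv ℝ k' (z, ζ)).comp (ContinuousLinearMap.inl ℝ H F) := by
    intro ζ hζ
    rw [← fderiv_partial_left hW hk' z ζ (hDS z hz ζ (hES hζ))]
    refine Filter.EventuallyEq.fderiv_eq ?_
    filter_upwards [hD.mem_nhds hz] with w hw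
    exact fderiv_partial_left hW hk1 w ζ (hDS w hw ζ (hES hζ))
  refine ⟨⟨?_, ?_⟩, fun φ => ⟨?_, ?_⟩, fun φ => ⟨?_, ?_⟩⟩
  · filter_upwards [hD.mem_nhds hz] with w hw
    exact (hA w hw).1.differentiableAt
  · exact hB.1.differentiableAt.congr_of_eventuallyEq he
  · exact ((hA z hz).2 φ).1.congr_fun (fun ζ hζ => congrArg φ (e1 ζ hζ).symm) hE
  · rw [(hA z hz).1.fderiv]
    exact ((hA z hz).2 φ).2.trans
      (setIntegral_congr_fun hE fun ζ hζ => congrArg φ (e1 ζ hζ).symm)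
  · exact (hB.2 φ).1.congr_fun (fun ζ hζ => congrArg φ (e2 ζ hζ).symm) hE
  · rw [he.fderiv_eq, hB.1.fderiv]
    exact (hB.2 φ).2.trans (setIntegral_congr_fun hE fun ζ hζ => congrArg φ (e2 ζ hζ).symm)

/-! ### The potential of a set -/

/-- The potential `∫_E k(ζ⁻¹ ∘ z) dζ` of the truncated kernel `k`. -/
def potential {n : ℕ} {p : Fin (n + 1) → ℕ} (B P : BlockMatrix p) (s κ f₀ : ℝ)
    (E : Set (SpaceTime p)) (z : SpaceTime p) : ℝ :=
  ∫ ζ in E, kernel P s κ f₀ (shiftMap B (z, ζ))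

theorem contDiffOn_kernel_shiftMap {n : ℕ} {p : Fin (n + 1) → ℕ} (B : BlockMatrix p)
    {P : BlockMatrix p} (hP : P.PosDef) (s : ℝ) {κ : ℝ} (hκ : 0 < κ) (f₀ : ℝ) :
    ContDiffOn ℝ 2 (fun q : SpaceTime p × SpaceTime p => kernel P s κ f₀ (shiftMap B q))
      {q | q.1 ≠ q.2} := by
  intro q hq
  have h := contDiffAt_kernel hP s hκ f₀ (shiftMap_ne_zero B (show q.1 ≠ q.2 from hq))
  exact (h.comp q (contDiff_shiftMap B 2).contDiffAt).contDiffWithinAt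

/-- At a fixed point, `ℒ` is a continuous linear functional of the first two derivatives, so it
passes under the integral, where each translate of the kernel is a subsolution. The compact set `S`
keeps ζ away from the singularity ζ = z. -/
theorem potential_subsolution {n : ℕ} {p : Fin (n + 1) → ℕ} {B P : BlockMatrix p}
    (hB : IsDriftMatrix p B) (h : IsLyapunov B P) {lam Lam : ℝ} (hlam : 0 < lam) (f₀ : ℝ)
    {D S E : Set (SpaceTime p)} (hD : IsOpen D) (hS : IsCompact S) (hSD : Disjoint S D)
    (hE : MeasurableSet E) (hES : E ⊆ S) {M : BlockMatrix p} (hM : IsAdmissible lam Lam M)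
    {z : SpaceTime p} (hz : z ∈ D) {U : SpaceTime p → ℝ}
    (hU : U = potential B P (Lam * homDim p / (2 * lam)) (1 / (4 * lam)) f₀ E) :
    TwiceDiffAt U z ∧ 0 ≤ secondOrder M (fderiv ℝ (fderiv ℝ U) z) +
      fderiv ℝ U z (driftVec B z) := by
  have hκ : 0 < 1 / (4 * lam) := by positivity
  have hW : IsOpen {q : SpaceTime p × SpaceTime p | q.1 ≠ q.2} :=
    isOpen_ne_fun continuous_fst continuous_snd
  have hDS : ∀ w ∈ D, ∀ ζ ∈ S, (w, ζ) ∈ {q : SpaceTime p × SpaceTime p | q.1 ≠ q.2} := by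
    intro w hw ζ hζ (heq : w = ζ)
    exact hSD.ne_of_mem hζ hw heq.symm
  have hcd := contDiffOn_kernel_shiftMap B h.posDef (Lam * homDim p / (2 * lam)) hκ f₀
  have _ : IsFiniteMeasureOnCompacts (volume : Measure (SpaceTime p)) :=
    inferInstanceAs (IsFiniteMeasureOnCompacts (Measure.prod volume volume))
  obtain ⟨h1, h2, h3⟩ := twiceDiffAt_setIntegral (μ := volume) hW hcd hS hE hES hD hDS hz
  have hUe : U = fun z => ∫ ζ in E, kernel P (Lam * homDim p / (2 * lam)) (1 / (4 * lam)) f₀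
    (shiftMap B (z, ζ)) := hU
  rw [← hUe] at h1 h2 h3
  refine ⟨h1, ?_⟩
  obtain ⟨i2, e2⟩ := h2 (ContinuousLinearMap.apply ℝ ℝ (driftVec B z))
  obtain ⟨i3, e3⟩ := h3 (secondOrder M)
  simp only [ContinuousLinearMap.apply_apply] at i2 e2
  rw [e2, e3, ← integral_add i3 i2]
  refine setIntegral_nonneg hE fun ζ hζ => ?_
  have hne : z ≠ ζ := hDS z hz ζ (hES hζ)
  have htd : TwiceDiffAt (fun w => kernel P (Lam * homDim p / (2 * lam)) (1 / (4 * lam)) f₀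
      (shiftMap B (w, ζ))) z := by
    have hc := contDiffAt_kernel h.posDef (Lam * homDim p / (2 * lam)) hκ f₀
      (shiftMap_ne_zero B hne)
    have hp : ContDiffAt ℝ 2 (fun w : SpaceTime p => shiftMap B (w, ζ)) z :=
      ((contDiff_shiftMap B 2).comp (contDiff_id.prodMk contDiff_const)).contDiffAt
    exact (hc.comp z hp).twiceDiffAt
  have := opL_kernel_shiftMap_nonneg hB h hlam hM f₀ hne
  rwa [htd.opL_eq] at this

/-! ### The upper bound of the potential -/

/-- The powers of `t` in `scaledMatrix` amount to the dilation of parameter t^{-1/2} applied to both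
arguments of the form of `P`. -/
theorem quadForm_ge_dilation {n : ℕ} {p : Fin (n + 1) → ℕ} {P : BlockMatrix p} {c : ℝ}
    (hc : ∀ x : Space p, c * ‖x‖ ^ 2 ≤ ∑ k, ∑ l, P k l * (x k * x l)) (z : SpaceTime p)
    (hz : 0 < z.2) : c * ‖dilation p (√(z.2⁻¹)) z.1‖ ^ 2 ≤ quadForm P z := by
  refine (hc _).trans_eq ?_
  have hr : √(z.2⁻¹) ^ 2 = z.2⁻¹ := Real.sq_sqrt (by positivity)
  simp only [quadForm, scaledMatrix, Matrix.of_apply, dilation_apply]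
  refine Finset.sum_congr rfl fun k _ => Finset.sum_congr rfl fun l _ => ?_
  have : √(z.2⁻¹) ^ (2 * (k.1 : ℕ) + 1) * √(z.2⁻¹) ^ (2 * (l.1 : ℕ) + 1) =
      (z.2⁻¹) ^ ((k.1 : ℕ) + (l.1 : ℕ) + 1) := by
    rw [← pow_add, show 2 * (k.1 : ℕ) + 1 + (2 * (l.1 : ℕ) + 1) =
      2 * ((k.1 : ℕ) + (l.1 : ℕ) + 1) by ring, pow_mul, hr]
  rw [← this]
  ring

theorem lintegral_comp_sub_linearMap {V : Type*} [NormedAddCommGroup V] [NormedSpace ℝ V]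
    [MeasurableSpace V] [BorelSpace V] [FiniteDimensional ℝ V] (μ : Measure V)
    [μ.IsAddHaarMeasure] (L : V →ₗ[ℝ] V) (hL : LinearMap.det L ≠ 0) (v : V) (g : V → ENNReal)
    (hg : Measurable g) :
    ∫⁻ ξ, g (v - L ξ) ∂μ = ENNReal.ofReal |(LinearMap.det L)⁻¹| * ∫⁻ w, g w ∂μ := by
  have hLm : Measurable L := (LinearMap.continuous_of_finiteDimensional L).measurable
  have h1 : ∫⁻ ξ, g (v - L ξ) ∂μ = ∫⁻ w, g (v - w) ∂(μ.map L) := by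
    have hm : Measurable fun w => g (v - w) := hg.comp (measurable_const.sub measurable_id)
    rw [lintegral_map hm hLm]
  rw [h1, Measure.map_linearMap_addHaar_eq_smul_addHaar μ hL, lintegral_smul_measure,
    lintegral_sub_left_eq_self, smul_eq_mul]

theorem lintegral_exp_neg_mul_norm_sq_lt_top {n : ℕ} (p : Fin (n + 1) → ℕ) {a : ℝ} (ha : 0 < a) :
    ∫⁻ w : Space p, ENNReal.ofReal (Real.exp (-a * ‖w‖ ^ 2)) < ⊤ := by
  have h := GaussianFourier.integrable_cexp_neg_mul_sq_norm_add (V := Space p) (b := (a : ℂ))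
    (by simpa using ha) 0 0
  have h2 := h.norm
  have h3 : Integrable (fun w : Space p => Real.exp (-a * ‖w‖ ^ 2)) := by
    refine h2.congr (Eventually.of_forall fun w => ?_)
    simp only [Complex.norm_exp]
    congr 1
    simp [← Complex.ofReal_pow]
  have := h3.hasFiniteIntegral
  simpa [HasFiniteIntegral, Real.enorm_eq_ofReal, (Real.exp_pos _).le] using this

theorem continuous_dilation {n : ℕ} (p : Fin (n + 1) → ℕ) :
    Continuous fun q : ℝ × Space p => dilation p q.1 q.2 := by
  have h : (fun q : ℝ × Space p => dilation p q.1 q.2) =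
      fun q => WithLp.toLp 2 fun k => q.1 ^ (2 * (k.1 : ℕ) + 1) * q.2 k := by
    funext q
    ext k
    simp
  rw [h]
  refine (PiLp.continuous_toLp 2 _).comp (continuous_pi fun k => ?_)
  fun_prop

theorem det_expFlow_ne_zero {n : ℕ} {p : Fin (n + 1) → ℕ} (B : BlockMatrix p) (σ : ℝ) :
    LinearMap.det (expFlow B σ : Space p →ₗ[ℝ] Space p) ≠ 0 := by
  intro h
  have h1 : (expFlow B (-σ) : Space p →ₗ[ℝ] Space p) ∘ₗ (expFlow B σ : Space p →ₗ[ℝ] Space p) =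
      LinearMap.id := by
    ext1 x
    show expFlow B (-σ) (expFlow B σ x) = x
    rw [← expFlow_add_apply, neg_add_cancel, expFlow_zero]
    rfl
  have h2 := congrArg LinearMap.det h1
  rw [LinearMap.det_comp, h, mul_zero, LinearMap.det_id] at h2
  exact zero_ne_one h2

theorem lintegral_Ioo_rpow {θ T : ℝ} (hθ : 0 < θ) (hT : 0 < T) :
    ∫⁻ σ in Ioo 0 T, ENNReal.ofReal (σ ^ (θ - 1)) = ENNReal.ofReal (T ^ θ / θ) := by
  have hi : IntervalIntegrable (fun σ : ℝ => σ ^ (θ - 1)) volume 0 T :=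
    intervalIntegral.intervalIntegrable_rpow' (by linarith)
  have hi2 : IntegrableOn (fun σ : ℝ => σ ^ (θ - 1)) (Ioo 0 T) :=
    ((intervalIntegrable_iff_integrableOn_Ioc_of_le hT.le).1 hi).mono_set Ioo_subset_Ioc_self
  rw [← ofReal_integral_eq_lintegral_ofReal hi2, ← integral_Ioc_eq_integral_Ioo,
    ← intervalIntegral.integral_of_le hT.le, integral_rpow (Or.inl (by linarith))]
  · congr 1
    rw [sub_add_cancel, Real.zero_rpow hθ.ne', sub_zero]
  · filter_upwards [ae_restrict_mem measurableSet_Ioo] with σ hσ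
    exact Real.rpow_nonneg hσ.1.le _

/-- The Gaussian bound `σ^{-s} exp (-a |δ(x) - E(1) δ(ξ)|²)`, where `δ` is the dilation of parameter
`σ^{-1/2}`. -/
def gaussBound {n : ℕ} {p : Fin (n + 1) → ℕ} (B : BlockMatrix p) (s a : ℝ) (x : Space p)
    (q : ℝ × Space p) : ENNReal :=
  ENNReal.ofReal (q.1 ^ (-s)) * ENNReal.ofReal (Real.exp (-a * ‖dilation p (√(q.1⁻¹)) x -
    expFlow B 1 (dilation p (√(q.1⁻¹)) q.2)‖ ^ 2))

theorem measurable_gaussBound {n : ℕ} {p : Fin (n + 1) → ℕ} (B : BlockMatrix p) (s a : ℝ)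
    (x : Space p) : Measurable (gaussBound B s a x) := by
  have hr : Measurable fun q : ℝ × Space p => √(q.1⁻¹) :=
    Real.continuous_sqrt.measurable.comp measurable_fst.inv
  have m1 : Measurable fun q : ℝ × Space p => dilation p (√(q.1⁻¹)) x :=
    Measurable.comp (g := fun q : ℝ × Space p => dilation p q.1 q.2)
      (f := fun q : ℝ × Space p => (√(q.1⁻¹), x)) (continuous_dilation p).measurable
      (hr.prodMk measurable_const)
  have m2 : Measurable fun q : ℝ × Space p => dilation p (√(q.1⁻¹)) q.2 :=
    Measurable.comp (g := fun q : ℝ × Space p => dilation p q.1 q.2)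
      (f := fun q : ℝ × Space p => (√(q.1⁻¹), q.2)) (continuous_dilation p).measurable
      (hr.prodMk measurable_snd)
  have m3 : Measurable fun q : ℝ × Space p => expFlow B 1 (dilation p (√(q.1⁻¹)) q.2) :=
    (expFlow B 1).continuous.measurable.comp m2
  have m4 : Measurable fun q : ℝ × Space p => ‖dilation p (√(q.1⁻¹)) x -
    expFlow B 1 (dilation p (√(q.1⁻¹)) q.2)‖ := (m1.sub m3).norm
  have m5 : Measurable fun q : ℝ × Space p => q.1 ^ (-s) := measurable_fst.pow_const _
  have m6 : Measurable fun q : ℝ × Space p => Real.exp (-a * ‖dilation p (√(q.1⁻¹)) x -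
    expFlow B 1 (dilation p (√(q.1⁻¹)) q.2)‖ ^ 2) := ((m4.pow_const 2).const_mul (-a)).exp
  unfold gaussBound
  exact Measurable.mul (ENNReal.measurable_ofReal.comp m5) (ENNReal.measurable_ofReal.comp m6)

/-- The truncation only decreases the Gaussian, and the dilation of parameter σ^{-1/2} turns E(σ)
into E(1), so that the flow no longer depends on σ. -/
theorem enorm_kernel_le {n : ℕ} {p : Fin (n + 1) → ℕ} {B P : BlockMatrix p}
    (hB : IsDriftMatrix p B) {s κ c : ℝ} (hκ : 0 < κ)
    (hc : ∀ x : Space p, c * ‖x‖ ^ 2 ≤ ∑ k, ∑ l, P k l * (x k * x l)) (f₀ : ℝ)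
    (z ζ : SpaceTime p) (hσ : 0 < z.2 - ζ.2) :
    ‖kernel P s κ f₀ (shiftMap B (z, ζ))‖ₑ ≤
      gaussBound B s (κ * c) z.1 (z.2 - ζ.2, ζ.1) := by
  rw [gaussBound, Real.enorm_eq_ofReal (kernel_nonneg _ _ _ _ _),
    ← ENNReal.ofReal_mul (Real.rpow_nonneg hσ.le _)]
  refine ENNReal.ofReal_le_ofReal ?_
  have hk : kernel P s κ f₀ (shiftMap B (z, ζ)) =
      cutExp f₀ (logKernel P s κ (shiftMap B (z, ζ))) := if_pos hσ
  rw [hk]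
  refine (cutExp_le_exp _ _).trans ?_
  have e1 : (z.2 - ζ.2) ^ (-s) = Real.exp (-s * Real.log (z.2 - ζ.2)) := by
    rw [Real.rpow_def_of_pos hσ, mul_comm]
  dsimp only
  rw [e1, ← Real.exp_add]
  refine Real.exp_le_exp.2 ?_
  have h2 : dilation p (√((z.2 - ζ.2)⁻¹)) (shiftMap B (z, ζ)).1 =
      dilation p (√((z.2 - ζ.2)⁻¹)) z.1 -
        expFlow B 1 (dilation p (√((z.2 - ζ.2)⁻¹)) ζ.1) := by
    have hr : √((z.2 - ζ.2)⁻¹) ≠ 0 := (Real.sqrt_pos.2 (by positivity)).ne'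
    have h3 := expFlow_dilation hB hr (z.2 - ζ.2) ζ.1
    rw [Real.sq_sqrt (by positivity), inv_mul_cancel₀ hσ.ne'] at h3
    rw [h3, ← map_sub]
    rfl
  have h4 : c * ‖dilation p (√((z.2 - ζ.2)⁻¹)) (shiftMap B (z, ζ)).1‖ ^ 2 ≤
    quadForm P (shiftMap B (z, ζ)) := quadForm_ge_dilation hc (shiftMap B (z, ζ)) hσ
  rw [h2] at h4
  have h5 := mul_le_mul_of_nonneg_left h4 hκ.le
  have h6 : logKernel P s κ (shiftMap B (z, ζ)) =
    -s * Real.log (z.2 - ζ.2) - κ * quadForm P (shiftMap B (z, ζ)) := rfl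
  rw [h6]
  linarith

/-- A linear change of variables of determinant det E(1) · σ^{-Q/2}; the result does not depend on
`x`. -/
theorem lintegral_gaussBound {n : ℕ} {p : Fin (n + 1) → ℕ} (B : BlockMatrix p) (s a : ℝ)
    (x : Space p) {σ : ℝ} (hσ : 0 < σ) :
    ∫⁻ ξ : Space p, gaussBound B s a x (σ, ξ) =
      ENNReal.ofReal |(LinearMap.det (expFlow B 1 : Space p →ₗ[ℝ] Space p))⁻¹| *
        (∫⁻ w : Space p, ENNReal.ofReal (Real.exp (-a * ‖w‖ ^ 2))) *
          ENNReal.ofReal (σ ^ ((homDim p : ℝ) / 2 - s)) := by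
  simp only [gaussBound]
  have hr0 : 0 < √(σ⁻¹) := Real.sqrt_pos.2 (by positivity)
  let L : Space p →ₗ[ℝ] Space p := (expFlow B 1 : Space p →ₗ[ℝ] Space p) ∘ₗ
    (dilation p (√(σ⁻¹)) : Space p →ₗ[ℝ] Space p)
  have hLdet : LinearMap.det L =
      LinearMap.det (expFlow B 1 : Space p →ₗ[ℝ] Space p) * √(σ⁻¹) ^ homDim p := by
    rw [LinearMap.det_comp, det_dilation]
  have hL0 : LinearMap.det L ≠ 0 := by
    rw [hLdet]; exact mul_ne_zero (det_expFlow_ne_zero B 1) (pow_ne_zero _ hr0.ne')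
  rw [lintegral_const_mul' _ _ ENNReal.ofReal_ne_top]
  have h1 := lintegral_comp_sub_linearMap (volume : Measure (Space p)) L hL0
    (dilation p (√(σ⁻¹)) x) (fun w => ENNReal.ofReal (Real.exp (-a * ‖w‖ ^ 2)))
    (by fun_prop)
  have h2 : ∫⁻ ξ : Space p, ENNReal.ofReal (Real.exp (-a * ‖dilation p (√(σ⁻¹)) x -
      expFlow B 1 (dilation p (√(σ⁻¹)) ξ)‖ ^ 2)) = ENNReal.ofReal |(LinearMap.det L)⁻¹| *
        ∫⁻ w : Space p, ENNReal.ofReal (Real.exp (-a * ‖w‖ ^ 2)) := h1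
  rw [h2, hLdet, mul_inv, abs_mul, ENNReal.ofReal_mul (abs_nonneg _)]
  have h3 : |(√(σ⁻¹) ^ homDim p)⁻¹| = σ ^ ((homDim p : ℝ) / 2) := by
    rw [abs_of_pos (by positivity), Real.sqrt_eq_rpow, Real.inv_rpow hσ.le,
      inv_pow, inv_inv, ← Real.rpow_natCast, ← Real.rpow_mul hσ.le]
    congr 1
    ring
  have h4 : σ ^ ((homDim p : ℝ) / 2 - s) = σ ^ (-s) * σ ^ ((homDim p : ℝ) / 2) := by
    rw [← Real.rpow_add hσ]
    congr 1
    ring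
  rw [h3, h4, ENNReal.ofReal_mul (Real.rpow_nonneg hσ.le _)]
  ring

/-- The assumption on `s` makes σ^{Q/2-s} integrable at 0, with integral T^θ/θ up to the time T
elapsed since `t₀`. This power of T later forces the potential to vanish at the bottom of the
cylinder. The constant depends neither on `f₀` nor on `E`. -/
theorem exists_potential_le {n : ℕ} {p : Fin (n + 1) → ℕ} {B P : BlockMatrix p}
    (hB : IsDriftMatrix p B) (hP : P.PosDef) {s κ : ℝ} (hκ : 0 < κ)
    (hs : s < homDim p / 2 + 1) :
    ∃ C : ℝ, 0 < C ∧ ∀ (f₀ t₀ : ℝ) (E : Set (SpaceTime p)) (z : SpaceTime p),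
      MeasurableSet E → (∀ ζ ∈ E, t₀ < ζ.2) → t₀ < z.2 →
      potential B P s κ f₀ E z ≤ C * (z.2 - t₀) ^ ((homDim p : ℝ) / 2 + 1 - s) := by
  obtain ⟨c, hc, hcP⟩ := exists_posDef_lower hP
  obtain ⟨θ, hθdef⟩ : ∃ θ : ℝ, θ = (homDim p : ℝ) / 2 + 1 - s := ⟨_, rfl⟩
  have hθ : 0 < θ := by rw [hθdef]; linarith
  have hθ1 : (homDim p : ℝ) / 2 - s = θ - 1 := by rw [hθdef]; ring
  rw [← hθdef]
  obtain ⟨I, hI⟩ : ∃ I, I = ENNReal.ofReal |(LinearMap.det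
      (expFlow B 1 : Space p →ₗ[ℝ] Space p))⁻¹| *
      (∫⁻ w : Space p, ENNReal.ofReal (Real.exp (-(κ * c) * ‖w‖ ^ 2))) := ⟨_, rfl⟩
  have hIfin : I ≠ ⊤ := hI ▸ ENNReal.mul_ne_top ENNReal.ofReal_ne_top
    (lintegral_exp_neg_mul_norm_sq_lt_top p (by positivity)).ne
  -- The added 1 only makes the constant visibly positive.
  refine ⟨I.toReal / θ + 1, by positivity, fun f₀ t₀ E z hE hEt hz => ?_⟩
  have hT0 : 0 < z.2 - t₀ := by linarith
  let G : ℝ × Space p → ENNReal :=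
    (Ioo 0 (z.2 - t₀) ×ˢ (univ : Set (Space p))).indicator (gaussBound B s (κ * c) z.1)
  let g : SpaceTime p → ENNReal := fun ζ => G (z.2 - ζ.2, ζ.1)
  have hgm : Measurable g := ((measurable_gaussBound B s (κ * c) z.1).indicator
    (measurableSet_Ioo.prod MeasurableSet.univ)).comp
      ((measurable_const.sub measurable_snd).prodMk measurable_fst)
  have hle : ∀ ζ ∈ E, ‖kernel P s κ f₀ (shiftMap B (z, ζ))‖ₑ ≤ g ζ := by
    intro ζ hζ
    by_cases hσ : 0 < z.2 - ζ.2
    · have hmem : (z.2 - ζ.2, ζ.1) ∈ Ioo 0 (z.2 - t₀) ×ˢ (univ : Set (Space p)) :=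
        ⟨⟨hσ, by linarith [hEt ζ hζ]⟩, mem_univ _⟩
      simp only [g, G, indicator_of_mem hmem]
      exact enorm_kernel_le hB hκ hcP f₀ z ζ hσ
    · have hk : kernel P s κ f₀ (shiftMap B (z, ζ)) = 0 := if_neg hσ
      rw [hk]
      simp
  have hinner : ∀ τ : ℝ, ∫⁻ ξ : Space p, g (ξ, τ) = (Ioo 0 (z.2 - t₀)).indicator
      (fun σ : ℝ => I * ENNReal.ofReal (σ ^ (θ - 1))) (z.2 - τ) := by
    intro τ
    by_cases hσ : z.2 - τ ∈ Ioo 0 (z.2 - t₀)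
    · have h1 : ∀ ξ : Space p, g (ξ, τ) = gaussBound B s (κ * c) z.1 (z.2 - τ, ξ) := fun ξ =>
        indicator_of_mem (show (z.2 - τ, ξ) ∈ Ioo 0 (z.2 - t₀) ×ˢ (univ : Set (Space p)) from
          ⟨hσ, mem_univ _⟩) _
      simp_rw [h1]
      rw [lintegral_gaussBound B s _ z.1 hσ.1, indicator_of_mem hσ, hI, hθ1]
    · have h1 : ∀ ξ : Space p, g (ξ, τ) = 0 := fun ξ =>
        indicator_of_notMem (fun h : (z.2 - τ, ξ) ∈ Ioo 0 (z.2 - t₀) ×ˢ (univ : Set (Space p)) =>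
          hσ h.1) _
      simp_rw [h1]
      rw [indicator_of_notMem hσ, lintegral_zero]
  have hbound : ‖potential B P s κ f₀ E z‖ₑ ≤ I * ENNReal.ofReal ((z.2 - t₀) ^ θ / θ) := by
    calc ‖potential B P s κ f₀ E z‖ₑ
        ≤ ∫⁻ ζ in E, ‖kernel P s κ f₀ (shiftMap B (z, ζ))‖ₑ := enorm_integral_le_lintegral_enorm _
      _ ≤ ∫⁻ ζ in E, g ζ := setLIntegral_mono hgm hle
      _ ≤ ∫⁻ ζ, g ζ := setLIntegral_le_lintegral _ _
      _ = ∫⁻ τ : ℝ, ∫⁻ ξ : Space p, g (ξ, τ) := by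
          rw [Measure.volume_eq_prod, lintegral_prod_symm _ hgm.aemeasurable]
      _ = ∫⁻ σ : ℝ, (Ioo 0 (z.2 - t₀)).indicator
            (fun σ : ℝ => I * ENNReal.ofReal (σ ^ (θ - 1))) σ := by
          simp_rw [hinner]
          rw [lintegral_sub_left_eq_self (fun σ : ℝ => (Ioo 0 (z.2 - t₀)).indicator
            (fun σ : ℝ => I * ENNReal.ofReal (σ ^ (θ - 1))) σ)]
      _ = I * ENNReal.ofReal ((z.2 - t₀) ^ θ / θ) := by
          rw [lintegral_indicator measurableSet_Ioo, lintegral_const_mul' _ _ hIfin,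
            lintegral_Ioo_rpow hθ hT0]
  have h1 := ENNReal.toReal_mono (ENNReal.mul_ne_top hIfin ENNReal.ofReal_ne_top) hbound
  rw [toReal_enorm, ENNReal.toReal_mul, ENNReal.toReal_ofReal (by positivity)] at h1
  have hTθ : 0 ≤ (z.2 - t₀) ^ θ := by positivity
  calc potential B P s κ f₀ E z ≤ ‖potential B P s κ f₀ E z‖ := le_abs_self _
    _ ≤ I.toReal * ((z.2 - t₀) ^ θ / θ) := h1
    _ = I.toReal / θ * (z.2 - t₀) ^ θ := by ring
    _ ≤ (I.toReal / θ + 1) * (z.2 - t₀) ^ θ := by gcongr; linarith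

/-! ### The homogeneous norm -/

theorem continuous_blockVec {n : ℕ} {p : Fin (n + 1) → ℕ} (i : Fin (n + 1)) :
    Continuous fun x : Space p => blockVec x i := by
  unfold blockVec
  refine (PiLp.continuous_toLp 2 _).comp (continuous_pi fun a => ?_)
  fun_prop

theorem continuous_homNorm {n : ℕ} {p : Fin (n + 1) → ℕ} :
    Continuous (homNorm : Space p → ℝ) := by
  unfold homNorm
  refine continuous_finsetSum _ fun i _ => ?_
  exact (continuous_blockVec i).norm.rpow_const fun x => Or.inr (by positivity)

theorem norm_sq_eq_sum_blockVec {n : ℕ} {p : Fin (n + 1) → ℕ} (x : Space p) :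
    ‖x‖ ^ 2 = ∑ i, ‖blockVec x i‖ ^ 2 := by
  simp only [EuclideanSpace.norm_sq_eq, Fintype.sum_sigma, blockVec]

theorem rpow_blockVec_le_homNorm {n : ℕ} {p : Fin (n + 1) → ℕ} (x : Space p) (i : Fin (n + 1)) :
    ‖blockVec x i‖ ^ ((1 : ℝ) / (2 * (i : ℕ) + 1)) ≤ homNorm x :=
  Finset.single_le_sum (f := fun i : Fin (n + 1) =>
    ‖blockVec x i‖ ^ ((1 : ℝ) / (2 * (i : ℕ) + 1))) (fun j _ => by positivity) (Finset.mem_univ i)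

theorem homNorm_nonneg {n : ℕ} {p : Fin (n + 1) → ℕ} (x : Space p) : 0 ≤ homNorm x :=
  Finset.sum_nonneg fun i _ => by positivity

theorem norm_blockVec_le {n : ℕ} {p : Fin (n + 1) → ℕ} (x : Space p) (i : Fin (n + 1)) :
    ‖blockVec x i‖ ≤ homNorm x ^ (2 * (i : ℕ) + 1) := by
  have h := pow_le_pow_left₀ (by positivity) (rpow_blockVec_le_homNorm x i) (2 * (i : ℕ) + 1)
  rw [← Real.rpow_natCast, ← Real.rpow_mul (norm_nonneg _)] at h
  have : (1 : ℝ) / (2 * (i : ℕ) + 1) * ((2 * (i : ℕ) + 1 : ℕ) : ℝ) = 1 := by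
    push_cast
    field_simp
  rwa [this, Real.rpow_one] at h

theorem exists_norm_le_of_homNorm_lt {n : ℕ} (p : Fin (n + 1) → ℕ) (ρ : ℝ) :
    ∃ R : ℝ, ∀ x : Space p, homNorm x < ρ → ‖x‖ ≤ R := by
  refine ⟨√(∑ i : Fin (n + 1), (ρ ^ (2 * (i : ℕ) + 1)) ^ 2), fun x hx => ?_⟩
  refine Real.le_sqrt_of_sq_le ?_
  rw [norm_sq_eq_sum_blockVec]
  refine Finset.sum_le_sum fun i _ => pow_le_pow_left₀ (norm_nonneg _) ?_ 2
  exact (norm_blockVec_le x i).trans (pow_le_pow_left₀ (homNorm_nonneg x) hx.le _)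

theorem exists_homNorm_le {n : ℕ} (p : Fin (n + 1) → ℕ) (R : ℝ) :
    ∃ K : ℝ, ∀ x : Space p, ‖x‖ ≤ R → homNorm x ≤ K := by
  obtain ⟨K, hK⟩ := (isCompact_closedBall (0 : Space p) R).bddAbove_image
    continuous_homNorm.continuousOn
  exact ⟨K, fun x hx => hK ⟨x, by simpa using hx, rfl⟩⟩

theorem sigmaMin_pos {n : ℕ} {p : Fin (n + 1) → ℕ} (hp : 1 ≤ p (Fin.last n)) :
    0 < sigmaMin p := by
  have hne : (Metric.sphere (0 : Space p) 1).Nonempty :=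
    ⟨EuclideanSpace.single ⟨Fin.last n, ⟨0, hp⟩⟩ 1, by simp⟩
  obtain ⟨x, hx, hmin⟩ := (isCompact_sphere (0 : Space p) 1).exists_isMinOn hne
    continuous_homNorm.continuousOn
  have h1 : 0 < homNorm x := by
    refine lt_of_le_of_ne (homNorm_nonneg x) fun h => ?_
    have h2 : ‖x‖ ^ 2 = 0 := by
      rw [norm_sq_eq_sum_blockVec]
      refine Finset.sum_eq_zero fun i _ => ?_
      have := norm_blockVec_le x i
      rw [← h, zero_pow (by omega)] at this
      rw [le_antisymm this (norm_nonneg _)]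
      simp
    simp at hx
    rw [hx] at h2
    norm_num at h2
  refine h1.trans_le (le_csInf (hne.image _) ?_)
  rintro _ ⟨y, hy, rfl⟩
  exact hmin hy

/-! ### Normalized cylinders. -/

/-- The product of the open ball of radius `ρ` for the homogeneous norm and a time interval. -/
def box {n : ℕ} (p : Fin (n + 1) → ℕ) (ρ a c : ℝ) : Set (SpaceTime p) :=
  {x : Space p | homNorm x < ρ} ×ˢ Ioo a c

theorem isOpen_box {n : ℕ} (p : Fin (n + 1) → ℕ) (ρ a c : ℝ) : IsOpen (box p ρ a c) :=
  (isOpen_lt continuous_homNorm continuous_const).prod isOpen_Ioo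

theorem isBounded_box {n : ℕ} (p : Fin (n + 1) → ℕ) (ρ a c : ℝ) :
    Bornology.IsBounded (box p ρ a c) := by
  obtain ⟨R, hR⟩ := exists_norm_le_of_homNorm_lt p ρ
  refine ((Metric.isBounded_closedBall (x := (0 : Space p)) (r := R)).prod
    (Metric.isBounded_Ioo a c)).subset ?_
  rintro ⟨x, t⟩ ⟨hx, ht⟩
  exact ⟨by simpa using hR x hx, ht⟩

theorem measureReal_box_pos {n : ℕ} (p : Fin (n + 1) → ℕ) {ρ a c : ℝ} (hρ : 0 < ρ) (hac : a < c) :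
    0 < volume.real (box p ρ a c) := by
  have _ : (volume : Measure (SpaceTime p)).IsAddHaarMeasure :=
    inferInstanceAs (Measure.prod volume volume).IsAddHaarMeasure
  have hne : (box p ρ a c).Nonempty := by
    refine ⟨(0, (a + c) / 2), ?_, ?_, ?_⟩
    · have h0 : homNorm (0 : Space p) = 0 := by
        refine Finset.sum_eq_zero fun i _ => ?_
        have : blockVec (0 : Space p) i = 0 := by ext a; simp [blockVec]
        rw [this, norm_zero, Real.zero_rpow (by positivity)]
      simpa [h0] using hρ
    · show a < (a + c) / 2
      linarith
    · show (a + c) / 2 < c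
      linarith
  exact ENNReal.toReal_pos ((isOpen_box p ρ a c).measure_pos volume hne).ne'
    (isBounded_box p ρ a c).measure_lt_top.ne

/-! ### Bounds for the kernel -/

/-- Compactness: the lag stays away from the singular time 0. -/
theorem exists_le_logKernel {n : ℕ} {p : Fin (n + 1) → ℕ} (B P : BlockMatrix p) (s κ R : ℝ)
    {a c : ℝ} (ha : 0 < a) : ∃ m : ℝ, ∀ x ξ : Space p, ∀ σ ∈ Icc a c, ‖x‖ ≤ R → ‖ξ‖ ≤ R →
      m ≤ logKernel P s κ (x - expFlow B σ ξ, σ) := by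
  let S : Set (Space p × Space p × ℝ) :=
    Metric.closedBall 0 R ×ˢ (Metric.closedBall 0 R ×ˢ Icc a c)
  have hS : IsCompact S :=
    (isCompact_closedBall _ _).prod ((isCompact_closedBall _ _).prod isCompact_Icc)
  let φ : Space p × Space p × ℝ → SpaceTime p := fun q => (q.1 - expFlow B q.2.2 q.2.1, q.2.2)
  have hφ : Continuous φ := by
    have h := (contDiff_expFlow B 0).continuous
    have h2 : Continuous fun q : Space p × Space p × ℝ => expFlow B q.2.2 :=
      h.comp (continuous_snd.comp continuous_snd)
    exact (continuous_fst.sub (h2.clm_apply (continuous_fst.comp continuous_snd))).prodMk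
      (continuous_snd.comp continuous_snd)
  have hc : ContinuousOn (fun q => logKernel P s κ (φ q)) S := by
    intro q hq
    have h0 : (φ q).2 ≠ 0 := (lt_of_lt_of_le ha hq.2.2.1).ne'
    exact ((contDiffAt_logKernel P s κ h0 0).continuousAt.comp hφ.continuousAt).continuousWithinAt
  obtain ⟨m, hm⟩ := hS.bddBelow_image hc
  refine ⟨m, fun x ξ σ hσ hx hξ => hm ⟨(x, ξ, σ), ⟨?_, ?_, hσ⟩, rfl⟩⟩
  · simpa using hx
  · simpa using hξ

/-- For large x the point y = x - E(σ)ξ is far from 0, as ‖E(σ)‖ ≤ 2, and the quadratic form is at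
least c|y|²/σ. This beats -s log σ ≤ s/σ uniformly in σ ≤ b. -/
theorem exists_logKernel_le {n : ℕ} {p : Fin (n + 1) → ℕ} {B P : BlockMatrix p} (hP : P.PosDef)
    {s κ b : ℝ} (hs : 0 ≤ s) (hκ : 0 < κ) (hb : 0 < b)
    (hE : ∀ σ : ℝ, |σ| ≤ b → ‖expFlow B σ‖ ≤ 2) (f₀ ρ : ℝ) :
    ∃ K₀ : ℝ, ∀ x ξ : Space p, ∀ σ : ℝ, 0 < σ → σ ≤ b → homNorm ξ < ρ → K₀ < homNorm x →
      logKernel P s κ (x - expFlow B σ ξ, σ) ≤ f₀ := by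
  obtain ⟨c, hc, hq⟩ := exists_quadForm_lower hP (le_max_left 1 b)
  obtain ⟨R, hR⟩ := exists_norm_le_of_homNorm_lt p ρ
  -- Chosen so that κcY/σ exceeds s/σ + b|f₀|/σ, which bounds -s log σ + |f₀|.
  set Y := (s + b * |f₀|) / (κ * c) + 1 with hY
  have hY1 : 1 ≤ Y := by
    have : 0 ≤ (s + b * |f₀|) / (κ * c) := by positivity
    linarith
  obtain ⟨K₀, hK₀⟩ := exists_homNorm_le p (2 * R + Y)
  refine ⟨K₀, fun x ξ σ hσ hσb hξ hx => ?_⟩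
  have hxn : 2 * R + Y < ‖x‖ := by
    by_contra h
    push Not at h
    exact absurd (hK₀ x h) (not_le.2 hx)
  have hEξ : ‖expFlow B σ ξ‖ ≤ 2 * R := by
    refine ((expFlow B σ).le_opNorm ξ).trans ?_
    have h1 := hE σ (by rwa [abs_of_pos hσ])
    have h2 := hR ξ hξ
    gcongr
  have hy : Y ≤ ‖x - expFlow B σ ξ‖ := by
    have := norm_sub_norm_le x (expFlow B σ ξ)
    linarith
  have hy2 : Y ≤ ‖x - expFlow B σ ξ‖ ^ 2 := by nlinarith
  have h1 := hq (x - expFlow B σ ξ, σ) hσ (hσb.trans (le_max_right _ _))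
  have h2 : κ * (c * Y / σ) ≤ κ * quadForm P (x - expFlow B σ ξ, σ) := by
    refine mul_le_mul_of_nonneg_left (le_trans ?_ h1) hκ.le
    dsimp only
    gcongr
  have h3 : -Real.log σ ≤ 1 / σ := by
    have := Real.log_le_sub_one_of_pos (inv_pos.2 hσ)
    rw [Real.log_inv] at this
    rw [one_div]
    linarith
  have h4 : -s * Real.log σ ≤ s / σ := by
    calc -s * Real.log σ = s * (-Real.log σ) := by ring
      _ ≤ s * (1 / σ) := by gcongr
      _ = s / σ := by ring
  have h5 : κ * (c * Y / σ) = (s + b * |f₀| + κ * c) / σ := by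
    rw [hY]; field_simp
  have h6 : |f₀| ≤ b * |f₀| / σ := by
    rw [le_div_iff₀ hσ, mul_comm]
    gcongr
  have h7 : (s + b * |f₀| + κ * c) / σ = s / σ + b * |f₀| / σ + κ * c / σ := by ring
  have h8 : 0 ≤ κ * c / σ := by positivity
  have h9 := neg_abs_le f₀
  show -s * Real.log σ - κ * quadForm P (x - expFlow B σ ξ, σ) ≤ f₀
  linarith

theorem TwiceDiffAt.const_mul {E : Type*} [NormedAddCommGroup E] [NormedSpace ℝ E]
    {u : E → ℝ} {z : E} (hu : TwiceDiffAt u z) (c : ℝ) :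
    TwiceDiffAt (fun w => c * u w) z ∧ fderiv ℝ (fun w => c * u w) z = c • fderiv ℝ u z ∧
    fderiv ℝ (fderiv ℝ fun w => c * u w) z = c • fderiv ℝ (fderiv ℝ u) z := by
  have he : fderiv ℝ (fun w => c * u w) =ᶠ[𝓝 z] fun w => c • fderiv ℝ u w := by
    filter_upwards [hu.1] with w h1
    exact fderiv_const_mul h1 c
  refine ⟨⟨?_, ?_⟩, he.self_of_nhds, ?_⟩
  · filter_upwards [hu.1] with w h1
    exact h1.const_mul c
  · exact (hu.2.const_smul c).congr_of_eventuallyEq he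
  · rw [he.fderiv_eq]
    exact fderiv_const_smul hu.2 c

/-! ### The growth lemma in normalized cylinders -/

theorem growth_of_potential {n : ℕ} {p : Fin (n + 1) → ℕ} {B P : BlockMatrix p}
    (hB : IsDriftMatrix p B) (hP : IsLyapunov B P) {lam Lam : ℝ} (hlam : 0 < lam)
    {f₀ b C C₁ θ c₀ K₀ K : ℝ} (hb : 0 < b) (hC : 0 < C) (hθ : 0 < θ) (hC₁ : C₁ = C * b ^ θ)
    (hc₀ : 0 ≤ c₀) (hK : K₀ < K) {E D : Set (SpaceTime p)} {U u : SpaceTime p → ℝ}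
    {A : SpaceTime p → BlockMatrix p}
    (hU : U = potential B P (Lam * homDim p / (2 * lam)) (1 / (4 * lam)) f₀ E)
    (hEm : MeasurableSet E) (hEb : Bornology.IsBounded E) (hED : Disjoint E D)
    (hUle : ∀ z : SpaceTime p, -b < z.2 → U z ≤ C * (z.2 + b) ^ θ)
    (hUzero : ∀ z : SpaceTime p, z.2 < 0 → K₀ < homNorm z.1 → U z = 0)
    (hA : ∀ z ∈ D, IsAdmissible lam Lam (A z)) (hD : IsOpen D) (hDK : D ⊆ box p K (-b) 0)
    (hu : ContDiffOn ℝ 2 u D) (huc : ContinuousOn u (closure D)) (hu0 : ∀ z ∈ D, 0 ≤ u z)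
    (hub : ∀ z ∈ frontier D ∩ box p K (-b) 0, u z = 0) (hL : ∀ z ∈ D, 0 ≤ opL B A u z)
    {z : SpaceTime p} (hz : z ∈ D) (hzU : c₀ ≤ U z) :
    (1 + c₀ / C₁) * u z ≤ sSup (u '' D) := by
  have hbθ : 0 < b ^ θ := Real.rpow_pos_of_pos hb θ
  have hC₁0 : 0 < C₁ := by rw [hC₁]; positivity
  have hDb : Bornology.IsBounded D := (isBounded_box p K (-b) 0).subset hDK
  have hbdd : BddAbove (u '' D) :=
    (hDb.isCompact_closure.bddAbove_image huc).mono (image_mono subset_closure)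
  set m := sSup (u '' D) with hm
  have hum : ∀ w ∈ D, u w ≤ m := fun w hw => le_csSup hbdd ⟨w, hw, rfl⟩
  have hm0 : 0 ≤ m := (hu0 z hz).trans (hum z hz)
  have hUC : ∀ w ∈ D, U w ≤ C₁ := by
    intro w hw
    have hwt := (hDK hw).2
    refine (hUle w hwt.1).trans ?_
    rw [hC₁]
    have h1 : 0 ≤ w.2 + b := by linarith [hwt.1]
    have h2 : w.2 + b ≤ b := by linarith [hwt.2]
    gcongr
  have hdU : ∀ w ∈ D, TwiceDiffAt U w ∧ 0 ≤ secondOrder (A w) (fderiv ℝ (fderiv ℝ U) w) +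
      fderiv ℝ U w (driftVec B w) := by
    intro w hw
    -- `E` may accumulate at the boundary of `D`, but `closure E \ D` is compact, contains `E` and
    -- misses `D`.
    have hS : IsCompact (closure E \ D) := hEb.isCompact_closure.diff hD
    refine potential_subsolution hB hP hlam f₀ hD hS disjoint_sdiff_left hEm ?_ (hA w hw) hw hU
    exact fun ζ hζ => ⟨subset_closure hζ, fun h => hED.ne_of_mem hζ h rfl⟩
  have hdu : ∀ w ∈ D, TwiceDiffAt u w := fun w hw =>
    (hu.contDiffAt (hD.mem_nhds hw)).twiceDiffAt
  have hmax := le_of_subsolution (B := B) (A := A) (v := fun w => u w + m / C₁ * U w) (m := m)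
    (t₀ := -b) hD hDb (fun w hw => ⟨(hDK hw).2.1.le, (hDK hw).2.2⟩)
    (fun w hw => (hA w hw).posSemidef hlam.le)
    (fun w hw => ((hdu w hw).add ((hdU w hw).1.const_mul (m / C₁)).1).1) ?_ ?_ z hz
  · have h1 : m / C₁ * c₀ ≤ m / C₁ * U z := by gcongr
    have h2 : u z ≤ m * (1 - c₀ / C₁) := by
      have : m * (1 - c₀ / C₁) = m - m / C₁ * c₀ := by ring
      linarith
    have h3 : 0 ≤ c₀ / C₁ := by positivity
    -- The bound u ≤ m(1 - x) is traded for (1 + x)u ≤ m at the cost of the square -m x².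
    calc (1 + c₀ / C₁) * u z ≤ (1 + c₀ / C₁) * (m * (1 - c₀ / C₁)) := by gcongr
      _ = m - m * (c₀ / C₁) ^ 2 := by ring
      _ ≤ m := by
          have : 0 ≤ m * (c₀ / C₁) ^ 2 := by positivity
          linarith
  · intro w hw
    obtain ⟨t1, e1, e2⟩ := (hdU w hw).1.const_mul (m / C₁)
    obtain ⟨-, e3, e4⟩ := (hdu w hw).add t1
    rw [e3, e4, e1, e2, map_add, map_smul]
    have h1 := hL w hw
    rw [(hdu w hw).opL_eq] at h1
    have h2 := mul_nonneg (show 0 ≤ m / C₁ by positivity) (hdU w hw).2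
    simp only [add_apply, smul_apply, smul_eq_mul]
    linarith
  · intro w hw hwt ε hε
    have hwK : homNorm w.1 ≤ K ∧ -b ≤ w.2 := by
      have hcl : IsClosed {w : SpaceTime p | homNorm w.1 ≤ K ∧ -b ≤ w.2} :=
        (isClosed_le (continuous_homNorm.comp continuous_fst) continuous_const).inter
          (isClosed_le continuous_const continuous_snd)
      have hsub : D ⊆ {w : SpaceTime p | homNorm w.1 ≤ K ∧ -b ≤ w.2} := fun y hy =>
        ⟨(show homNorm y.1 < K from (hDK hy).1).le, (hDK hy).2.1.le⟩
      exact closure_minimal hsub hcl hw.1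
    -- Three kinds of boundary points. At the bottom, `U` tends to 0 and `u ≤ m`.
    rcases hwK.2.eq_or_lt with hwb | hwb
    · have hcont : Continuous fun y : SpaceTime p => m / C₁ * (C * (y.2 + b) ^ θ) :=
        continuous_const.mul (continuous_const.mul ((continuous_snd.add continuous_const).rpow_const
          fun y => Or.inr hθ.le))
      have h0 : m / C₁ * (C * (w.2 + b) ^ θ) < ε := by
        rw [← hwb, neg_add_cancel, Real.zero_rpow hθ.ne']
        simpa using hε
      filter_upwards [nhdsWithin_le_nhds (hcont.continuousAt.eventually (gt_mem_nhds h0)),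
        self_mem_nhdsWithin] with y hy hyD
      have h1 := hum y hyD
      have h2 : m / C₁ * U y ≤ m / C₁ * (C * (y.2 + b) ^ θ) := by
        have := hUle y (hDK hyD).2.1
        gcongr
      linarith
    · rcases hwK.1.eq_or_lt with hwK' | hwK'
      -- On the lateral side, `U` is already zero nearby because `K₀ < K`.
      · have h0 : K₀ < homNorm w.1 := by rwa [hwK']
        have hc : Continuous fun y : SpaceTime p => homNorm y.1 :=
          continuous_homNorm.comp continuous_fst
        filter_upwards [nhdsWithin_le_nhds (hc.continuousAt.eventually (lt_mem_nhds h0)),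
          self_mem_nhdsWithin] with y hy hyD
        rw [hUzero y (hDK hyD).2.2 hy]
        linarith [hum y hyD]
      -- Inside the cylinder, `u` tends to 0 and `(m / C₁) U ≤ m`.
      · have hu0' : u w = 0 := hub w ⟨hw, hwK', hwb, hwt⟩
        have hcw : Tendsto u (𝓝[D] w) (𝓝 (u w)) :=
          (huc w hw.1).mono_left (nhdsWithin_mono w subset_closure)
        rw [hu0'] at hcw
        filter_upwards [hcw.eventually (gt_mem_nhds hε), self_mem_nhdsWithin] with y hy hyD
        have h2 : m / C₁ * U y ≤ m / C₁ * C₁ := by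
          have := hUC y hyD
          gcongr
        rw [div_mul_cancel₀ _ hC₁0.ne'] at h2
        linarith

/-- The kernel, and with it η, is chosen independently of `K`; the potential vanishes beyond `K₀`
whatever `K > K₀` is. -/
theorem growth_normalized {n : ℕ} {p : Fin (n + 1) → ℕ} {B : BlockMatrix p}
    (hB : IsDriftMatrix p B) {b : ℝ} (hb : IsTimeConstant B b) {lam Lam : ℝ} (hlam : 0 < lam)
    (hLam : 0 < Lam) (hLl : Lam / lam < 1 + 2 / (homDim p : ℝ)) :
    ∃ K₀ : ℝ, sigmaMin p < K₀ ∧ ∃ η : ℝ, 0 < η ∧ ∀ K : ℝ, K₀ < K →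
      ∀ (A : SpaceTime p → BlockMatrix p) (D : Set (SpaceTime p)) (u : SpaceTime p → ℝ),
        (∀ z ∈ D, IsAdmissible lam Lam (A z)) → IsOpen D → D ⊆ box p K (-b) 0 →
        (D ∩ box p (sigmaMin p) (-(1 / 4 * b)) 0).Nonempty →
        ContDiffOn ℝ 2 u D → ContinuousOn u (closure D) → (∀ z ∈ D, 0 ≤ u z) →
        (∀ z ∈ frontier D ∩ box p K (-b) 0, u z = 0) → (∀ z ∈ D, 0 ≤ opL B A u z) →
        (1 + η * (volume.real (box p (sigmaMin p) (-b) (-(1 / 2 * b)) \ D) /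
          volume.real (box p (sigmaMin p) (-b) (-(1 / 2 * b))))) *
            sSup (u '' (D ∩ box p (sigmaMin p) (-(1 / 4 * b)) 0)) ≤ sSup (u '' D) := by
  obtain ⟨hb0, -, hE2⟩ := hb
  obtain ⟨P, hP1, hP2, hP3⟩ := exists_lyapunov hB
  have hP : IsLyapunov B P := ⟨hP1, hP2, hP3⟩
  have hσ0 := sigmaMin_pos hB.one_le_last
  have hQ : 0 < (homDim p : ℝ) := by
    have h1 : 0 < homDim p := by
      refine Finset.sum_pos' (fun i _ => Nat.zero_le _) ⟨Fin.last n, Finset.mem_univ _, ?_⟩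
      have := hB.one_le_last
      positivity
    exact_mod_cast h1
  obtain ⟨s, hs⟩ : ∃ s, s = Lam * homDim p / (2 * lam) := ⟨_, rfl⟩
  obtain ⟨κ, hκ⟩ : ∃ κ, κ = 1 / (4 * lam) := ⟨_, rfl⟩
  have hκ0 : 0 < κ := by rw [hκ]; positivity
  have hs0 : 0 ≤ s := by rw [hs]; positivity
  have hsQ : s < homDim p / 2 + 1 := by
    have h1 : s = homDim p / 2 * (Lam / lam) := by rw [hs]; field_simp
    have h2 : (homDim p : ℝ) / 2 * (1 + 2 / homDim p) = homDim p / 2 + 1 := by field_simp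
    rw [h1, ← h2]
    gcongr
  have hθ : 0 < (homDim p : ℝ) / 2 + 1 - s := by linarith
  obtain ⟨R, hR⟩ := exists_norm_le_of_homNorm_lt p (sigmaMin p)
  -- Times in (-b/4, 0) and in (-b, -b/2) differ by between b/4 and b. Truncating at level `m - 1`
  -- then leaves a kernel bounded below by the positive number `cutExp (m - 1) m`.
  obtain ⟨m, hm⟩ := exists_le_logKernel B P s κ R (a := 1 / 4 * b) (c := b) (by positivity)
  have hc₀ : 0 < cutExp (m - 1) m := cutExp_pos (by linarith)
  obtain ⟨K₁, hK₁⟩ := exists_logKernel_le (s := s) hP1 hs0 hκ0 hb0 hE2 (m - 1) (sigmaMin p)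
  obtain ⟨C, hC, hpot⟩ := exists_potential_le (s := s) hB hP1 hκ0 hsQ
  have hV := measureReal_box_pos p (ρ := sigmaMin p) (a := -b) (c := -(1 / 2 * b)) hσ0
    (by linarith)
  have hbθ : 0 < b ^ ((homDim p : ℝ) / 2 + 1 - s) := Real.rpow_pos_of_pos hb0 _
  refine ⟨max (sigmaMin p + 1) K₁, lt_max_of_lt_left (by linarith),
    cutExp (m - 1) m * volume.real (box p (sigmaMin p) (-b) (-(1 / 2 * b))) /
      (C * b ^ ((homDim p : ℝ) / 2 + 1 - s)), by positivity, ?_⟩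
  intro K hK A D u hA hD hDK hne hu huc hu0 hub hL
  set Q₃ := box p (sigmaMin p) (-b) (-(1 / 2 * b)) with hQ₃
  have hEb : Bornology.IsBounded (Q₃ \ D) := (isBounded_box p _ _ _).subset sdiff_subset
  have hEm : MeasurableSet (Q₃ \ D) := (isOpen_box p _ _ _).measurableSet.diff hD.measurableSet
  have hED : Disjoint (Q₃ \ D) D := disjoint_sdiff_left
  have _ : (volume : Measure (SpaceTime p)).IsAddHaarMeasure :=
    inferInstanceAs (Measure.prod volume volume).IsAddHaarMeasure
  have hUzero : ∀ z : SpaceTime p, z.2 < 0 → max (sigmaMin p + 1) K₁ < homNorm z.1 →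
      potential B P s κ (m - 1) (Q₃ \ D) z = 0 := by
    intro z hz hzK
    refine setIntegral_eq_zero_of_forall_eq_zero fun ζ hζ => ?_
    unfold kernel
    split_ifs with hσ
    · have hσ' : 0 < z.2 - ζ.2 := hσ
      refine cutExp_eq_zero (hK₁ z.1 ζ.1 (z.2 - ζ.2) hσ' ?_ hζ.1.1
        ((le_max_right _ _).trans_lt hzK))
      have := hζ.1.2.1
      linarith
    · rfl
  have hUle : ∀ z : SpaceTime p, -b < z.2 → potential B P s κ (m - 1) (Q₃ \ D) z ≤
      C * (z.2 + b) ^ ((homDim p : ℝ) / 2 + 1 - s) := by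
    intro z hz
    have := hpot (m - 1) (-b) (Q₃ \ D) z hEm (fun ζ hζ => hζ.1.2.1) hz
    rwa [sub_neg_eq_add] at this
  have hUge : ∀ z ∈ D ∩ box p (sigmaMin p) (-(1 / 4 * b)) 0,
      cutExp (m - 1) m * volume.real (Q₃ \ D) ≤ potential B P s κ (m - 1) (Q₃ \ D) z := by
    rintro z ⟨hzD, hz2⟩
    have hkint : IntegrableOn (fun ζ => kernel P s κ (m - 1) (shiftMap B (z, ζ))) (Q₃ \ D) := by
      have hS : IsCompact (closure Q₃ \ D) := (isBounded_box p _ _ _).isCompact_closure.diff hD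
      refine IntegrableOn.mono_set (ContinuousOn.integrableOn_compact hS ?_)
        (sdiff_subset_sdiff_left subset_closure)
      refine (contDiffOn_kernel_shiftMap B hP1 s hκ0 (m - 1)).continuousOn.comp
        (by fun_prop) fun ζ hζ (h : z = ζ) => hζ.2 (h ▸ hzD)
    refine setIntegral_ge_of_const_le_real hEm (hEb.measure_lt_top).ne (fun ζ hζ => ?_) hkint
    have hζt := hζ.1.2
    have hzt := hz2.2
    have hσ : z.2 - ζ.2 ∈ Icc (1 / 4 * b) b :=
      ⟨by linarith [hζt.2, hzt.1], by linarith [hζt.1, hzt.2]⟩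
    have hk : kernel P s κ (m - 1) (shiftMap B (z, ζ)) =
        cutExp (m - 1) (logKernel P s κ (shiftMap B (z, ζ))) :=
      if_pos (show 0 < z.2 - ζ.2 by linarith [hσ.1])
    rw [hk]
    exact monotone_cutExp _ (hm z.1 ζ.1 _ hσ (hR _ hz2.1) (hR _ hζ.1.1))
  have hkey : ∀ z ∈ D ∩ box p (sigmaMin p) (-(1 / 4 * b)) 0,
      (1 + cutExp (m - 1) m * volume.real (Q₃ \ D) / (C * b ^ ((homDim p : ℝ) / 2 + 1 - s))) *
        u z ≤ sSup (u '' D) := fun z hz =>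
    growth_of_potential hB hP hlam hb0 hC hθ rfl (by positivity) hK (by rw [hs, hκ]) hEm hEb hED
      hUle hUzero hA hD hDK hu huc hu0 hub hL hz.1 (hUge z hz)
  -- η times the density of E in 𝒬³ is the ratio c₀/C₁ of `growth_of_potential`.
  have he : cutExp (m - 1) m * volume.real Q₃ / (C * b ^ ((homDim p : ℝ) / 2 + 1 - s)) *
      (volume.real (Q₃ \ D) / volume.real Q₃) =
      cutExp (m - 1) m * volume.real (Q₃ \ D) / (C * b ^ ((homDim p : ℝ) / 2 + 1 - s)) := by
    field_simp
  rw [he, mul_comm, ← le_div_iff₀ (by positivity)]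
  refine csSup_le (hne.image u) ?_
  rintro _ ⟨z, hz, rfl⟩
  rw [le_div_iff₀ (by positivity), mul_comm]
  exact hkey z hz

/-! ### Transfer to cylinders of arbitrary centre and radius. -/

theorem cyl1_eq_image {n : ℕ} {p : Fin (n + 1) → ℕ} (B : BlockMatrix p) (b K : ℝ) {r : ℝ}
    (hr : 0 < r) (z₀ : SpaceTime p) :
    cyl1 B b K r z₀ = affineMap B z₀ r '' box p K (-b) 0 := by
  have h := cylinder_eq_image B z₀ hr K (-b) 0
  rwa [neg_mul, zero_mul] at h

theorem cyl2_eq_image {n : ℕ} {p : Fin (n + 1) → ℕ} (B : BlockMatrix p) (b : ℝ) {r : ℝ}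
    (hr : 0 < r) (z₀ : SpaceTime p) :
    cyl2 B b r z₀ = affineMap B z₀ r '' box p (sigmaMin p) (-(1 / 4 * b)) 0 := by
  have h := cylinder_eq_image B z₀ hr (sigmaMin p) (-(1 / 4 * b)) 0
  rwa [neg_mul, zero_mul] at h

theorem cyl3_eq_image {n : ℕ} {p : Fin (n + 1) → ℕ} (B : BlockMatrix p) (b : ℝ) {r : ℝ}
    (hr : 0 < r) (z₀ : SpaceTime p) :
    cyl3 B b r z₀ = affineMap B z₀ r '' box p (sigmaMin p) (-b) (-(1 / 2 * b)) := by
  have h := cylinder_eq_image B z₀ hr (sigmaMin p) (-b) (-(1 / 2 * b))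
  rwa [neg_mul, neg_mul] at h

end

end Kolmogorov

open Kolmogorov Set MeasureTheory

theorem theorem5p1 {n : ℕ} (p : Fin (n + 1) → ℕ) (B : Kolmogorov.BlockMatrix p)
    (hB : Kolmogorov.IsDriftMatrix p B) (b : ℝ) (hb : Kolmogorov.IsTimeConstant B b)
    (lam Lam : ℝ) :
    ∃ K₀ : ℝ, Kolmogorov.sigmaMin p < K₀ ∧ ∀ K : ℝ, K₀ < K → ∃ η : ℝ, 0 < η ∧
      ∀ (Ω : Set (Kolmogorov.SpaceTime p)) (A : Kolmogorov.SpaceTime p → Kolmogorov.BlockMatrix p)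
        (z₀ : Kolmogorov.SpaceTime p) (r : ℝ) (D : Set (Kolmogorov.SpaceTime p))
        (u : Kolmogorov.SpaceTime p → ℝ),
        IsOpen Ω → Kolmogorov.CordesLandis Ω lam Lam A → z₀ ∈ Ω → 0 < r →
        IsOpen D → D ⊆ Kolmogorov.cyl1 B b K r z₀ → Kolmogorov.cyl1 B b K r z₀ ⊆ Ω →
        (D ∩ Kolmogorov.cyl2 B b r z₀).Nonempty →
        ContDiffOn ℝ 2 u D → ContinuousOn u (closure D) →
        (∀ z ∈ D, 0 ≤ u z) →
        (∀ z ∈ frontier D ∩ Kolmogorov.cyl1 B b K r z₀, u z = 0) →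
        (∀ z ∈ D, 0 ≤ Kolmogorov.opL B A u z) →
        sSup (u '' D) ≥
          (1 + η * (MeasureTheory.volume.real (Kolmogorov.cyl3 B b r z₀ \ D) /
              MeasureTheory.volume.real (Kolmogorov.cyl3 B b r z₀))) *
            sSup (u '' (D ∩ Kolmogorov.cyl2 B b r z₀)) := by
  -- If the constants violate the condition, no coefficients are admitted and any `K₀ > σ₀` and `η >
  -- 0` will do.
  by_cases hell : 0 < lam ∧ 0 < Lam ∧ Lam / lam < 1 + 2 / (homDim p : ℝ)
  swap
  · refine ⟨sigmaMin p + 1, by linarith, fun K _ => ⟨1, one_pos, ?_⟩⟩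
    intro Ω A z₀ r D u _ hCL
    exact absurd ⟨hCL.1, hCL.2.1, hCL.2.2.2⟩ hell
  obtain ⟨K₀, hK₀, η, hη, hmain⟩ := growth_normalized hB hb hell.1 hell.2.1 hell.2.2
  refine ⟨K₀, hK₀, fun K hK => ⟨η, hη, ?_⟩⟩
  intro Ω A z₀ r D u _ hCL _ hr hD hDK hKΩ hne hu huc hu0 hub hL
  let Φ := affineHomeo B z₀ hr.ne'
  have hΦ : ⇑Φ = affineMap B z₀ r := rfl
  have hΦc : ContDiff ℝ 2 Φ := contDiff_affineMap B z₀ r 2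
  have h1 : cyl1 B b K r z₀ = Φ '' box p K (-b) 0 := cyl1_eq_image B b K hr z₀
  have h2 : cyl2 B b r z₀ = Φ '' box p (sigmaMin p) (-(1 / 4 * b)) 0 := cyl2_eq_image B b hr z₀
  have h3 : cyl3 B b r z₀ = Φ '' box p (sigmaMin p) (-b) (-(1 / 2 * b)) := cyl3_eq_image B b hr z₀
  have hDimg : Φ '' (Φ ⁻¹' D) = D := image_preimage_eq D Φ.surjective
  have hadm : ∀ z ∈ D, IsAdmissible lam Lam (A z) := fun z hz =>
    hCL.2.2.1.isAdmissible (hKΩ (hDK hz))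
  have key := hmain K hK (fun ζ => A (Φ ζ)) (Φ ⁻¹' D) (fun ζ => u (Φ ζ))
    (fun ζ hζ => hadm _ hζ) (hD.preimage Φ.continuous) ?_ ?_ ?_ ?_ (fun ζ hζ => hu0 _ hζ) ?_ ?_
  · have e1 : (fun ζ => u (Φ ζ)) '' (Φ ⁻¹' D) = u '' D := by
      rw [← hDimg, ← image_comp, hDimg]
      rfl
    have e2 : (fun ζ => u (Φ ζ)) '' (Φ ⁻¹' D ∩ box p (sigmaMin p) (-(1 / 4 * b)) 0) =
        u '' (D ∩ cyl2 B b r z₀) := by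
      have : D ∩ cyl2 B b r z₀ =
          Φ '' (Φ ⁻¹' D ∩ box p (sigmaMin p) (-(1 / 4 * b)) 0) := by
        rw [image_inter Φ.injective, hDimg, h2]
      rw [this, ← image_comp]
      rfl
    have e3 : cyl3 B b r z₀ \ D =
        Φ '' (box p (sigmaMin p) (-b) (-(1 / 2 * b)) \ (Φ ⁻¹' D)) := by
      rw [image_sdiff Φ.injective, hDimg, h3]
    obtain ⟨c, hc, hvol⟩ := exists_volume_image_affineMap B z₀ hr.ne'
    rw [← hΦ] at hvol
    have hm3 : MeasurableSet (box p (sigmaMin p) (-b) (-(1 / 2 * b))) :=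
      (isOpen_box p _ _ _).measurableSet
    rw [e1, e2] at key
    -- The volume factor of the change of variables cancels in the quotient.
    rw [e3, h3, hvol _ (hm3.diff (hD.preimage Φ.continuous).measurableSet), hvol _ hm3,
      mul_div_mul_left _ _ hc.ne']
    exact key
  · intro ζ hζ
    have := hDK hζ
    rw [h1] at this
    exact Φ.injective.mem_set_image.1 this
  · obtain ⟨z, hzD, hz2⟩ := hne
    rw [h2] at hz2
    obtain ⟨ζ, hζ, rfl⟩ := hz2
    exact ⟨ζ, hzD, hζ⟩
  · exact hu.comp hΦc.contDiffOn fun ζ hζ => hζ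
  · refine huc.comp Φ.continuous.continuousOn fun ζ hζ => ?_
    rwa [← Φ.preimage_closure] at hζ
  · rintro ζ ⟨hζ, hζ1⟩
    rw [← Φ.preimage_frontier] at hζ
    exact hub _ ⟨hζ, by rw [h1]; exact ⟨ζ, hζ1, rfl⟩⟩
  · intro ζ hζ
    have hζD : affineMap B z₀ r ζ ∈ D := hζ
    -- The operator at ζ only sees the coefficients at ζ, so they may be frozen there.
    have := opL_comp_affineMap hB z₀ r (A (Φ ζ)) (hadm _ hζ).supp u ζ
      (hu.contDiffAt (hD.mem_nhds hζD)).twiceDiffAt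
    have h5 : 0 ≤ opL B (fun _ => A (Φ ζ)) u (affineMap B z₀ r ζ) := hL _ hζ
    change 0 ≤ opL B (fun _ => A (Φ ζ)) (fun ξ => u (affineMap B z₀ r ξ)) ζ
    rw [this]
    positivity
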